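/- **Definitions.** All manifolds, bundles and maps are smooth. A *Courant algebroid* (CA) is a vector bundle $E\to M$ with a nondegenerate symmetric fibrewise pairing $\langle\,,\rangle$, an anchor $\rho:E\to TM$ and an $\mathbb R$-bilinear bracket on $\Gamma(E)$ such that, with $u\cdot f:=\rho(u)f$ and $\langle u,d_Ef\rangle=u\cdot f$: $[u,[v,w]]=[[u,v],w]+[v,[u,w]]$, $[u,fv]=f[u,v]+(u\cdot f)v$, $u\cdot\langle v,w\rangle=\langle[u,v],w\rangle+\langle v,[u,w]\rangle$, $[u,v]+[v,u]=d_E\langle u,v\rangle$. A *generalized pseudometric* is a subbundle $V_+\subset E$ on which $\langle\,,\rangle$ is nondegenerate; $V_-:=V_+^\perp$, and subscripts $\pm$ denote the orthogonal projections. A *divergence* is an $\mathbb R$-linear map $\operatorname{div}:\Gamma(E)\to C^\infty(M)$ with $\operatorname{div}(fa)=f\operatorname{div}a+a\cdot f$; for a nowhere vanishing density $\mu$ put $\operatorname{div}_\mu a=\mu^{-1}L_{\rho(a)}\mu$. For $a\in\Gamma(V_+)$, $b\in\Gamma(V_-)$, $$\mathrm{GRic}_{V_+,\operatorname{div}}(a,b)=\operatorname{div}[b,a]_+-b\cdot\operatorname{div}a-\operatorname{Tr}_{V_+}[[\,\cdot\,,b]_-,a]_+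 .$$ With local frames $e_a$ of $V_+$ and $e_{\bar a}$ of $V_-$ having constant pairings, and $c_{\alpha\beta\gamma}=\langle e_\alpha,[e_\beta,e_\gamma]\rangle$, let $\Delta_{V_+}=4L_{\rho(e^a)}L_{\rho(e_a)}-\frac16c_{abc}c^{abc}-\frac12c_{ab\bar c}c^{ab\bar c}$, acting on half-densities. Then $$\mathcal R_{V_+,\operatorname{div}}=\sigma^{-1}\Delta_{V_+}\sigma+\langle e_+,e_+\rangle+2\operatorname{div}_{\sigma^2}e_+,\qquad \operatorname{div}-\operatorname{div}_{\sigma^2}=\langle e,\cdot\rangle ,$$ for any nonvanishing half-density $\sigma$ (the result does not depend on $\sigma$ or on the frames). The *generalized string background equations* for $(V_+,\operatorname{div})$ are $\mathrm{GRic}_{V_+,\operatorname{div}}=0$ and $\mathcal R_{V_+,\operatorname{div}}=0$. Let $\mathfrak s$ be the Lie algebra of a connected Lie group $\mathsf S$. The CA $E$ is *$\mathfrak s$-equivariant* if it is equipped with a linear map $\chi:\mathfrak s\to\Gamma(E)$, injective at every point, with $[\chi(s),\chi(t)]=\chi([s,t])$ and $\langle\chi(s),\chi(t)\rangle=0$;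 let $\mathfrak s_E\subset\mathfrak s_E^\perp\subset E$ be the subbundles with fibres $\chi(\mathfrak s)$ and $\chi(\mathfrak s)^\perp$. $V_+$ is *admissible* if $[\chi(s),\Gamma(V_+)]\subset\Gamma(V_+)$ for all $s$ and $V_+\subset\mathfrak s_E^\perp$. The divergence is *equivariant* if $\chi(s)\cdot\operatorname{div}u=\operatorname{div}[\chi(s),u]$ and $\operatorname{div}\chi(s)=-\operatorname{Tr}_{\mathfrak s}\mathrm{ad}_s$ for all $s\in\mathfrak s$, $u\in\Gamma(E)$. **Theorem.** Let $E\to M$ be an $\mathfrak s$-equivariant CA, $V_+\subset E$ an admissible generalized pseudometric and $\operatorname{div}$ an equivariant divergence such that $\mathrm{GRic}_{V_+,\operatorname{div}}=0$ and $\mathcal R_{V_+,\operatorname{div}}=0$. Let $\tau:M'\to M$ be a smooth map and let $E'=\tau^*E$ carry a CA structure with $\langle\tau^*u,\tau^*v\rangle'=\tau^*\langle u,v\rangle$, $[\tau^*u,\tau^*v]'=\tau^*[u,v]$ and $\tau_*(\rho'(\tau^*u))=\rho(u)$; it is $\mathfrak s$-equivariant with $\chi'(s)=\tau^*\chi(s)$.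 Suppose that the action of $\mathfrak s$ on $M'$ by the vector fields $\rho'(\chi'(s))$ integrates to a free and proper action of $\mathsf S$, let $\pi:M'\to M'_{\mathrm{red}}=M'/\mathsf S$ be the projection to the quotient manifold, and let $E'_{\mathrm{red}}\to M'_{\mathrm{red}}$ be the reduced CA: its fibre at $\pi(x)$ is identified with $(\mathfrak s_{E'}^\perp/\mathfrak s_{E'})_x$, its sections are $\Gamma(\mathfrak s_{E'}^\perp)^{\mathfrak s}/\Gamma(\mathfrak s_{E'})^{\mathfrak s}$, and its pairing, anchor and bracket are induced by those of $E'$. Then there are a divergence $\operatorname{div}'$ on $E'$ with $\operatorname{div}'(\tau^*u)=\tau^*(\operatorname{div}u)$ for all $u\in\Gamma(E)$, a generalized pseudometric $V'_{+,\mathrm{red}}\subset E'_{\mathrm{red}}$ whose fibre at $\pi(x)$ is the image of $(\tau^*V_+)_x$, and a divergence $\operatorname{div}'_{\mathrm{red}}$ on $E'_{\mathrm{red}}$ to which $\operatorname{div}'$ descends, i.e. $\pi^*(\operatorname{div}'_{\mathrm{red}}\tilde u)=\operatorname{div}'u$ whenever $u\in\Gamma(\mathfrak s_{E'}^\perp)^{\mathfrak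 s}$ has class $\tilde u$. Any such pair satisfies the generalized string background equations: $\mathrm{GRic}_{V'_{+,\mathrm{red}},\operatorname{div}'_{\mathrm{red}}}=0$ and $\mathcal R_{V'_{+,\mathrm{red}},\operatorname{div}'_{\mathrm{red}}}=0$. -/

import Mathlib

open Bundle Manifold Filter Topology Module
open scoped ContDiff

noncomputable section

namespace CourantT

section Base

variable {n : ℕ} {M : Type*} [TopologicalSpace M] [ChartedSpace (EuclideanSpace ℝ (Fin n)) M]
  [IsManifold (𝓡 n) ∞ M] {F : Type*} [NormedAddCommGroup F] [NormedSpace ℝ F]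
  {E : M → Type*} [TopologicalSpace (TotalSpace F E)] [∀ x, TopologicalSpace (E x)]
  [∀ x, AddCommGroup (E x)] [∀ x, Module ℝ (E x)] [FiberBundle F E] [VectorBundle ℝ F E]

variable (n F E) in
/-- The space `Γ(E)` of smooth sections of the vector bundle `E → M`, where `dim M = n`. -/
abbrev Sec := Cₛ^∞⟮𝓡 n; F, E⟯

/-- The derivative `X f` of a function `f` along a tangent vector `X`. -/
def deriveAlong {p : M} (X : TangentSpace (𝓡 n) p) (f : M → ℝ) : ℝ :=
  (mfderiv (𝓡 n) 𝓘(ℝ, ℝ) f p X : ℝ)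

/-- The product `f u` of a smooth function and a smooth section. -/
def mulSec (f : C^∞⟮𝓡 n, M; ℝ⟯) (u : Sec n F E) : Sec n F E :=
  ⟨fun x => f x • u x, ContMDiff.smul_section f.contMDiff u.contMDiff⟩

variable (n F E) in
/-- A Courant algebroid structure on the vector bundle `E → M`. The last axiom
`⟨[u,v] + [v,u], w⟩ = w · ⟨u,v⟩` says that `[u,v] + [v,u] = d_E ⟨u,v⟩`. -/
structure CourantAlgebroid where
  /-- the fibrewise pairing -/
  pairing : ∀ x, LinearMap.BilinForm ℝ (E x)
  pairing_smooth : ∀ u v : Sec n F E,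
    ContMDiff (𝓡 n) 𝓘(ℝ, ℝ) ∞ (fun x => pairing x (u x) (v x))
  pairing_symm : ∀ x (u v : E x), pairing x u v = pairing x v u
  pairing_nondeg : ∀ x, (pairing x).Nondegenerate
  /-- the anchor map -/
  anchor : ∀ x, E x →ₗ[ℝ] TangentSpace (𝓡 n) x
  anchor_smooth : ∀ u : Sec n F E, ContMDiff (𝓡 n) (𝓡 n).tangent ∞
    (fun x => (⟨x, anchor x (u x)⟩ : TangentBundle (𝓡 n) M))
  /-- the bracket of sections -/
  bracket : Sec n F E →ₗ[ℝ] Sec n F E →ₗ[ℝ] Sec n F E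
  jacobi : ∀ u v w : Sec n F E,
    bracket u (bracket v w) = bracket (bracket u v) w + bracket v (bracket u w)
  leibniz : ∀ (u v : Sec n F E) (f : C^∞⟮𝓡 n, M; ℝ⟯) (x : M),
    bracket u (mulSec f v) x = f x • bracket u v x + deriveAlong (anchor x (u x)) f • v x
  invariant : ∀ (u v w : Sec n F E) (x : M),
    deriveAlong (anchor x (u x)) (fun y => pairing y (v y) (w y)) =
      pairing x (bracket u v x) (w x) + pairing x (v x) (bracket u w x)
  symmetric_part : ∀ (u v w : Sec n F E) (x : M),
    pairing x (bracket u v x + bracket v u x) (w x) =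
      deriveAlong (anchor x (w x)) (fun y => pairing y (u y) (v y))

/-- A divergence: an `ℝ`-linear map `div : Γ(E) → C^∞(M)` with `div (f a) = f div a + a · f`. -/
structure Divergence (C : CourantAlgebroid n F E) where
  /-- the underlying linear map -/
  toLin : Sec n F E →ₗ[ℝ] C^∞⟮𝓡 n, M; ℝ⟯
  leibniz : ∀ (f : C^∞⟮𝓡 n, M; ℝ⟯) (a : Sec n F E) (x : M),
    toLin (mulSec f a) x = f x * toLin a x + deriveAlong (C.anchor x (a x)) f

variable (n F) in
/-- A family of fibrewise subspaces is a smooth subbundle if near every point it is spanned by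
a frame of smooth sections. -/
def IsSubbundle (V : ∀ x, Submodule ℝ (E x)) : Prop :=
  ∀ p : M, ∃ (k : ℕ) (s : Fin k → Sec n F E), ∀ᶠ x in 𝓝 p,
    LinearIndependent ℝ (fun i => s i x) ∧ Submodule.span ℝ (Set.range fun i => s i x) = V x

/-- A generalized pseudometric: a subbundle `V₊ ⊂ E` on which the pairing is nondegenerate. -/
structure GenPseudometric (C : CourantAlgebroid n F E) where
  /-- the fibres of `V₊` -/
  plus : ∀ x, Submodule ℝ (E x)
  subbundle : IsSubbundle n F plus
  nondeg : ∀ x, ∀ v ∈ plus x, (∀ w ∈ plus x, C.pairing x v w = 0) → v = 0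

end Base

section Projection

variable {n : ℕ} {M : Type*} [TopologicalSpace M] [ChartedSpace (EuclideanSpace ℝ (Fin n)) M]
  [IsManifold (𝓡 n) ∞ M] {F : Type*} [NormedAddCommGroup F] [NormedSpace ℝ F] [FiniteDimensional ℝ F]
  {E : M → Type*} [TopologicalSpace (TotalSpace F E)] [∀ x, TopologicalSpace (E x)]
  [∀ x, AddCommGroup (E x)] [∀ x, Module ℝ (E x)] [FiberBundle F E] [VectorBundle ℝ F E]
  {C : CourantAlgebroid n F E} (V : GenPseudometric C)

namespace GenPseudometric

/-- The fibres of `V₋ = V₊^⊥`. -/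
def minus {C : CourantAlgebroid n F E} (V : GenPseudometric C) (x : M) : Submodule ℝ (E x) :=
  (C.pairing x).orthogonal (V.plus x)

theorem isCompl (x : M) : IsCompl (V.plus x) (V.minus x) := by
  have := VectorBundle.finiteDimensional ℝ F E x
  have hr : (C.pairing x).IsRefl := fun u v h => by rw [C.pairing_symm, h]
  refine (LinearMap.BilinForm.isCompl_orthogonal_iff_disjoint hr).2 ?_
  rw [Submodule.disjoint_def]
  intro v hv hv'
  refine V.nondeg x v hv fun w hw => ?_
  rw [C.pairing_symm]
  exact hv' w hw

/-- The orthogonal projection `E x → V₊ x`, as an endomorphism of `E x`. -/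
def proj (x : M) : E x →ₗ[ℝ] E x := (V.plus x).projection (V.minus x) (V.isCompl x)

theorem proj_mem (x : M) (v : E x) : V.proj x v ∈ V.plus x :=
  Submodule.projection_apply_mem _ _

theorem proj_eq {x : M} {v w : E x} (hw : w ∈ V.plus x)
    (h : ∀ z ∈ V.plus x, C.pairing x z v = C.pairing x z w) : V.proj x v = w := by
  have h1 : V.proj x (v - w) = 0 := by
    refine (Submodule.projection_apply_eq_zero_iff _).2 fun z hz => ?_
    change C.pairing x z (v - w) = 0
    rw [map_sub, h z hz, sub_self]
  have h2 : V.proj x w = w := Submodule.projection_apply_left (V.isCompl x) ⟨w, hw⟩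
  rw [map_sub, sub_eq_zero, h2] at h1
  exact h1

set_option linter.unusedSectionVars false in
theorem gram_det_ne_zero {x : M} {k : ℕ} (s : Fin k → E x) (hs : LinearIndependent ℝ s)
    (hV : Submodule.span ℝ (Set.range s) = V.plus x) :
    (Matrix.of fun i j => C.pairing x (s i) (s j)).det ≠ 0 := by
  intro h0
  obtain ⟨c, hc, hc0⟩ := Matrix.exists_mulVec_eq_zero_iff.2 h0
  have hmem : ∑ j, c j • s j ∈ V.plus x := by
    rw [← hV]
    exact Submodule.sum_mem _ fun j _ => Submodule.smul_mem _ _ (Submodule.subset_span ⟨j, rfl⟩)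
  have hz : ∑ j, c j • s j = 0 := by
    refine V.nondeg x _ hmem fun w hw => ?_
    rw [C.pairing_symm]
    rw [← hV] at hw
    induction hw using Submodule.span_induction with
    | mem w hw =>
      obtain ⟨i, rfl⟩ := hw
      have := congrFun hc0 i
      simpa [Matrix.mulVec, dotProduct, mul_comm] using this
    | zero => simp
    | add a b _ _ ha hb => rw [map_add, LinearMap.add_apply, ha, hb, add_zero]
    | smul r a _ ha => rw [map_smul, LinearMap.smul_apply, ha, smul_zero]
  exact hc (funext fun i => Fintype.linearIndependent_iff.1 hs c hz i)

theorem proj_smooth (u : Sec n F E) :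
    ContMDiff (𝓡 n) ((𝓡 n).prod 𝓘(ℝ, F)) ∞ (fun x => TotalSpace.mk' F x (V.proj x (u x))) := by
  intro p
  obtain ⟨k, s, hs⟩ := V.subbundle p
  let G : M → Matrix (Fin k) (Fin k) ℝ := fun x => Matrix.of fun i j => C.pairing x (s i x) (s j x)
  let b : M → Fin k → ℝ := fun x j => C.pairing x (s j x) (u x)
  have hdet : ∀ A : M → Matrix (Fin k) (Fin k) ℝ,
      (∀ i j, ContMDiffAt (𝓡 n) 𝓘(ℝ, ℝ) ∞ (fun x => A x i j) p) →
      ContMDiffAt (𝓡 n) 𝓘(ℝ, ℝ) ∞ (fun x => (A x).det) p := by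
    intro A hA
    simp only [Matrix.det_apply']
    exact contMDiffAt_finsetSum fun σ _ =>
      contMDiffAt_const.mul (contMDiffAt_finsetProd fun i _ => hA _ _)
  have hG : ∀ i j, ContMDiffAt (𝓡 n) 𝓘(ℝ, ℝ) ∞ (fun x => G x i j) p :=
    fun i j => C.pairing_smooth (s i) (s j) p
  have hcoef : ∀ i, ContMDiffAt (𝓡 n) 𝓘(ℝ, ℝ) ∞ (fun x => ((G x)⁻¹.mulVec (b x)) i) p := by
    intro i
    obtain ⟨hli, hsp⟩ := hs.self_of_nhds
    have hne : (G p).det ≠ 0 := V.gram_det_ne_zero _ hli hsp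
    have hadj : ∀ j, ContMDiffAt (𝓡 n) 𝓘(ℝ, ℝ) ∞ (fun x => (G x).adjugate i j) p := by
      intro j
      simp only [Matrix.adjugate_apply]
      refine hdet _ fun i' j' => ?_
      simp only [Matrix.updateRow_apply]
      split_ifs
      · exact contMDiffAt_const
      · exact hG _ _
    have heq : (fun x => ((G x)⁻¹.mulVec (b x)) i) =
        fun x => ∑ j, ((G x).det)⁻¹ * (G x).adjugate i j * b x j := by
      funext x
      simp [Matrix.mulVec, dotProduct, Matrix.inv_def, Ring.inverse_eq_inv']
    rw [heq]
    exact contMDiffAt_finsetSum fun j _ =>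
      (((hdet G hG).inv₀ hne).mul (hadj j)).mul (C.pairing_smooth (s j) u p)
  have hsum : ContMDiffAt (𝓡 n) ((𝓡 n).prod 𝓘(ℝ, F)) ∞
      (fun x => TotalSpace.mk' F x (∑ i, ((G x)⁻¹.mulVec (b x)) i • s i x)) p :=
    ContMDiffAt.sum_section fun i _ => (hcoef i).smul_section (s i).contMDiff.contMDiffAt
  refine hsum.congr_of_eventuallyEq ?_
  filter_upwards [hs] with x hx
  obtain ⟨hli, hsp⟩ := hx
  have hu : IsUnit (G x).det := (V.gram_det_ne_zero _ hli hsp).isUnit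
  congr 1
  refine V.proj_eq ?_ fun z hz => ?_
  · rw [← hsp]
    exact Submodule.sum_mem _ fun j _ => Submodule.smul_mem _ _ (Submodule.subset_span ⟨j, rfl⟩)
  · rw [← hsp] at hz
    induction hz using Submodule.span_induction with
    | mem w hw =>
      obtain ⟨i, rfl⟩ := hw
      have h1 : (G x).mulVec ((G x)⁻¹.mulVec (b x)) = b x := by
        rw [Matrix.mulVec_mulVec, Matrix.mul_nonsing_inv _ hu, Matrix.one_mulVec]
      have h2 := congrFun h1 i
      rw [map_sum]
      simp only [map_smul, smul_eq_mul]
      rw [show C.pairing x (s i x) (u x) = b x i from rfl, ← h2]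
      simp only [Matrix.mulVec, dotProduct, G, Matrix.of_apply]
      exact Finset.sum_congr rfl fun j _ => mul_comm _ _
    | zero => simp
    | add a b _ _ ha hb => simp only [map_add, LinearMap.add_apply, ha, hb]
    | smul r a _ ha => simp only [map_smul, LinearMap.smul_apply, ha]

/-- The projection `u ↦ u₊` on sections. -/
def plusSec (u : Sec n F E) : Sec n F E := ⟨fun x => V.proj x (u x), V.proj_smooth u⟩

/-- The projection `u ↦ u₋` on sections. -/
def minusSec (u : Sec n F E) : Sec n F E := u - V.plusSec u

/-- `a ∈ Γ(V₊)`. -/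
def IsPlus {C : CourantAlgebroid n F E} (V : GenPseudometric C) (a : Sec n F E) : Prop :=
  ∀ x, a x ∈ V.plus x

/-- `b ∈ Γ(V₋)`. -/
def IsMinus {C : CourantAlgebroid n F E} (V : GenPseudometric C) (b : Sec n F E) : Prop :=
  ∀ x, b x ∈ V.minus x

/-- The operator `[[v, b]₋, a]₊` on sections `v`. -/
def ricOp (a b v : Sec n F E) : Sec n F E :=
  V.plusSec (C.bracket (V.minusSec (C.bracket v b)) a)

open Classical in
/-- The endomorphism of the fibre of `V₊` at `p` induced by the `C^∞`-linear operator
`[[ · , b]₋, a]₊ : Γ(V₊) → Γ(V₊)`: it sends the value at `p` of every `v ∈ Γ(V₊)` to the value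
at `p` of `[[v, b]₋, a]₊`. -/
def ricEnd (a b : Sec n F E) (p : M) : V.plus p →ₗ[ℝ] V.plus p :=
  if h : ∃ T : V.plus p →ₗ[ℝ] V.plus p, ∀ (v : Sec n F E) (hv : V.IsPlus v),
      (T ⟨v p, hv p⟩ : E p) = V.ricOp a b v p
  then h.choose else 0

/-- The generalized Ricci tensor
`GRic(a, b) = div [b, a]₊ - b · div a - Tr_{V₊} [[ · , b]₋, a]₊` for `a ∈ Γ(V₊)`, `b ∈ Γ(V₋)`. -/
def GRic (div : Divergence C) (a b : Sec n F E) (p : M) : ℝ :=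
  div.toLin (V.plusSec (C.bracket b a)) p
    - deriveAlong (C.anchor p (b p)) (div.toLin a)
    - LinearMap.trace ℝ (V.plus p) (V.ricEnd a b p)

end GenPseudometric
end Projection

section Density

variable (n : ℕ) (M : Type*) [TopologicalSpace M] [ChartedSpace (EuclideanSpace ℝ (Fin n)) M]

/-- A (not necessarily smooth) half-density on the `n`-dimensional manifold `M`: at each point a
function `σ` of `n`-tuples of tangent vectors such that
`σ(A v₁, …, A vₙ) = |det A|^{1/2} σ(v₁, …, vₙ)` for every linear endomorphism `A`. -/
structure HalfDensity where
  /-- the value on an `n`-tuple of tangent vectors -/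
  val : ∀ p : M, (Fin n → TangentSpace (𝓡 n) p) → ℝ
  map_linear : ∀ (p : M) (A : TangentSpace (𝓡 n) p →ₗ[ℝ] TangentSpace (𝓡 n) p)
    (v : Fin n → TangentSpace (𝓡 n) p),
    val p (fun i => A (v i)) = √|LinearMap.det A| * val p v

variable {n M}

/-- The coefficient `s` of a half-density `σ = s |dy|^{1/2}` in the coordinates `y` given by the
chart at `p`, i.e. the value of `σ` on the coordinate vector fields. -/
def HalfDensity.coeff (σ : HalfDensity n M) (p : M) (y : EuclideanSpace ℝ (Fin n)) : ℝ :=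
  σ.val ((extChartAt (𝓡 n) p).symm y) fun i =>
    mfderiv (𝓡 n) (𝓡 n) (extChartAt (𝓡 n) p).symm y (EuclideanSpace.basisFun (Fin n) ℝ i)

/-- `σ` is smooth and nowhere vanishing in a neighbourhood of `p`. -/
def HalfDensity.RegularNear (σ : HalfDensity n M) (p : M) : Prop :=
  ∀ᶠ y in 𝓝 (extChartAt (𝓡 n) p p), ContDiffAt ℝ ∞ (σ.coeff p) y ∧ σ.coeff p y ≠ 0

/-- The expression of a vector field in the coordinates given by the chart at `p`. -/
def chartVec (p : M) (X : ∀ q : M, TangentSpace (𝓡 n) q) (y : EuclideanSpace ℝ (Fin n)) :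
    EuclideanSpace ℝ (Fin n) :=
  mfderiv (𝓡 n) (𝓡 n) (extChartAt (𝓡 n) p) ((extChartAt (𝓡 n) p).symm y)
    (X ((extChartAt (𝓡 n) p).symm y))

/-- The coefficient of the Lie derivative of the `w`-density `s |dy|^w` along the vector field `X`
on `ℝⁿ`: `L_X (s |dy|^w) = (X s + w (∂ᵢ Xⁱ) s) |dy|^w`. -/
def lieCoord (w : ℝ) (X : EuclideanSpace ℝ (Fin n) → EuclideanSpace ℝ (Fin n))
    (s : EuclideanSpace ℝ (Fin n) → ℝ) (y : EuclideanSpace ℝ (Fin n)) : ℝ :=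
  fderiv ℝ s y (X y) + w * LinearMap.trace ℝ _ (fderiv ℝ X y).toLinearMap * s y

/-- `div_{σ²} X = σ⁻² L_X σ²` at the point `y`, in the coordinates given by the chart at `p`. -/
def HalfDensity.divSq (σ : HalfDensity n M) (p : M) (X : ∀ q : M, TangentSpace (𝓡 n) q)
    (y : EuclideanSpace ℝ (Fin n)) : ℝ :=
  (σ.coeff p y ^ 2)⁻¹ * lieCoord 1 (chartVec p X) (fun z => σ.coeff p z ^ 2) y

end Density

section Scalar

variable {n : ℕ} {M : Type*} [TopologicalSpace M] [ChartedSpace (EuclideanSpace ℝ (Fin n)) M]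
  [IsManifold (𝓡 n) ∞ M] {F : Type*} [NormedAddCommGroup F] [NormedSpace ℝ F]
  {E : M → Type*} [TopologicalSpace (TotalSpace F E)] [∀ x, TopologicalSpace (E x)]
  [∀ x, AddCommGroup (E x)] [∀ x, Module ℝ (E x)] [FiberBundle F E] [VectorBundle ℝ F E]
  {C : CourantAlgebroid n F E}

/-- A frame of `E` near `p` that is the union of a frame `e_a` of `V₊` and a frame `f_c` of `V₋`,
with constant pairings `g_{ab} = ⟨e_a, e_b⟩` and `h_{cd} = ⟨f_c, f_d⟩`. The sections are defined on
all of `M`, but are a frame only near `p`. -/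
structure AdaptedFrame (V : GenPseudometric C) (p : M) where
  /-- the rank of `V₊` at `p` -/
  k : ℕ
  /-- the rank of `V₋` at `p` -/
  l : ℕ
  /-- the frame of `V₊` -/
  e : Fin k → Sec n F E
  /-- the frame of `V₋` -/
  f : Fin l → Sec n F E
  /-- the pairings of the `e_a` -/
  g : Matrix (Fin k) (Fin k) ℝ
  /-- the pairings of the `f_c` -/
  h : Matrix (Fin l) (Fin l) ℝ
  frame_e : ∀ᶠ x in 𝓝 p, LinearIndependent ℝ (fun i => e i x) ∧
    Submodule.span ℝ (Set.range fun i => e i x) = V.plus x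
  frame_f : ∀ᶠ x in 𝓝 p, LinearIndependent ℝ (fun i => f i x) ∧
    Submodule.span ℝ (Set.range fun i => f i x) = V.minus x
  pairing_e : ∀ᶠ x in 𝓝 p, ∀ i j, C.pairing x (e i x) (e j x) = g i j
  pairing_f : ∀ᶠ x in 𝓝 p, ∀ i j, C.pairing x (f i x) (f j x) = h i j

namespace AdaptedFrame

variable {V : GenPseudometric C} {p : M} (B : AdaptedFrame V p)

/-- The dual frame `e^a = g^{ab} e_b` of `V₊`. -/
def eUp (i : Fin B.k) : Sec n F E := ∑ j, B.g⁻¹ i j • B.e j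

/-- The dual frame `f^c = h^{cd} f_d` of `V₋`. -/
def fUp (i : Fin B.l) : Sec n F E := ∑ j, B.h⁻¹ i j • B.f j

/-- The function `σ⁻¹ Δ_{V₊} σ` at `p`, where
`Δ_{V₊} = 4 L_{ρ(e^a)} L_{ρ(e_a)} - 1/6 c_{abc} c^{abc} - 1/2 c_{ab c̄} c^{ab c̄}` is the Laplacian on
half-densities and `c_{αβγ} = ⟨e_α, [e_β, e_γ]⟩`. -/
def laplacianQuot (σ : HalfDensity n M) : ℝ :=
  let X : Sec n F E → EuclideanSpace ℝ (Fin n) → EuclideanSpace ℝ (Fin n) :=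
    fun u => chartVec p fun q => C.anchor q (u q)
  let y := extChartAt (𝓡 n) p p
  let c : Sec n F E → Sec n F E → Sec n F E → ℝ :=
    fun u v w => C.pairing p (u p) (C.bracket v w p)
  4 * ((σ.coeff p y)⁻¹ *
      ∑ a, lieCoord (1 / 2) (X (B.eUp a)) (lieCoord (1 / 2) (X (B.e a)) (σ.coeff p)) y)
    - 1 / 6 * ∑ a, ∑ b, ∑ d, c (B.e a) (B.e b) (B.e d) * c (B.eUp a) (B.eUp b) (B.eUp d)
    - 1 / 2 * ∑ a, ∑ b, ∑ d, c (B.e a) (B.e b) (B.f d) * c (B.eUp a) (B.eUp b) (B.fUp d)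

end AdaptedFrame

end Scalar

section Equations

variable {n : ℕ} {M : Type*} [TopologicalSpace M] [ChartedSpace (EuclideanSpace ℝ (Fin n)) M]
  [IsManifold (𝓡 n) ∞ M] {F : Type*} [NormedAddCommGroup F] [NormedSpace ℝ F]
  [FiniteDimensional ℝ F]
  {E : M → Type*} [TopologicalSpace (TotalSpace F E)] [∀ x, TopologicalSpace (E x)]
  [∀ x, AddCommGroup (E x)] [∀ x, Module ℝ (E x)] [FiberBundle F E] [VectorBundle ℝ F E]
  {C : CourantAlgebroid n F E}

/-- `R` is the generalized scalar curvature of `V₊` and `div`, that is,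
`R = σ⁻¹ Δ_{V₊} σ + ⟨e₊, e₊⟩ + 2 div_{σ²} e₊`, where `div - div_{σ²} = ⟨e, · ⟩`. This is
independent of the nonvanishing half-density `σ` and of the adapted frame in `Δ_{V₊}`; as it is
a local expression, `σ` and `e` are only needed in a neighbourhood of the point `p`. -/
def IsScalarCurvature (V : GenPseudometric C) (div : Divergence C) (R : M → ℝ) : Prop :=
  ∀ (p : M) (B : AdaptedFrame V p) (σ : HalfDensity n M) (e : Sec n F E),
    σ.RegularNear p →
    (∀ᶠ q in 𝓝 p, ∀ a : Sec n F E,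
      div.toLin a q - σ.divSq p (fun z => C.anchor z (a z)) (extChartAt (𝓡 n) p q) =
        C.pairing q (e q) (a q)) →
    R p = B.laplacianQuot σ + C.pairing p (V.plusSec e p) (V.plusSec e p)
      + 2 * σ.divSq p (fun z => C.anchor z (V.plusSec e z)) (extChartAt (𝓡 n) p p)

/-- The generalized string background equations `GRic = 0` and `R = 0` for `V₊` and `div`. -/
def StringBackground (V : GenPseudometric C) (div : Divergence C) : Prop :=
  (∀ a b : Sec n F E, V.IsPlus a → V.IsMinus b → ∀ p, V.GRic div a b p = 0) ∧
    IsScalarCurvature V div (fun _ => 0)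

end Equations

section Equivariant

variable {n : ℕ} {M : Type*} [TopologicalSpace M] [ChartedSpace (EuclideanSpace ℝ (Fin n)) M]
  [IsManifold (𝓡 n) ∞ M] {F : Type*} [NormedAddCommGroup F] [NormedSpace ℝ F]
  {E : M → Type*} [TopologicalSpace (TotalSpace F E)] [∀ x, TopologicalSpace (E x)]
  [∀ x, AddCommGroup (E x)] [∀ x, Module ℝ (E x)] [FiberBundle F E] [VectorBundle ℝ F E]
  (𝔰 : Type*) [LieRing 𝔰] [LieAlgebra ℝ 𝔰]

/-- An `𝔰`-equivariant structure on a Courant algebroid, where `𝔰` carries the zero pairing. -/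
structure EquivariantStructure (C : CourantAlgebroid n F E) where
  /-- the map `χ : 𝔰 → Γ(E)` -/
  χ : 𝔰 →ₗ[ℝ] Sec n F E
  bracket : ∀ s t, C.bracket (χ s) (χ t) = χ ⁅s, t⁆
  isotropic : ∀ s t x, C.pairing x (χ s x) (χ t x) = 0
  injective : ∀ x, Function.Injective fun s => χ s x

variable {𝔰} {C : CourantAlgebroid n F E} (X : EquivariantStructure 𝔰 C)

namespace EquivariantStructure

/-- The fibre at `x` of the subbundle `𝔰_E^⊥`. -/
def perp (x : M) : Submodule ℝ (E x) where
  carrier := {w | ∀ s, C.pairing x (X.χ s x) w = 0}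
  add_mem' := fun ha hb s => by rw [map_add, ha s, hb s, add_zero]
  zero_mem' := fun s => map_zero _
  smul_mem' := fun r a ha s => by rw [map_smul, ha s, smul_zero]

/-- `u ∈ Γ(𝔰_E^⊥)^𝔰`: an invariant section of `𝔰_E^⊥`. -/
def InvPerp (u : Sec n F E) : Prop :=
  (∀ x, u x ∈ X.perp x) ∧ ∀ s, C.bracket (X.χ s) u = 0

/-- The generalized pseudometric `V₊` is admissible: it is `𝔰`-invariant and contained in
`𝔰_E^⊥`. -/
def Admissible (V : GenPseudometric C) : Prop :=
  (∀ (s : 𝔰) (a : Sec n F E), V.IsPlus a → V.IsPlus (C.bracket (X.χ s) a)) ∧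
    ∀ x, V.plus x ≤ X.perp x

/-- The divergence is equivariant: `χ(s) · div u = div [χ(s), u]` and `div χ(s) = - Tr ad_s`. -/
def IsEquivariantDiv (div : Divergence C) : Prop :=
  (∀ (s : 𝔰) (u : Sec n F E) (x : M),
    deriveAlong (C.anchor x (X.χ s x)) (div.toLin u) = div.toLin (C.bracket (X.χ s) u) x) ∧
  ∀ (s : 𝔰) (x : M), div.toLin (X.χ s) x = - LinearMap.trace ℝ 𝔰 (LieAlgebra.ad ℝ 𝔰 s)

end EquivariantStructure

end Equivariant

section Pullback

instance pullbackAddCommGroup {B B' : Type*} (f : B' → B) (E : B → Type*)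
    [∀ x, AddCommGroup (E x)] : ∀ x, AddCommGroup ((f *ᵖ E) x) :=
  fun x => inferInstanceAs (AddCommGroup (E (f x)))

variable {n m : ℕ} {M M' : Type*}
  [TopologicalSpace M] [ChartedSpace (EuclideanSpace ℝ (Fin n)) M] [IsManifold (𝓡 n) ∞ M]
  [TopologicalSpace M'] [ChartedSpace (EuclideanSpace ℝ (Fin m)) M'] [IsManifold (𝓡 m) ∞ M']
  {F : Type*} [NormedAddCommGroup F] [NormedSpace ℝ F]
  {E : M → Type*} [TopologicalSpace (TotalSpace F E)] [∀ x, TopologicalSpace (E x)]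
  [∀ x, AddCommGroup (E x)] [∀ x, Module ℝ (E x)] [FiberBundle F E] [VectorBundle ℝ F E]
  (τ : ContMDiffMap (𝓡 m) (𝓡 n) M' M ∞)

/-- The pulled back section `τ^* u` of `τ^* E`. -/
def pullSec (u : Sec n F E) : Sec m F ((τ : M' → M) *ᵖ E) where
  toFun x := (u (τ x) : E (τ x))
  contMDiff_toFun := by
    intro x
    refine (contMDiffAt_section _).2 ?_
    have h := (contMDiffAt_section (τ x)).1 (u.contMDiff (τ x))
    exact h.comp x (τ.contMDiff x)

/-- Pullback of sections as a linear map. -/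
def pullSecLin : Sec n F E →ₗ[ℝ] Sec m F ((τ : M' → M) *ᵖ E) where
  toFun := pullSec τ
  map_add' _ _ := rfl
  map_smul' _ _ := rfl

variable (C : CourantAlgebroid n F E) (C' : CourantAlgebroid m F ((τ : M' → M) *ᵖ E))

/-- The Courant algebroid structure `C'` makes `τ^* E` a CA-pullback of `E`. -/
structure IsCAPullback : Prop where
  pairing : ∀ (x : M') (u v : E (τ x)), C'.pairing x u v = C.pairing (τ x) u v
  bracket : ∀ u v : Sec n F E,
    C'.bracket (pullSec τ u) (pullSec τ v) = pullSec τ (C.bracket u v)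
  anchor : ∀ (x : M') (u : E (τ x)),
    mfderiv (𝓡 m) (𝓡 n) τ x (C'.anchor x u) = C.anchor (τ x) u

variable {τ C C'}

namespace IsCAPullback

/-- The pulled back equivariant structure `χ'(s) = τ^* χ(s)`. -/
def pullEquivariant {𝔰 : Type*} [LieRing 𝔰] [LieAlgebra ℝ 𝔰] (H : IsCAPullback τ C C')
    (X : EquivariantStructure 𝔰 C) : EquivariantStructure 𝔰 C' where
  χ := pullSecLin τ ∘ₗ X.χ
  bracket s t := by
    change C'.bracket (pullSec τ (X.χ s)) (pullSec τ (X.χ t)) = pullSec τ (X.χ ⁅s, t⁆)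
    rw [H.bracket, X.bracket]
  isotropic s t x := (H.pairing x _ _).trans (X.isotropic s t (τ x))
  injective x := X.injective (τ x)

/-- The pulled back generalized pseudometric `τ^* V₊`. -/
def pullMetric (H : IsCAPullback τ C C') (V : GenPseudometric C) : GenPseudometric C' where
  plus x := V.plus (τ x)
  subbundle p := by
    obtain ⟨k, s, hs⟩ := V.subbundle (τ p)
    exact ⟨k, fun i => pullSec τ (s i), τ.contMDiff.continuous.continuousAt.eventually hs⟩
  nondeg x v hv h := V.nondeg (τ x) v hv fun w hw => (H.pairing x v w).symm.trans (h w hw)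

end IsCAPullback

/-- The divergence `div'` on `τ^* E` is the pullback `τ^* div`, the divergence with
`(τ^* div)(τ^* u) = τ^* (div u)`. -/
def IsPullbackDiv (div : Divergence C) (div' : Divergence C') : Prop :=
  ∀ (u : Sec n F E) (x : M'), div'.toLin (pullSec τ u) x = div.toLin u (τ x)

end Pullback

section Reduction

variable {m d r : ℕ} {M N S 𝔰 : Type*}
  [TopologicalSpace M] [ChartedSpace (EuclideanSpace ℝ (Fin m)) M] [IsManifold (𝓡 m) ∞ M]
  [TopologicalSpace N] [ChartedSpace (EuclideanSpace ℝ (Fin d)) N] [IsManifold (𝓡 d) ∞ N]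
  [TopologicalSpace S] [ChartedSpace (EuclideanSpace ℝ (Fin r)) S] [Group S] [MulAction S M]
  [LieRing 𝔰] [LieAlgebra ℝ 𝔰]
  {F : Type*} [NormedAddCommGroup F] [NormedSpace ℝ F]
  {E : M → Type*} [TopologicalSpace (TotalSpace F E)] [∀ x, TopologicalSpace (E x)]
  [∀ x, AddCommGroup (E x)] [∀ x, Module ℝ (E x)] [FiberBundle F E] [VectorBundle ℝ F E]
  {F₁ : Type*} [NormedAddCommGroup F₁] [NormedSpace ℝ F₁]
  {E₁ : N → Type*} [TopologicalSpace (TotalSpace F₁ E₁)] [∀ x, TopologicalSpace (E₁ x)]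
  [∀ x, AddCommGroup (E₁ x)] [∀ x, Module ℝ (E₁ x)] [FiberBundle F₁ E₁] [VectorBundle ℝ F₁ E₁]

variable (m d S) in
/-- `pr : M → N` is the projection to the quotient manifold `N = M / S`. -/
structure IsQuotientManifold (pr : M → N) : Prop where
  submersion : IsSubmersion (𝓡 m) (𝓡 d) ∞ pr
  surjective : Function.Surjective pr
  fibre : ∀ x y, pr x = pr y ↔ ∃ g : S, g • x = y

/-- The action of `𝔰` on the base given by the vector fields `ρ(χ(s))` integrates to the (left)
action of the Lie group `S`, where `Φ` identifies `𝔰` with the Lie algebra of `S`: the flow of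
`ρ(χ(s))` is the action of `exp(-t s)`. (For left actions, minus the fundamental vector fields
depend on `s` in a bracket-preserving way.) -/
def IntegratesTo {C : CourantAlgebroid m F E} (X : EquivariantStructure 𝔰 C)
    (Φ : 𝔰 ≃ₗ[ℝ] GroupLieAlgebra (𝓡 r) S) : Prop :=
  ∀ (s : 𝔰) (x : M), C.anchor x (X.χ s x) =
    (- mfderiv (𝓡 r) (𝓡 m) (fun g : S => g • x) 1 (Φ s) : TangentSpace (𝓡 m) ((1 : S) • x))

/-- The data exhibiting the Courant algebroid `E₁ → N` as the reduced Courant algebroid `E_{/S}`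
of the equivariant Courant algebroid `E → M`, where `pr : M → N = M / S`. The fibre of `E₁` at `pr x`
is identified with `𝔰_E^⊥ / 𝔰_E` at `x`, the sections of `E₁` with
`Γ(𝔰_E^⊥)^𝔰 / Γ(𝔰_E)^𝔰`, and the pairing, anchor and bracket of `E₁` are induced from those
of `E`. -/
structure CAReduction {C : CourantAlgebroid m F E} (X : EquivariantStructure 𝔰 C) (pr : M → N)
    (C₁ : CourantAlgebroid d F₁ E₁) where
  /-- the quotient map `𝔰_E^⊥ → 𝔰_E^⊥ / 𝔰_E` -/
  q : ∀ x, X.perp x →ₗ[ℝ] E₁ (pr x)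
  q_surjective : ∀ x, Function.Surjective (q x)
  q_ker : ∀ x (w : X.perp x), q x w = 0 ↔ ∃ s, X.χ s x = w
  descend : ∀ (u : Sec m F E) (hu : X.InvPerp u),
    ∃ v : Sec d F₁ E₁, ∀ x, q x ⟨u x, hu.1 x⟩ = v (pr x)
  lift : ∀ v : Sec d F₁ E₁, ∃ (u : Sec m F E) (hu : X.InvPerp u),
    ∀ x, q x ⟨u x, hu.1 x⟩ = v (pr x)
  pairing : ∀ x (w z : X.perp x), C₁.pairing (pr x) (q x w) (q x z) = C.pairing x w z
  anchor : ∀ x (w : X.perp x),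
    C₁.anchor (pr x) (q x w) = mfderiv (𝓡 m) (𝓡 d) pr x (C.anchor x w)
  bracket : ∀ (u₁ u₂ : Sec m F E) (v₁ v₂ : Sec d F₁ E₁)
    (h₁ : X.InvPerp u₁) (h₂ : X.InvPerp u₂),
    (∀ x, q x ⟨u₁ x, h₁.1 x⟩ = v₁ (pr x)) → (∀ x, q x ⟨u₂ x, h₂.1 x⟩ = v₂ (pr x)) →
    ∀ x, ∃ h : C.bracket u₁ u₂ x ∈ X.perp x,
      q x ⟨C.bracket u₁ u₂ x, h⟩ = C₁.bracket v₁ v₂ (pr x)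

variable {C : CourantAlgebroid m F E} {X : EquivariantStructure 𝔰 C} {pr : M → N}
  {C₁ : CourantAlgebroid d F₁ E₁}

/-- `V₁` is the generalized pseudometric to which `V₊` descends: its fibre at `pr x` is the image
of `V₊ x` in `𝔰_E^⊥ / 𝔰_E`. -/
def CAReduction.IsReducedMetric (Q : CAReduction X pr C₁) (V : GenPseudometric C)
    (V₁ : GenPseudometric C₁) : Prop :=
  ∀ x, V₁.plus (pr x) = ((V.plus x).comap (X.perp x).subtype).map (Q.q x)

/-- `div₁` is the divergence to which `div` descends. -/
def CAReduction.IsReducedDiv (Q : CAReduction X pr C₁) (div : Divergence C)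
    (div₁ : Divergence C₁) : Prop :=
  ∀ (u : Sec m F E) (hu : X.InvPerp u) (v : Sec d F₁ E₁),
    (∀ x, Q.q x ⟨u x, hu.1 x⟩ = v (pr x)) → ∀ x, div₁.toLin v (pr x) = div.toLin u x

end Reduction

end CourantT

end

open Bundle Manifold Filter Topology Module
open scoped ContDiff

noncomputable section

set_option linter.unusedSectionVars false
set_option linter.unusedSimpArgs false

namespace CourantT

/-! ### Derivatives of functions along tangent vectors. -/

section DeriveAlong

variable {n m : ℕ} {M N : Type*} [TopologicalSpace M] [ChartedSpace (EuclideanSpace ℝ (Fin n)) M]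
  [TopologicalSpace N] [ChartedSpace (EuclideanSpace ℝ (Fin m)) N]

/-! Both equations can be written using only pairings, brackets, anchors and divergences of sections
in a frame of `V₊`. Such expressions are natural under pullback and under reduction, so a solution
on `E` is carried to `τ^* E` and from there to the reduced algebroid.

For the scalar equation the half-density has to be eliminated. In an orthonormal frame `e_a` of `V₊`
with signs `η_a`, the curvature at a point equals `∑ η_a (2 e_a · div e_a + (div e_a)²) + 1/3 ∑ η_a
η_b η_c ⟨[e_a,e_b],e_c⟩² - 1/2 ∑ η_a η_b ⟨[e_a,e_b],[e_a,e_b]⟩`, which is `scalarON`. The theorem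
`scalar_rhs_eq` identifies it with the expression in `σ` and `e`: the Laplacian gives the divergence
terms with `div_{σ²}` in place of `div`, and the terms in `e` convert one into the other.
Completeness of the frames of `V₊` and `V₋` turns the sum over `c_{ab c̄}` into the norm of
`[e_a,e_b]` minus the purely `V₊` part. Since `IsScalarCurvature` quantifies over all local choices
of `σ` and `e`, extracting information from it requires at least one choice; the density of a chart
supplies it (`exists_div_sub_chartDiv`).

On `τ^* E` the pulled back frames inherit the equations, but a general frame of `τ^* V₊` is not
pulled back. For the Ricci equation this is harmless because `GRic` is `C^∞`-bilinear and vanishes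
once it vanishes on frames. The expression `scalarON` is not visibly tensorial; its independence of
the frame is the computation `scalarON_eq`. Two frames that agree at the point are compared there,
and the first and second derivatives of the orthogonal transition matrix cancel.

For the reduction, admissibility gives `V₊ ⊂ 𝔰_E^⊥`, hence `𝔰_E ⊂ V₋`. The quotient map is therefore
an isometry from `V₊` onto its image, and projection to `V₊` preserves invariant sections. Sections
of the reduced `V₊` and `V₋` lift to invariant sections of `V₊` and `V₋`, and lifting respects every
operation entering the two curvatures. Thus both reduced curvatures, composed with the projection,
are those of the lifted frames.

It remains to construct the data. The pullback divergence is given by an explicit frame formula,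
independent of the frame. An equivariant divergence of an invariant section is constant on the
orbits of the connected group, so it descends to a function. It also vanishes on invariant sections
of `𝔰_E`, because the condition `div χ(s) = - Tr ad_s` cancels the trace produced by invariance;
hence the descended function depends only on the reduced section. -/

theorem deriveAlong_congr {p : M} (X : TangentSpace (𝓡 n) p) {f g : M → ℝ} (h : f =ᶠ[𝓝 p] g) :
    deriveAlong X f = deriveAlong X g := by
  unfold deriveAlong
  rw [h.mfderiv_eq]
  rfl

theorem deriveAlong_const {p : M} (X : TangentSpace (𝓡 n) p) (c : ℝ) :
    deriveAlong X (fun _ : M => c) = 0 := by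
  unfold deriveAlong
  rw [mfderiv_const]; rfl

theorem deriveAlong_zero_vec {p : M} (f : M → ℝ) :
    deriveAlong (0 : TangentSpace (𝓡 n) p) f = 0 := map_zero (mfderiv (𝓡 n) 𝓘(ℝ, ℝ) f p)

theorem deriveAlong_add_vec {p : M} (X Y : TangentSpace (𝓡 n) p) (f : M → ℝ) :
    deriveAlong (X + Y) f = deriveAlong X f + deriveAlong Y f :=
  map_add (mfderiv (𝓡 n) 𝓘(ℝ, ℝ) f p) X Y

theorem deriveAlong_smul_vec {p : M} (c : ℝ) (X : TangentSpace (𝓡 n) p) (f : M → ℝ) :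
    deriveAlong (c • X) f = c * deriveAlong X f :=
  map_smul (mfderiv (𝓡 n) 𝓘(ℝ, ℝ) f p) c X

theorem deriveAlong_add {p : M} (X : TangentSpace (𝓡 n) p) {f g : M → ℝ}
    (hf : MDifferentiableAt (𝓡 n) 𝓘(ℝ, ℝ) f p) (hg : MDifferentiableAt (𝓡 n) 𝓘(ℝ, ℝ) g p) :
    deriveAlong X (f + g) = deriveAlong X f + deriveAlong X g := by
  unfold deriveAlong
  rw [mfderiv_add hf hg]; rfl

theorem deriveAlong_mul {p : M} (X : TangentSpace (𝓡 n) p) {f g : M → ℝ}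
    (hf : MDifferentiableAt (𝓡 n) 𝓘(ℝ, ℝ) f p) (hg : MDifferentiableAt (𝓡 n) 𝓘(ℝ, ℝ) g p) :
    deriveAlong X (f * g) = f p * deriveAlong X g + g p * deriveAlong X f := by
  unfold deriveAlong
  have h := (hf.hasMFDerivAt.mul hg.hasMFDerivAt).mfderiv
  rw [h]; rfl

theorem deriveAlong_comp {p : M} (X : TangentSpace (𝓡 n) p) {φ : M → N} {f : N → ℝ}
    (hf : MDifferentiableAt (𝓡 m) 𝓘(ℝ, ℝ) f (φ p)) (hφ : MDifferentiableAt (𝓡 n) (𝓡 m) φ p) :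
    deriveAlong X (f ∘ φ) = deriveAlong (mfderiv (𝓡 n) (𝓡 m) φ p X) f := by
  unfold deriveAlong
  rw [mfderiv_comp p hf hφ]; rfl

theorem smooth_mdiff (f : C^∞⟮𝓡 n, M; ℝ⟯) (p : M) : MDifferentiableAt (𝓡 n) 𝓘(ℝ, ℝ) f p :=
  f.contMDiff.mdifferentiable (by simp) p

end DeriveAlong

/-! ### Extension of local functions, sections and frames by bump functions. -/

section Bump

variable {n : ℕ} {M : Type*} [TopologicalSpace M] [ChartedSpace (EuclideanSpace ℝ (Fin n)) M]
  [IsManifold (𝓡 n) ∞ M] [T2Space M] {F : Type*} [NormedAddCommGroup F] [NormedSpace ℝ F]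
  {E : M → Type*} [TopologicalSpace (TotalSpace F E)] [∀ x, TopologicalSpace (E x)]
  [∀ x, AddCommGroup (E x)] [∀ x, Module ℝ (E x)] [FiberBundle F E] [VectorBundle ℝ F E]

theorem exists_bump {p : M} {P : M → Prop} (h : ∀ᶠ x in 𝓝 p, P x) :
    ∃ f : C^∞⟮𝓡 n, M; ℝ⟯, (∀ᶠ x in 𝓝 p, f x = 1) ∧
      ∀ x ∈ tsupport f, P x := by
  obtain ⟨g, hg, -⟩ := (SmoothBumpFunction.nhds_basis_support (I := 𝓡 n) (c := p) h).mem_iff.1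
    (Filter.univ_mem (f := 𝓝 p))
  exact ⟨⟨g, g.contMDiff⟩, g.eventuallyEq_one, fun x hx => hg hx⟩

/-- A function that is smooth near `p` agrees near `p` with a globally smooth one. -/
theorem exists_smooth_extend {p : M} {f : M → ℝ}
    (h : ∀ᶠ x in 𝓝 p, ContMDiffAt (𝓡 n) 𝓘(ℝ, ℝ) ∞ f x) :
    ∃ g : C^∞⟮𝓡 n, M; ℝ⟯, ∀ᶠ x in 𝓝 p, g x = f x := by
  obtain ⟨b, hb, hs⟩ := exists_bump (n := n) h
  refine ⟨⟨fun x => b x * f x, ?_⟩, ?_⟩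
  · refine contMDiff_of_tsupport fun x hx => ?_
    exact b.contMDiff.contMDiffAt.mul (hs x (tsupport_mul_subset_left hx))
  · filter_upwards [hb] with x hx
    change b x * f x = f x
    rw [hx, one_mul]

/-- A section that is smooth near `p` agrees near `p` with a globally smooth one. -/
theorem exists_section_extend {p : M} {s : ∀ x, E x}
    (h : ∀ᶠ x in 𝓝 p, ContMDiffAt (𝓡 n) ((𝓡 n).prod 𝓘(ℝ, F)) ∞
      (fun x => TotalSpace.mk' F x (s x)) x) :
    ∃ t : Sec n F E, ∀ᶠ x in 𝓝 p, t x = s x := by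
  obtain ⟨U, hU, hUo, hpU⟩ := eventually_nhds_iff.1 h
  obtain ⟨b, hb, hs⟩ := exists_bump (n := n) (hUo.mem_nhds hpU)
  refine ⟨⟨fun x => b x • s x, ?_⟩, ?_⟩
  · have := ContMDiffOn.smul_section_of_tsupport (I := 𝓡 n) (F := F) (s := s)
      (b.contMDiff.contMDiffOn) hUo hs (fun x hx => (hU x hx).contMDiffWithinAt)
    exact this
  · filter_upwards [hb] with x hx
    change b x • s x = s x
    rw [hx, one_smul]

variable (F E) in
theorem exists_local_frame [FiniteDimensional ℝ F] [ContMDiffVectorBundle ∞ F E (𝓡 n)] (p : M) :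
    ∃ s : Fin (finrank ℝ F) → Sec n F E, ∀ᶠ x in 𝓝 p, LinearIndependent ℝ (fun i => s i x) ∧
      Submodule.span ℝ (Set.range fun i => s i x) = ⊤ := by
  let e := trivializationAt F E p
  let b := finBasis ℝ F
  have hp : p ∈ e.baseSet := FiberBundle.mem_baseSet_trivializationAt F E p
  have hnhds : ∀ᶠ x in 𝓝 p, x ∈ e.baseSet := e.open_baseSet.mem_nhds hp
  have h := e.isLocalFrameOn_localFrame_baseSet (𝓡 n) ∞ b
  have hext : ∀ i, ∃ t : Sec n F E, ∀ᶠ x in 𝓝 p, t x = e.localFrame b i x := fun i =>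
    exists_section_extend (by
      filter_upwards [hnhds] with x hx
      exact h.contMDiffAt e.open_baseSet hx i)
  choose t ht using hext
  refine ⟨t, ?_⟩
  filter_upwards [hnhds, eventually_all.2 ht] with x hx htx
  have he : (fun i => t i x) = fun i => e.localFrame b i x := funext htx
  rw [he]
  exact ⟨h.linearIndependent hx, top_le_iff.1 (h.generating hx)⟩

theorem exists_section_through [FiniteDimensional ℝ F] [ContMDiffVectorBundle ∞ F E (𝓡 n)] (p : M)
    (z : E p) : ∃ t : Sec n F E, t p = z := by
  obtain ⟨s, hs⟩ := exists_local_frame (n := n) F E p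
  have hz : z ∈ Submodule.span ℝ (Set.range fun i => s i p) := by
    rw [hs.self_of_nhds.2]; trivial
  obtain ⟨c, hc⟩ := (Submodule.mem_span_range_iff_exists_fun ℝ).1 hz
  let ev : Sec n F E →+ E p := ⟨⟨fun u => u p, rfl⟩, fun _ _ => rfl⟩
  refine ⟨∑ i, c i • s i, ?_⟩
  rw [← hc]
  exact map_sum ev _ _

end Bump

/-! ### Courant algebroid calculus and locality of the bracket and the divergence. -/

section Calculus

variable {n : ℕ} {M : Type*} [TopologicalSpace M] [ChartedSpace (EuclideanSpace ℝ (Fin n)) M]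
  [IsManifold (𝓡 n) ∞ M] {F : Type*} [NormedAddCommGroup F] [NormedSpace ℝ F]
  {E : M → Type*} [TopologicalSpace (TotalSpace F E)] [∀ x, TopologicalSpace (E x)]
  [∀ x, AddCommGroup (E x)] [∀ x, Module ℝ (E x)] [FiberBundle F E] [VectorBundle ℝ F E]

@[simp] theorem mulSec_apply (f : C^∞⟮𝓡 n, M; ℝ⟯) (u : Sec n F E) (x : M) :
    mulSec f u x = f x • u x := rfl

@[simp] theorem sec_add_apply (u v : Sec n F E) (x : M) : (u + v) x = u x + v x := rfl
@[simp] theorem sec_sub_apply (u v : Sec n F E) (x : M) : (u - v) x = u x - v x := rfl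
@[simp] theorem sec_zero_apply (x : M) : (0 : Sec n F E) x = 0 := rfl
@[simp] theorem sec_smul_apply (c : ℝ) (u : Sec n F E) (x : M) : (c • u) x = c • u x := rfl

@[simp] theorem sec_sum_apply {ι : Type*} (s : Finset ι) (u : ι → Sec n F E) (x : M) :
    (∑ i ∈ s, u i) x = ∑ i ∈ s, u i x :=
  map_sum (⟨⟨fun u : Sec n F E => u x, rfl⟩, fun _ _ => rfl⟩ : Sec n F E →+ E x) u s

@[simp] theorem smooth_sum_apply {ι : Type*} (s : Finset ι) (f : ι → C^∞⟮𝓡 n, M; ℝ⟯) (x : M) :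
    (∑ i ∈ s, f i) x = ∑ i ∈ s, f i x :=
  map_sum (⟨⟨fun u : C^∞⟮𝓡 n, M; ℝ⟯ => u x, rfl⟩, fun _ _ => rfl⟩ : C^∞⟮𝓡 n, M; ℝ⟯ →+ ℝ) f s

theorem deriveAlong_smooth (X : ∀ x : M, TangentSpace (𝓡 n) x)
    (hX : ContMDiff (𝓡 n) (𝓡 n).tangent ∞ (fun x => (⟨x, X x⟩ : TangentBundle (𝓡 n) M)))
    (f : C^∞⟮𝓡 n, M; ℝ⟯) : ContMDiff (𝓡 n) 𝓘(ℝ, ℝ) ∞ (fun x => deriveAlong (X x) f) := by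
  have h := (f.contMDiff.contMDiff_tangentMap (m := ∞) (by simp)).comp hX
  intro x
  have h2 := contMDiffAt_totalSpace.1 (h x)
  refine h2.2.congr_of_eventuallyEq (Eventually.of_forall fun y => ?_)
  simp [tangentMap, deriveAlong, TangentBundle.trivializationAt_apply]
  rfl

namespace CourantAlgebroid

variable (C : CourantAlgebroid n F E)

/-- The smooth function `⟨u, v⟩`. -/
def pair (u v : Sec n F E) : C^∞⟮𝓡 n, M; ℝ⟯ := ⟨fun x => C.pairing x (u x) (v x),
  C.pairing_smooth u v⟩

/-- The smooth function `u · f`. -/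
def act (u : Sec n F E) (f : C^∞⟮𝓡 n, M; ℝ⟯) : C^∞⟮𝓡 n, M; ℝ⟯ :=
  ⟨fun x => deriveAlong (C.anchor x (u x)) f,
    deriveAlong_smooth (fun x => C.anchor x (u x)) (C.anchor_smooth u) f⟩

@[simp] theorem pair_apply (u v : Sec n F E) (x : M) :
    C.pair u v x = C.pairing x (u x) (v x) := rfl

theorem act_apply (u : Sec n F E) (f : C^∞⟮𝓡 n, M; ℝ⟯) (x : M) :
    C.act u f x = deriveAlong (C.anchor x (u x)) f := rfl

theorem act_congr {u v : Sec n F E} {f g : C^∞⟮𝓡 n, M; ℝ⟯} {x : M} (hu : u x = v x)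
    (hf : ∀ᶠ y in 𝓝 x, f y = g y) : C.act u f x = C.act v g x := by
  rw [act_apply, act_apply, hu]
  exact deriveAlong_congr _ hf

theorem act_eq_zero_of_const {u : Sec n F E} {f : C^∞⟮𝓡 n, M; ℝ⟯} {x : M} {c : ℝ}
    (hf : ∀ᶠ y in 𝓝 x, f y = c) : C.act u f x = 0 := by
  rw [act_apply, deriveAlong_congr (g := fun _ => c) _ hf, deriveAlong_const]

theorem act_add (u : Sec n F E) (f g : C^∞⟮𝓡 n, M; ℝ⟯) : C.act u (f + g) = C.act u f + C.act u g := by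
  ext x
  exact deriveAlong_add _ (smooth_mdiff f x) (smooth_mdiff g x)

theorem act_mul (u : Sec n F E) (f g : C^∞⟮𝓡 n, M; ℝ⟯) :
    C.act u (f * g) = f * C.act u g + g * C.act u f := by
  ext x
  exact deriveAlong_mul _ (smooth_mdiff f x) (smooth_mdiff g x)

theorem act_zero (u : Sec n F E) : C.act u 0 = 0 := by
  ext x
  exact deriveAlong_const _ 0

theorem act_sum {ι : Type*} (s : Finset ι) (u : Sec n F E) (f : ι → C^∞⟮𝓡 n, M; ℝ⟯) :
    C.act u (∑ i ∈ s, f i) = ∑ i ∈ s, C.act u (f i) := by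
  classical
  induction s using Finset.induction_on with
  | empty => simp [act_zero]
  | insert a s ha h => rw [Finset.sum_insert ha, Finset.sum_insert ha, act_add, h]

theorem act_smul (u : Sec n F E) (c : ℝ) (f : C^∞⟮𝓡 n, M; ℝ⟯) :
    C.act u (c • f) = c • C.act u f := by
  ext x
  have h : (c • f : C^∞⟮𝓡 n, M; ℝ⟯) = (ContMDiffMap.const c : C^∞⟮𝓡 n, M; ℝ⟯) * f := by
    ext x; rfl
  rw [h, act_mul]
  have h0 : C.act u (ContMDiffMap.const c : C^∞⟮𝓡 n, M; ℝ⟯) x = 0 :=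
    C.act_eq_zero_of_const (c := c) (Eventually.of_forall fun _ => rfl)
  change c * C.act u f x + f x * _ = c * C.act u f x
  rw [h0, mul_zero, add_zero]

theorem add_act (u v : Sec n F E) (f : C^∞⟮𝓡 n, M; ℝ⟯) :
    C.act (u + v) f = C.act u f + C.act v f := by
  ext x
  change deriveAlong (C.anchor x (u x + v x)) f = _
  rw [map_add, deriveAlong_add_vec]; rfl

theorem mulSec_act (g : C^∞⟮𝓡 n, M; ℝ⟯) (u : Sec n F E) (f : C^∞⟮𝓡 n, M; ℝ⟯) :
    C.act (mulSec g u) f = g * C.act u f := by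
  ext x
  change deriveAlong (C.anchor x (g x • u x)) f = _
  rw [map_smul, deriveAlong_smul_vec]; rfl

theorem bracket_mulSec (u v : Sec n F E) (f : C^∞⟮𝓡 n, M; ℝ⟯) :
    C.bracket u (mulSec f v) = mulSec f (C.bracket u v) + mulSec (C.act u f) v := by
  ext x
  exact C.leibniz u v f x

theorem pairing_bracket_swap (u v w : Sec n F E) (x : M) :
    C.pairing x (C.bracket u v x) (w x) =
      - C.pairing x (C.bracket v u x) (w x) + C.act w (C.pair u v) x := by
  have h := C.symmetric_part u v w x
  rw [map_add, LinearMap.add_apply] at h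
  rw [act_apply]
  change _ = _ + deriveAlong _ (fun y => C.pairing y (u y) (v y))
  linarith

theorem act_pair (u v w : Sec n F E) (x : M) :
    C.act u (C.pair v w) x =
      C.pairing x (C.bracket u v x) (w x) + C.pairing x (v x) (C.bracket u w x) :=
  C.invariant u v w x

/-- That the anchor preserves brackets is not among the axioms; it follows by applying the Jacobi
identity to `f w` and comparing the coefficients of `w` where `w x ≠ 0`. If all sections vanish at
`x`, both sides are zero. -/
theorem act_bracket (u v : Sec n F E) (f : C^∞⟮𝓡 n, M; ℝ⟯) :
    C.act (C.bracket u v) f = C.act u (C.act v f) - C.act v (C.act u f) := by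
  ext x
  change _ = C.act u (C.act v f) x - C.act v (C.act u f) x
  by_cases hx : ∀ w : Sec n F E, w x = 0
  · simp only [act_apply, hx, map_zero, deriveAlong_zero_vec, sub_zero]
  · push Not at hx
    obtain ⟨w, hw⟩ := hx
    have h := congrArg (fun s : Sec n F E => s x) (C.jacobi u v (mulSec f w))
    simp only [bracket_mulSec, map_add, LinearMap.add_apply, sec_add_apply, mulSec_apply,
      C.jacobi u v w, smul_add] at h
    have h2 : (C.act (C.bracket u v) f x - (C.act u (C.act v f) x - C.act v (C.act u f) x)) • w x = 0 := by
      rw [sub_smul, sub_smul]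
      rw [← sub_eq_zero] at h
      rw [← neg_eq_zero, ← h]
      abel
    exact sub_eq_zero.1 ((smul_eq_zero.1 h2).resolve_right hw)

theorem act_symm_bracket (u v : Sec n F E) (f : C^∞⟮𝓡 n, M; ℝ⟯) :
    C.act (C.bracket u v + C.bracket v u) f = 0 := by
  rw [add_act, act_bracket, act_bracket]; abel

/-- `d_E f` is isotropic. -/
theorem pairing_symm_bracket_self (u v : Sec n F E) (x : M) :
    C.pairing x (C.bracket u v x + C.bracket v u x) (C.bracket u v x + C.bracket v u x) = 0 := by
  have h := C.symmetric_part u v (C.bracket u v + C.bracket v u) x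
  rw [sec_add_apply] at h
  rw [h]
  exact congrArg (fun g : C^∞⟮𝓡 n, M; ℝ⟯ => g x) (C.act_symm_bracket u v (C.pair u v))

theorem eq_of_pairing {x : M} {v w : E x} (h : ∀ z, C.pairing x v z = C.pairing x w z) : v = w := by
  have := (C.pairing_nondeg x).1 (v - w) fun z => by rw [map_sub, LinearMap.sub_apply, h z, sub_self]
  exact sub_eq_zero.1 this

section Locality

variable [T2Space M] [FiniteDimensional ℝ F] [ContMDiffVectorBundle ∞ F E (𝓡 n)]

/-- With a bump function `b` equal to `1` near `p` and supported where `v = w`, the section `b (v -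
w)` is zero, and the Leibniz rule evaluates its bracket at `p` to `[u, v - w]`. -/
theorem bracket_congr_right (u : Sec n F E) {v w : Sec n F E} {p : M}
    (h : ∀ᶠ x in 𝓝 p, v x = w x) : C.bracket u v p = C.bracket u w p := by
  obtain ⟨b, hb, hs⟩ := exists_bump (n := n) h
  have h0 : mulSec b (v - w) = 0 := by
    ext x
    by_cases hx : x ∈ tsupport b
    · simp [hs x hx]
    · simp [image_eq_zero_of_notMem_tsupport hx]
  have h1 := C.leibniz u (v - w) b p
  have hb1 := hb.self_of_nhds
  rw [h0, map_zero, hb1, one_smul, sec_sub_apply v w, h.self_of_nhds, sub_self, smul_zero, add_zero,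
    map_sub, sec_sub_apply, sec_zero_apply] at h1
  exact (sub_eq_zero.1 h1.symm)

theorem eq_of_pairing_sec {x : M} {v w : E x}
    (h : ∀ z : Sec n F E, C.pairing x v (z x) = C.pairing x w (z x)) : v = w :=
  C.eq_of_pairing fun z => by
    obtain ⟨t, rfl⟩ := exists_section_through (n := n) (F := F) x z
    exact h t

/-- There is no simple Leibniz rule in the first slot; swapping the arguments costs only a
derivative of `⟨u, w⟩`, which is itself local. -/
theorem bracket_congr_left {u v : Sec n F E} (w : Sec n F E) {p : M}
    (h : ∀ᶠ x in 𝓝 p, u x = v x) : C.bracket u w p = C.bracket v w p := by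
  refine C.eq_of_pairing_sec fun z => ?_
  rw [C.pairing_bracket_swap, C.pairing_bracket_swap v, C.bracket_congr_right w h]
  congr 1
  refine C.act_congr rfl ?_
  filter_upwards [h] with x hx
  simp [hx]

theorem bracket_congr {u v u' v' : Sec n F E} {p : M}
    (h : ∀ᶠ x in 𝓝 p, u x = u' x) (h' : ∀ᶠ x in 𝓝 p, v x = v' x) :
    ∀ᶠ x in 𝓝 p, C.bracket u v x = C.bracket u' v' x := by
  filter_upwards [h.eventually_nhds, h'.eventually_nhds] with x hx hx'
  rw [C.bracket_congr_left v hx, C.bracket_congr_right u' hx']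

/-- Sections with constant pairing near `p` have antisymmetric brackets near `p`. -/
theorem bracket_antisymm {u v : Sec n F E} {p : M} {c : ℝ}
    (h : ∀ᶠ x in 𝓝 p, C.pairing x (u x) (v x) = c) :
    C.bracket u v p = - C.bracket v u p := by
  refine C.eq_of_pairing_sec fun z => ?_
  rw [C.pairing_bracket_swap, C.act_eq_zero_of_const (f := C.pair u v) h, map_neg,
    LinearMap.neg_apply, add_zero]

end Locality

end CourantAlgebroid

namespace Divergence

variable {C : CourantAlgebroid n F E} (D : Divergence C)

theorem map_mulSec (f : C^∞⟮𝓡 n, M; ℝ⟯) (a : Sec n F E) :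
    D.toLin (mulSec f a) = f * D.toLin a + C.act a f := by
  ext x
  exact D.leibniz f a x

theorem congr [T2Space M] {u v : Sec n F E} {p : M} (h : ∀ᶠ x in 𝓝 p, u x = v x) :
    ∀ᶠ x in 𝓝 p, D.toLin u x = D.toLin v x := by
  filter_upwards [h.eventually_nhds] with q hq
  obtain ⟨b, hb, hs⟩ := exists_bump (n := n) hq
  have h0 : mulSec b (u - v) = 0 := by
    ext x
    by_cases hx : x ∈ tsupport b
    · simp [hs x hx]
    · simp [image_eq_zero_of_notMem_tsupport hx]
  have h1 := D.leibniz b (u - v) q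
  rw [h0, map_zero, hb.self_of_nhds, one_mul, sec_sub_apply u v, hq.self_of_nhds, sub_self,
    map_zero, deriveAlong_zero_vec, add_zero, map_sub] at h1
  exact (sub_eq_zero.1 h1.symm)

end Divergence

end Calculus

/-! ### Orthonormal frames of subbundles with nondegenerate, possibly indefinite, pairing. -/

section OrthonormalBasis

variable {V : Type*} [AddCommGroup V] [Module ℝ V] 

/-- A subspace on which a symmetric form is nondegenerate has an orthonormal basis. -/
theorem exists_orthonormal_family [FiniteDimensional ℝ V] (B : LinearMap.BilinForm ℝ V)
    (hB : ∀ u v, B u v = B v u)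
    (W : Submodule ℝ V) (hW : ∀ v ∈ W, (∀ w ∈ W, B v w = 0) → v = 0) :
    ∃ (w : Fin (finrank ℝ W) → V) (η : Fin (finrank ℝ W) → ℝ),
      (∀ i, w i ∈ W) ∧ (∀ i, η i * η i = 1) ∧ ∀ i j, B (w i) (w j) = if i = j then η i else 0 := by
  have hsym : LinearMap.IsSymm (B.restrict W) := ⟨fun u v => hB u v⟩
  obtain ⟨v, hv⟩ := LinearMap.BilinForm.exists_orthogonal_basis hsym
  have hne : ∀ i, B (v i) (v i) ≠ 0 := by
    intro i h0
    have : (v i : V) = 0 := by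
      refine hW _ (v i).2 fun w hw => ?_
      have hsum := v.sum_repr ⟨w, hw⟩
      have : w = ∑ j, v.repr ⟨w, hw⟩ j • (v j : V) := by
        have := congrArg W.subtype hsum
        rw [map_sum] at this
        exact this.symm
      rw [this, map_sum]
      refine Finset.sum_eq_zero fun j _ => ?_
      rw [map_smul]
      by_cases hij : i = j
      · subst hij; rw [h0, smul_zero]
      · have : B (v i) (v j) = 0 := hv hij
        rw [this, smul_zero]
    exact v.ne_zero i (Subtype.ext this)
  let q : Fin (finrank ℝ W) → ℝ := fun i => B (v i) (v i)
  have hsq : ∀ i, 0 < √|q i| := fun i => Real.sqrt_pos.2 (abs_pos.2 (hne i))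
  refine ⟨fun i => (√|q i|)⁻¹ • (v i : V), fun i => |q i|⁻¹ * q i, fun i => W.smul_mem _ (v i).2, ?_, ?_⟩
  · intro i
    have h1 : |q i| ≠ 0 := (abs_pos.2 (hne i)).ne'
    have h2 : q i * q i = |q i| * |q i| := (abs_mul_abs_self _).symm
    field_simp
    rw [sq, h2, sq]
  · intro i j
    simp only [map_smul, LinearMap.smul_apply, smul_eq_mul]
    split_ifs with h
    · subst h
      have h2 : √|q i| * √|q i| = |q i| := Real.mul_self_sqrt (abs_nonneg _)
      rw [← mul_assoc, ← mul_inv, h2]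
    · have : B (v i) (v j) = 0 := hv h
      rw [this]; ring

end OrthonormalBasis

section ONFrame

variable {n : ℕ} {M : Type*} [TopologicalSpace M] [ChartedSpace (EuclideanSpace ℝ (Fin n)) M]
  [IsManifold (𝓡 n) ∞ M] {F : Type*} [NormedAddCommGroup F] [NormedSpace ℝ F]
  {E : M → Type*} [TopologicalSpace (TotalSpace F E)] [∀ x, TopologicalSpace (E x)]
  [∀ x, AddCommGroup (E x)] [∀ x, Module ℝ (E x)] [FiberBundle F E] [VectorBundle ℝ F E]

/-- The sections `s i` form, near `p`, an orthonormal frame of `W` with signs `η i`. -/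
structure IsONFrame (C : CourantAlgebroid n F E) (W : ∀ x, Submodule ℝ (E x)) (p : M) {k : ℕ}
    (s : Fin k → Sec n F E) (η : Fin k → ℝ) : Prop where
  sq : ∀ i, η i * η i = 1
  pairing : ∀ᶠ x in 𝓝 p, ∀ i j, C.pairing x (s i x) (s j x) = if i = j then η i else 0
  mem : ∀ᶠ x in 𝓝 p, ∀ i, s i x ∈ W x
  expand : ∀ᶠ x in 𝓝 p, ∀ v ∈ W x, v = ∑ i, (η i * C.pairing x (s i x) v) • s i x

theorem linearIndependent_of_orthonormal {V : Type*} [AddCommGroup V] [Module ℝ V]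
    (B : LinearMap.BilinForm ℝ V) {k : ℕ} {w : Fin k → V} {η : Fin k → ℝ}
    (hη : ∀ i, η i * η i = 1) (h : ∀ i j, B (w i) (w j) = if i = j then η i else 0) :
    LinearIndependent ℝ w := by
  refine Fintype.linearIndependent_iff.2 fun c hc i => ?_
  have h1 := congrArg (B (w i)) hc
  simp only [map_sum, map_smul, h, smul_eq_mul, mul_ite, mul_zero, Finset.sum_ite_eq,
    Finset.mem_univ, if_true, map_zero] at h1
  exact (mul_eq_zero.1 h1).resolve_right fun h0 => by simpa [h0] using hη i

namespace IsONFrame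

variable {C : CourantAlgebroid n F E} {W : ∀ x, Submodule ℝ (E x)} {p : M} {k : ℕ}
  {s : Fin k → Sec n F E} {η : Fin k → ℝ}

theorem linearIndependent (h : IsONFrame C W p s η) :
    ∀ᶠ x in 𝓝 p, LinearIndependent ℝ (fun i => s i x) := by
  filter_upwards [h.pairing] with x hx
  exact linearIndependent_of_orthonormal (C.pairing x) h.sq hx

theorem span (h : IsONFrame C W p s η) :
    ∀ᶠ x in 𝓝 p, Submodule.span ℝ (Set.range fun i => s i x) = W x := by
  filter_upwards [h.mem, h.expand] with x hx hx'
  refine le_antisymm (Submodule.span_le.2 ?_) fun v hv => ?_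
  · rintro _ ⟨i, rfl⟩; exact hx i
  · rw [hx' v hv]
    exact Submodule.sum_mem _ fun i _ => Submodule.smul_mem _ _ (Submodule.subset_span ⟨i, rfl⟩)

theorem eventually (h : IsONFrame C W p s η) : ∀ᶠ x in 𝓝 p, IsONFrame C W x s η := by
  filter_upwards [h.pairing.eventually_nhds, h.mem.eventually_nhds, h.expand.eventually_nhds]
    with x h1 h2 h3
  exact ⟨h.sq, h1, h2, h3⟩

theorem congr (h : IsONFrame C W p s η) {t : Fin k → Sec n F E}
    (ht : ∀ᶠ x in 𝓝 p, ∀ i, t i x = s i x) : IsONFrame C W p t η := by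
  refine ⟨h.sq, ?_, ?_, ?_⟩
  · filter_upwards [ht, h.pairing] with x h1 h2 i j
    rw [h1, h1, h2]
  · filter_upwards [ht, h.mem] with x h1 h2 i
    rw [h1]; exact h2 i
  · filter_upwards [ht, h.expand] with x h1 h2 v hv
    simp only [h1]
    exact h2 v hv

end IsONFrame

/-- Orthonormal sections in `W` that are complete form an orthonormal frame. -/
theorem isONFrame_of_complete {C : CourantAlgebroid n F E} {W : ∀ x, Submodule ℝ (E x)} {p : M}
    {k : ℕ} {s : Fin k → Sec n F E} {η : Fin k → ℝ} (hη : ∀ i, η i * η i = 1)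
    (hp : ∀ᶠ x in 𝓝 p, ∀ i j, C.pairing x (s i x) (s j x) = if i = j then η i else 0)
    (hm : ∀ᶠ x in 𝓝 p, ∀ i, s i x ∈ W x)
    (hc : ∀ᶠ x in 𝓝 p, ∀ v ∈ W x, (∀ i, C.pairing x (s i x) v = 0) → v = 0) :
    IsONFrame C W p s η := by
  refine ⟨hη, hp, hm, ?_⟩
  filter_upwards [hp, hm, hc] with x h1 h2 h3 v hv
  refine sub_eq_zero.1 (h3 _ (Submodule.sub_mem _ hv (Submodule.sum_mem _ fun i _ =>
    Submodule.smul_mem _ _ (h2 i))) fun i => ?_)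
  simp only [map_sub, map_sum, map_smul, h1, smul_eq_mul, mul_ite, mul_zero, Finset.sum_ite_eq,
    Finset.mem_univ, if_true]
  rw [mul_right_comm, hη, one_mul, sub_self]

/-- Gram-Schmidt orthonormalization near a point. -/
theorem exists_gramSchmidt [T2Space M] (C : CourantAlgebroid n F E) (p : M) :
    ∀ {k : ℕ} (t : Fin k → Sec n F E) (η : Fin k → ℝ), (∀ i, η i * η i = 1) →
      (∀ i j, C.pairing p (t i p) (t j p) = if i = j then η i else 0) →
      ∃ s : Fin k → Sec n F E, (∀ i, s i p = t i p) ∧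
        (∀ᶠ x in 𝓝 p, ∀ i j, C.pairing x (s i x) (s j x) = if i = j then η i else 0) ∧
        ∀ x i, s i x ∈ Submodule.span ℝ (Set.range fun j => t j x)
  | 0, t, _, _, _ => ⟨t, fun _ => rfl, Eventually.of_forall fun _ i => i.elim0, fun _ i => i.elim0⟩
  | k + 1, t, η, hη, ht => by
    obtain ⟨s, hsp, hs, hspan⟩ := exists_gramSchmidt C p (fun i : Fin k => t i.castSucc)
      (fun i => η i.castSucc) (fun i => hη _) (fun i j => by rw [ht]; simp)
    let l := Fin.last k
    let u : Sec n F E := t l - ∑ i, mulSec (η i.castSucc • C.pair (s i) (t l)) (s i)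
    have hux : ∀ x, u x = t l x - ∑ i, (η i.castSucc * C.pairing x (s i x) (t l x)) • s i x := by
      intro x
      simp only [u, sec_sub_apply, sec_sum_apply, mulSec_apply]
      rfl
    have hup : u p = t l p := by
      rw [hux, Finset.sum_eq_zero, sub_zero]
      intro i _
      rw [hsp, ht, if_neg (Fin.castSucc_lt_last i).ne, mul_zero, zero_smul]
    have horth : ∀ᶠ x in 𝓝 p, ∀ j, C.pairing x (s j x) (u x) = 0 := by
      filter_upwards [hs] with x hx j
      rw [hux]
      simp only [map_sub, map_sum, map_smul, hx, smul_eq_mul, mul_ite, mul_zero, Finset.sum_ite_eq,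
        Finset.mem_univ, if_true]
      rw [mul_right_comm, hη, one_mul, sub_self]
    -- The sign `η l` makes this squared length equal to `1` at `p`, hence positive nearby, so that
    -- the last vector can be normalized by a smooth inverse square root without changing its value
    -- at `p`.
    let N : C^∞⟮𝓡 n, M; ℝ⟯ := η l • C.pair u u
    have hN : ∀ x, N x = η l * C.pairing x (u x) (u x) := fun _ => rfl
    have hNp : N p = 1 := by rw [hN, hup, ht, if_pos rfl, hη]
    have hpos : ∀ᶠ x in 𝓝 p, 0 < N x :=
      N.contMDiff.continuous.continuousAt.eventually (lt_mem_nhds (by rw [hNp]; exact one_pos))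
    obtain ⟨φ, hφ⟩ := exists_smooth_extend (n := n) (p := p) (f := fun x => (√(N x))⁻¹) (by
      filter_upwards [hpos] with x hx
      have h1 : ContDiffAt ℝ ∞ (fun y : ℝ => (√y)⁻¹) (N x) :=
        (Real.contDiffAt_sqrt hx.ne').inv (Real.sqrt_pos.2 hx).ne'
      exact h1.contMDiffAt.comp x (N.contMDiff x))
    have hφp : φ p = 1 := by rw [hφ.self_of_nhds, hNp]; simp
    refine ⟨Fin.snoc s (mulSec φ u), ?_, ?_, ?_⟩
    · intro i
      refine Fin.lastCases ?_ (fun i => ?_) i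
      · rw [Fin.snoc_last, mulSec_apply, hφp, one_smul, hup]
      · rw [Fin.snoc_castSucc, hsp]
    · filter_upwards [hs, horth, hpos, hφ] with x h1 h2 h3 h4 i j
      have h5 : φ x * φ x * N x = 1 := by
        rw [h4, ← mul_inv, Real.mul_self_sqrt h3.le, inv_mul_cancel₀ h3.ne']
      refine Fin.lastCases ?_ (fun i => ?_) i <;> refine Fin.lastCases ?_ (fun j => ?_) j
      · simp only [Fin.snoc_last, mulSec_apply, map_smul, LinearMap.smul_apply, smul_eq_mul,
          if_true]
        rw [hN] at h5
        have := hη l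
        linear_combination (η l) * h5 - φ x * φ x * C.pairing x (u x) (u x) * this
      · simp only [Fin.snoc_last, Fin.snoc_castSucc, mulSec_apply, map_smul, LinearMap.smul_apply,
          smul_eq_mul, C.pairing_symm x (u x), h2, mul_zero, if_neg (Fin.castSucc_lt_last j).ne']
      · simp only [Fin.snoc_last, Fin.snoc_castSucc, mulSec_apply, map_smul, LinearMap.smul_apply,
          smul_eq_mul, h2, mul_zero, if_neg (Fin.castSucc_lt_last i).ne]
      · simp only [Fin.snoc_castSucc, h1, Fin.castSucc_inj]
    · intro x i
      have hsub : ∀ j, s j x ∈ Submodule.span ℝ (Set.range fun j => t j x) := fun j =>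
        Submodule.span_mono (by rintro _ ⟨i, rfl⟩; exact ⟨i.castSucc, rfl⟩) (hspan x j)
      refine Fin.lastCases ?_ (fun i => ?_) i
      · rw [Fin.snoc_last, mulSec_apply, hux]
        exact Submodule.smul_mem _ _ (Submodule.sub_mem _ (Submodule.subset_span ⟨l, rfl⟩)
          (Submodule.sum_mem _ fun j _ => Submodule.smul_mem _ _ (hsub j)))
      · rw [Fin.snoc_castSucc]
        exact hsub i

/-- An orthonormal family of the right size is complete. -/
theorem complete_of_finrank {V : Type*} [AddCommGroup V] [Module ℝ V] [FiniteDimensional ℝ V]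
    (B : LinearMap.BilinForm ℝ V) (hB : ∀ u v, B u v = B v u) {W : Submodule ℝ V}
    (hW : ∀ v ∈ W, (∀ w ∈ W, B v w = 0) → v = 0) {k : ℕ} {w : Fin k → V} {η : Fin k → ℝ}
    (hη : ∀ i, η i * η i = 1) (h : ∀ i j, B (w i) (w j) = if i = j then η i else 0)
    (hw : ∀ i, w i ∈ W) (hk : finrank ℝ W = k) {v : V} (hv : v ∈ W) (hv0 : ∀ i, B (w i) v = 0) :
    v = 0 := by
  have hli := linearIndependent_of_orthonormal B hη h
  have hspan : Submodule.span ℝ (Set.range w) = W := by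
    refine Submodule.eq_of_le_of_finrank_eq (Submodule.span_le.2 ?_) ?_
    · rintro _ ⟨i, rfl⟩; exact hw i
    · rw [finrank_span_eq_card hli, hk, Fintype.card_fin]
  refine hW v hv fun w hw => ?_
  rw [← hspan] at hw
  rw [hB]
  induction hw using Submodule.span_induction with
  | mem w hw => obtain ⟨i, rfl⟩ := hw; exact hv0 i
  | zero => simp
  | add a b _ _ ha hb => rw [map_add, LinearMap.add_apply, ha, hb, add_zero]
  | smul r a _ ha => rw [map_smul, LinearMap.smul_apply, ha, smul_zero]

/-- A subbundle with nondegenerate pairing has orthonormal frames with prescribed value at `p`. -/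
theorem exists_ONFrame [T2Space M] [FiniteDimensional ℝ F] (C : CourantAlgebroid n F E)
    {W : ∀ x, Submodule ℝ (E x)}
    (hW : IsSubbundle n F W) (hnd : ∀ x, ∀ v ∈ W x, (∀ w ∈ W x, C.pairing x v w = 0) → v = 0) (p : M)
    {k : ℕ} (hk : k = finrank ℝ (W p)) (w : Fin k → E p) (η : Fin k → ℝ) (hw : ∀ i, w i ∈ W p)
    (hη : ∀ i, η i * η i = 1)
    (hp : ∀ i j, C.pairing p (w i) (w j) = if i = j then η i else 0) :
    ∃ s : Fin k → Sec n F E, (∀ i, s i p = w i) ∧ IsONFrame C W p s η := by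
  obtain ⟨l, t, ht⟩ := hW p
  obtain ⟨hli, hsp⟩ := ht.self_of_nhds
  have hc : ∀ i, ∃ c : Fin l → ℝ, ∑ j, c j • t j p = w i := fun i =>
    (Submodule.mem_span_range_iff_exists_fun ℝ).1 (by rw [hsp]; exact hw i)
  choose c hc using hc
  have hval : ∀ i x, (∑ j, c i j • t j) x = ∑ j, c i j • t j x := fun i x => by
    rw [sec_sum_apply]; rfl
  obtain ⟨s, hs1, hs2, hs3⟩ := exists_gramSchmidt C p (fun i => ∑ j, c i j • t j) η hη (fun i j => by
    rw [hval, hval, hc, hc, hp])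
  refine ⟨s, fun i => by rw [hs1, hval, hc], ?_⟩
  have hm : ∀ᶠ x in 𝓝 p, ∀ i, s i x ∈ W x := by
    filter_upwards [ht] with x hx i
    refine Submodule.span_le.2 ?_ (hs3 x i)
    rintro _ ⟨j, rfl⟩
    change (∑ m, c j m • t m) x ∈ W x
    rw [hval, ← hx.2]
    exact Submodule.sum_mem _ fun j _ => Submodule.smul_mem _ _ (Submodule.subset_span ⟨j, rfl⟩)
  have hkl : k = l := by
    rw [hk, ← hsp, finrank_span_eq_card hli, Fintype.card_fin]
  refine isONFrame_of_complete hη hs2 hm ?_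
  filter_upwards [hs2, hm, ht] with x h1 h2 h3 v hv hv0
  have := VectorBundle.finiteDimensional ℝ F E x
  exact complete_of_finrank (C.pairing x) (C.pairing_symm x) (hnd x) hη h1 h2
    (by rw [← h3.2, finrank_span_eq_card h3.1, Fintype.card_fin, hkl]) hv hv0

theorem exists_ONFrame' [T2Space M] [FiniteDimensional ℝ F] (C : CourantAlgebroid n F E)
    {W : ∀ x, Submodule ℝ (E x)}
    (hW : IsSubbundle n F W) (hnd : ∀ x, ∀ v ∈ W x, (∀ w ∈ W x, C.pairing x v w = 0) → v = 0) (p : M) :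
    ∃ (k : ℕ) (s : Fin k → Sec n F E) (η : Fin k → ℝ), IsONFrame C W p s η := by
  have := VectorBundle.finiteDimensional ℝ F E p
  obtain ⟨w, η, h1, h2, h3⟩ := exists_orthonormal_family (C.pairing p) (C.pairing_symm p) (W p) (hnd p)
  obtain ⟨s, -, hs⟩ := exists_ONFrame C hW hnd p rfl w η h1 h2 h3
  exact ⟨_, s, η, hs⟩

end ONFrame

/-! ### Independence of the scalar curvature from the orthonormal frame. -/

section Algebra

variable {ι : Type*} [Fintype ι]

theorem sum_cyclic (f : ι → ι → ι → ℝ) :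
    ∑ a, ∑ b, ∑ c, f b c a = ∑ a, ∑ b, ∑ c, f a b c := by
  rw [Finset.sum_comm]
  refine Finset.sum_congr rfl fun b _ => ?_
  rw [Finset.sum_comm]

theorem sum_mul_ite_left [DecidableEq ι] (η f : ι → ℝ) (hη : ∀ i, η i * η i = 1) (a : ι) :
    ∑ c, η c * ((if a = c then η a else 0) * f c) = f a := by
  simp only [ite_mul, zero_mul, mul_ite, mul_zero, Finset.sum_ite_eq, Finset.mem_univ, if_true]
  rw [← mul_assoc, hη, one_mul]

/-- The summand is `2 φ a b c - φ b c a - φ c a b` for a suitable `φ`, and a sum over all triples is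
unchanged by cyclic relabelling. -/
theorem cubic_terms_cancel (η : ι → ℝ) (C al : ι → ι → ι → ℝ)
    (hal : ∀ a b c, al a b c = - al b a c) (hC : ∀ a b c, C b c a = C a b c) :
    ∑ a, ∑ b, ∑ c, η a * η b * η c * (- (al a c b * al b c a)
      + 1 / 3 * ((C a b c + (al b c a - al a c b) + al a b c) ^ 2 - C a b c ^ 2)
      - 1 / 2 * (2 * ((al b c a - al a c b) * C a b c) + (al b c a - al a c b) ^ 2
        + 2 * ((al b c a - al a c b) * al a b c))) = 0 := by
  let φ : ι → ι → ι → ℝ := fun a b c => η a * η b * η c *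
    (1 / 3 * (C a b c * al a b c) + 1 / 6 * al a b c ^ 2 + 1 / 3 * (al b c a * al c a b))
  have h1 := sum_cyclic φ
  have h2 := sum_cyclic fun a b c => φ b c a
  have h3 : ∑ a, ∑ b, ∑ c, (2 * φ a b c - φ b c a - φ c a b) = 0 := by
    simp only [Finset.sum_sub_distrib, ← Finset.mul_sum]
    rw [h1, h2, h1]; ring
  rw [← h3]
  refine Finset.sum_congr rfl fun a _ => Finset.sum_congr rfl fun b _ =>
    Finset.sum_congr rfl fun c _ => ?_
  simp only [φ]
  rw [hal a c b, hC a b c, ← hC c a b]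
  ring

/-- The algebraic core of frame independence. In the application `al` holds the first derivatives of
the transition matrix, `H` its second derivatives, `K` its derivatives along `[s_a, s_b]`, `C` the
structure constants and `N` the norms of `[s_a, s_b]`. The second derivatives enter only
symmetrized, so `hH` trades them for `K`; this cancels against the `K` coming from the norms of the
new brackets. The terms with `D` and those quadratic in the traces of `al` cancel separately, which
leaves `cubic_terms_cancel`. -/
theorem scalar_invariance_algebra (η : ι → ℝ) (C al : ι → ι → ι → ℝ) (H K N : ι → ι → ℝ)
    (dD D : ι → ℝ) (hal : ∀ a b c, al a b c = - al b a c) (hC : ∀ a b c, C b c a = C a b c)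
    (hH : ∀ a b, H a b + H b a = K a b - ∑ c, η c * (al a c b * al b c a + al a c a * al b c b)) :
    (∑ a, η a * (2 * (dD a + ∑ b, η b * (al a b a * D b) + ∑ b, η b * H a b)
        + (D a + ∑ b, η b * al a b b) * (D a + ∑ b, η b * al a b b))
      + 1 / 3 * ∑ a, ∑ b, ∑ c, η a * η b * η c * (C a b c + (al b c a - al a c b) + al a b c) ^ 2
      - 1 / 2 * ∑ a, ∑ b, η a * η b * (N a b + 2 * K a b
        + ∑ c, η c * (2 * ((al b c a - al a c b) * C a b c) + (al b c a - al a c b) ^ 2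
        + 2 * ((al b c a - al a c b) * al a b c)))) =
    ∑ a, η a * (2 * dD a + D a * D a) + 1 / 3 * ∑ a, ∑ b, ∑ c, η a * η b * η c * C a b c ^ 2
      - 1 / 2 * ∑ a, ∑ b, η a * η b * N a b := by
  let t : ι → ℝ := fun a => ∑ b, η b * al a b b
  have h1 : ∑ a, ∑ b, η a * (η b * (al a b a * D b)) = - ∑ b, η b * (D b * t b) := by
    rw [Finset.sum_comm, ← Finset.sum_neg_distrib]
    refine Finset.sum_congr rfl fun b _ => ?_
    simp only [t, Finset.mul_sum, ← Finset.sum_neg_distrib]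
    refine Finset.sum_congr rfl fun a _ => ?_
    rw [hal a b a]; ring
  have h2 : 2 * ∑ a, ∑ b, η a * (η b * H a b) = ∑ a, ∑ b, η a * η b * K a b
      - ∑ a, ∑ b, ∑ c, η a * η b * η c * (al a c b * al b c a) - ∑ c, η c * (t c * t c) := by
    have h3 : ∑ a, ∑ b, η a * (η b * H a b) = ∑ a, ∑ b, η a * (η b * H b a) := by
      rw [Finset.sum_comm]
      exact Finset.sum_congr rfl fun a _ => Finset.sum_congr rfl fun b _ => by ring
    have h4 : ∑ c, η c * (t c * t c) =
        ∑ a, ∑ b, ∑ c, η a * η b * η c * (al a c a * al b c b) := by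
      rw [← sum_cyclic]
      refine Finset.sum_congr rfl fun c _ => ?_
      simp only [t]
      rw [Finset.sum_mul_sum, Finset.mul_sum]
      refine Finset.sum_congr rfl fun a _ => ?_
      rw [Finset.mul_sum]
      refine Finset.sum_congr rfl fun b _ => ?_
      rw [hal c a a, hal c b b]; ring
    rw [two_mul]
    nth_rewrite 2 [h3]
    rw [h4, ← Finset.sum_add_distrib, ← Finset.sum_sub_distrib, ← Finset.sum_sub_distrib]
    refine Finset.sum_congr rfl fun a _ => ?_
    rw [← Finset.sum_add_distrib, ← Finset.sum_sub_distrib, ← Finset.sum_sub_distrib]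
    refine Finset.sum_congr rfl fun b _ => ?_
    have h5 := hH a b
    rw [← mul_add, ← mul_add, h5, mul_sub, mul_sub, Finset.mul_sum, Finset.mul_sum, ← mul_assoc,
      sub_sub, ← Finset.sum_add_distrib]
    congr 1
    exact Finset.sum_congr rfl fun c _ => by ring
  have h3 := cubic_terms_cancel η C al hal hC
  have e1 : ∑ a, η a * (2 * (dD a + ∑ b, η b * (al a b a * D b) + ∑ b, η b * H a b)
        + (D a + ∑ b, η b * al a b b) * (D a + ∑ b, η b * al a b b)) =
      ∑ a, η a * (2 * dD a + D a * D a) + 2 * ∑ a, ∑ b, η a * (η b * (al a b a * D b))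
        + 2 * ∑ a, ∑ b, η a * (η b * H a b) + 2 * ∑ b, η b * (D b * t b)
        + ∑ c, η c * (t c * t c) := by
    rw [Finset.mul_sum, Finset.mul_sum, Finset.mul_sum, ← Finset.sum_add_distrib,
      ← Finset.sum_add_distrib, ← Finset.sum_add_distrib, ← Finset.sum_add_distrib]
    refine Finset.sum_congr rfl fun a _ => ?_
    rw [← Finset.mul_sum, ← Finset.mul_sum]
    simp only [t]
    ring
  have e2 : ∑ a, ∑ b, η a * η b * (N a b + 2 * K a b
        + ∑ c, η c * (2 * ((al b c a - al a c b) * C a b c) + (al b c a - al a c b) ^ 2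
        + 2 * ((al b c a - al a c b) * al a b c))) =
      ∑ a, ∑ b, η a * η b * N a b + 2 * ∑ a, ∑ b, η a * η b * K a b +
      ∑ a, ∑ b, ∑ c, η a * η b * η c * (2 * ((al b c a - al a c b) * C a b c)
        + (al b c a - al a c b) ^ 2 + 2 * ((al b c a - al a c b) * al a b c)) := by
    simp only [Finset.mul_sum, ← Finset.sum_add_distrib]
    refine Finset.sum_congr rfl fun a _ => Finset.sum_congr rfl fun b _ => ?_
    rw [mul_add, Finset.mul_sum]
    congr 1
    · ring
    · exact Finset.sum_congr rfl fun c _ => by ring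
  have e3 : ∑ a, ∑ b, ∑ c, η a * η b * η c * (- (al a c b * al b c a)
      + 1 / 3 * ((C a b c + (al b c a - al a c b) + al a b c) ^ 2 - C a b c ^ 2)
      - 1 / 2 * (2 * ((al b c a - al a c b) * C a b c) + (al b c a - al a c b) ^ 2
        + 2 * ((al b c a - al a c b) * al a b c))) =
      - ∑ a, ∑ b, ∑ c, η a * η b * η c * (al a c b * al b c a)
      + 1 / 3 * ∑ a, ∑ b, ∑ c, η a * η b * η c * (C a b c + (al b c a - al a c b) + al a b c) ^ 2
      - 1 / 3 * ∑ a, ∑ b, ∑ c, η a * η b * η c * C a b c ^ 2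
      - 1 / 2 * ∑ a, ∑ b, ∑ c, η a * η b * η c * (2 * ((al b c a - al a c b) * C a b c)
        + (al b c a - al a c b) ^ 2 + 2 * ((al b c a - al a c b) * al a b c)) := by
    simp only [Finset.mul_sum, ← Finset.sum_neg_distrib, ← Finset.sum_add_distrib,
      ← Finset.sum_sub_distrib]
    refine Finset.sum_congr rfl fun a _ => Finset.sum_congr rfl fun b _ =>
      Finset.sum_congr rfl fun c _ => ?_
    ring
  rw [e3] at h3
  rw [e1, e2, h1, h2]
  linear_combination h3

end Algebra

section Scalar

variable {n : ℕ} {M : Type*} [TopologicalSpace M] [ChartedSpace (EuclideanSpace ℝ (Fin n)) M]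
  [IsManifold (𝓡 n) ∞ M] {F : Type*} [NormedAddCommGroup F] [NormedSpace ℝ F]
  {E : M → Type*} [TopologicalSpace (TotalSpace F E)] [∀ x, TopologicalSpace (E x)]
  [∀ x, AddCommGroup (E x)] [∀ x, Module ℝ (E x)] [FiberBundle F E] [VectorBundle ℝ F E]

/-- The generalized scalar curvature in an orthonormal frame `s` of `V₊`. -/
def scalarON {C : CourantAlgebroid n F E} (D : Divergence C) {k : ℕ} (s : Fin k → Sec n F E)
    (η : Fin k → ℝ) (p : M) : ℝ :=
  ∑ a, η a * (2 * C.act (s a) (D.toLin (s a)) p + D.toLin (s a) p * D.toLin (s a) p)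
  + 1 / 3 * ∑ a, ∑ b, ∑ c, η a * η b * η c * C.pairing p (C.bracket (s a) (s b) p) (s c p) ^ 2
  - 1 / 2 * ∑ a, ∑ b, η a * η b * C.pairing p (C.bracket (s a) (s b) p) (C.bracket (s a) (s b) p)

variable [T2Space M] [FiniteDimensional ℝ F] [ContMDiffVectorBundle ∞ F E (𝓡 n)]

theorem scalarON_congr {C : CourantAlgebroid n F E} (D : Divergence C) {k : ℕ}
    {s t : Fin k → Sec n F E} (η : Fin k → ℝ) {p : M} (h : ∀ᶠ x in 𝓝 p, ∀ i, s i x = t i x) :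
    scalarON D s η p = scalarON D t η p := by
  have hi : ∀ i, ∀ᶠ x in 𝓝 p, s i x = t i x := fun i => h.mono fun x hx => hx i
  have h1 : ∀ i, C.act (s i) (D.toLin (s i)) p = C.act (t i) (D.toLin (t i)) p := fun i =>
    C.act_congr (hi i).self_of_nhds (D.congr (hi i))
  have h2 : ∀ i, D.toLin (s i) p = D.toLin (t i) p := fun i => (D.congr (hi i)).self_of_nhds
  have h3 : ∀ i j, C.bracket (s i) (s j) p = C.bracket (t i) (t j) p := fun i j =>
    (C.bracket_congr (hi i) (hi j)).self_of_nhds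
  simp only [scalarON, h1, h2, h3, fun i => (hi i).self_of_nhds]

/-- The scalar curvature does not depend on the orthonormal frame. -/
theorem scalarON_eq {C : CourantAlgebroid n F E} (D : Divergence C) {W : ∀ x, Submodule ℝ (E x)}
    {p : M} {k : ℕ} {s s' : Fin k → Sec n F E} {η : Fin k → ℝ} (h : IsONFrame C W p s η)
    (h' : IsONFrame C W p s' η) (hp : ∀ i, s' i p = s i p) :
    scalarON D s' η p = scalarON D s η p := by
  have hη := h.sq
  -- Up to the signs `η`, this is the transition matrix: near `p` one has `s'_a = ∑ η_b G_{ab} s_b`,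
  -- and at `p` it is the identity.
  let G : Fin k → Fin k → C^∞⟮𝓡 n, M; ℝ⟯ := fun a b => C.pair (s' a) (s b)
  let t : Fin k → Sec n F E := fun a => ∑ b, mulSec (η b • G a b) (s b)
  have hs't : ∀ᶠ x in 𝓝 p, ∀ a, s' a x = t a x := by
    filter_upwards [h.expand, h'.mem] with x h1 h2 a
    rw [h1 _ (h2 a)]
    simp only [t, sec_sum_apply]
    refine Finset.sum_congr rfl fun b _ => ?_
    rw [C.pairing_symm]; rfl
  have hs'ta : ∀ a, ∀ᶠ x in 𝓝 p, s' a x = t a x := fun a => hs't.mono fun x hx => hx a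
  have hGp : ∀ a b, G a b p = if a = b then η a else 0 := fun a b => by
    rw [CourantAlgebroid.pair_apply, hp, h.pairing.self_of_nhds]
  -- Orthogonality of the transition matrix holds in a whole neighbourhood, so it may be
  -- differentiated. One derivative gives the antisymmetry `hanti`, two give the relation `hH`.
  have hGG : ∀ a b, ∀ᶠ x in 𝓝 p, (∑ c, η c • (G a c * G b c)) x = if a = b then η a else 0 := by
    intro a b
    filter_upwards [hs't, h.pairing, h'.pairing] with x h1 h2 h3
    rw [← h3 a b]
    nth_rewrite 1 [h1 a]
    simp only [smooth_sum_apply, t, sec_sum_apply, map_sum, LinearMap.sum_apply, mulSec_apply,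
      map_smul, LinearMap.smul_apply]
    refine Finset.sum_congr rfl fun c _ => ?_
    change η c * (G a c x * G b c x) = (η c * G a c x) * _
    rw [C.pairing_symm x (s c x) (s' b x)]
    exact (mul_assoc _ _ _).symm
  have hact1 : ∀ (u : Sec n F E) a b, C.act u (∑ c, η c • (G a c * G b c)) =
      ∑ c, η c • (G a c * C.act u (G b c) + G b c * C.act u (G a c)) := by
    intro u a b
    rw [C.act_sum]
    refine Finset.sum_congr rfl fun c _ => ?_
    rw [C.act_smul, C.act_mul]
  have hcol : ∀ (a : Fin k) (f : Fin k → ℝ), ∑ c, η c * (G a c p * f c) = f a := by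
    intro a f
    simp only [hGp]
    exact sum_mul_ite_left η f hη a
  have hanti : ∀ (u : Sec n F E) a b, C.act u (G a b) p = - C.act u (G b a) p := by
    intro u a b
    have h1 := C.act_eq_zero_of_const (u := u) (hGG a b)
    rw [hact1, smooth_sum_apply] at h1
    have h2 : ∀ c, (η c • (G a c * C.act u (G b c) + G b c * C.act u (G a c)) :
        C^∞⟮𝓡 n, M; ℝ⟯) p = η c * (G a c p * C.act u (G b c) p) +
          η c * (G b c p * C.act u (G a c) p) := fun c => mul_add _ _ _
    simp only [h2, Finset.sum_add_distrib] at h1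
    rw [hcol, hcol] at h1
    linarith
  let al : Fin k → Fin k → Fin k → ℝ := fun a b c => C.act (s c) (G a b) p
  let H : Fin k → Fin k → ℝ := fun a b => C.act (s a) (C.act (s b) (G a b)) p
  let K : Fin k → Fin k → ℝ := fun a b => C.act (C.bracket (s a) (s b)) (G a b) p
  have hH : ∀ a b, H a b + H b a =
      K a b - ∑ c, η c * (al a c b * al b c a + al a c a * al b c b) := by
    intro a b
    have h0 : ∀ᶠ x in 𝓝 p, C.act (s b) (∑ c, η c • (G a c * G b c)) x = 0 := by
      filter_upwards [(hGG a b).eventually_nhds] with x hx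
      exact C.act_eq_zero_of_const hx
    have h1 := C.act_eq_zero_of_const (u := s a) h0
    rw [hact1, C.act_sum, smooth_sum_apply] at h1
    have h2 : ∀ c, C.act (s a) (η c • (G a c * C.act (s b) (G b c) + G b c * C.act (s b) (G a c))) p
        = η c * (G a c p * C.act (s a) (C.act (s b) (G b c)) p)
          + η c * (G b c p * C.act (s a) (C.act (s b) (G a c)) p)
          + η c * (al a c b * al b c a + al a c a * al b c b) := by
      intro c
      rw [C.act_smul, C.act_add, C.act_mul, C.act_mul]
      change η c * ((G a c p * C.act (s a) (C.act (s b) (G b c)) p +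
        C.act (s b) (G b c) p * C.act (s a) (G a c) p) +
        (G b c p * C.act (s a) (C.act (s b) (G a c)) p +
        C.act (s b) (G a c) p * C.act (s a) (G b c) p)) = _
      simp only [al]
      ring
    simp only [h2, Finset.sum_add_distrib] at h1
    rw [hcol, hcol] at h1
    have h3 : K a b = - (C.act (s a) (C.act (s b) (G b a)) p - H b a) := by
      change C.act (C.bracket (s a) (s b)) (G a b) p = _
      rw [hanti, C.act_bracket]; rfl
    have h4 : C.act (s a) (C.act (s b) (G a b)) p = H a b := rfl
    rw [h3]
    linarith
  have hD : ∀ a, ∀ᶠ x in 𝓝 p, D.toLin (s' a) x =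
      (∑ b, (η b • (G a b * D.toLin (s b) + C.act (s b) (G a b)))) x := by
    intro a
    filter_upwards [D.congr (hs'ta a)] with x hx
    rw [hx]
    simp only [t, map_sum, D.map_mulSec, C.act_smul]
    refine congrArg (fun f : C^∞⟮𝓡 n, M; ℝ⟯ => f x) (Finset.sum_congr rfl fun b _ => ?_)
    rw [smul_add, smul_mul_assoc]
  have hDp : ∀ a, D.toLin (s' a) p = D.toLin (s a) p + ∑ b, η b * al a b b := by
    intro a
    rw [(hD a).self_of_nhds, smooth_sum_apply]
    have : ∀ b, (η b • (G a b * D.toLin (s b) + C.act (s b) (G a b)) : C^∞⟮𝓡 n, M; ℝ⟯) p =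
        η b * (G a b p * D.toLin (s b) p) + η b * al a b b := fun b => mul_add _ _ _
    simp only [this, Finset.sum_add_distrib]
    rw [hcol]
  have hdD : ∀ a, C.act (s' a) (D.toLin (s' a)) p = C.act (s a) (D.toLin (s a)) p
      + ∑ b, η b * (al a b a * D.toLin (s b) p) + ∑ b, η b * H a b := by
    intro a
    rw [C.act_congr (hp a) (hD a), C.act_sum, smooth_sum_apply]
    have : ∀ b, C.act (s a) (η b • (G a b * D.toLin (s b) + C.act (s b) (G a b))) p =
        η b * (G a b p * C.act (s a) (D.toLin (s b)) p) + η b * (al a b a * D.toLin (s b) p)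
          + η b * H a b := by
      intro b
      rw [C.act_smul, C.act_add, C.act_mul]
      change η b * ((G a b p * C.act (s a) (D.toLin (s b)) p +
        D.toLin (s b) p * C.act (s a) (G a b) p) + H a b) = _
      simp only [al]; ring
    simp only [this, Finset.sum_add_distrib]
    rw [hcol]
  -- This is `d_E G_{ab}` at `p`, the defect of antisymmetry that appears when `s'_a` is expanded in
  -- the first slot of the bracket. It is isotropic, so it contributes to the norm of `[s'_a, s'_b]`
  -- only through cross terms.
  let z : Fin k → Fin k → E p := fun a b => C.bracket (s' a) (s b) p + C.bracket (s b) (s' a) p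
  have hz : ∀ a b (w : Sec n F E), C.pairing p (z a b) (w p) = C.act w (G a b) p := fun a b w =>
    C.symmetric_part (s' a) (s b) w p
  have hzz : ∀ a b, C.pairing p (z a b) (z a b) = 0 := fun a b =>
    C.pairing_symm_bracket_self (s' a) (s b) p
  have hbr : ∀ (u v : Sec n F E) (a : Fin k), u p = v p → 
      C.bracket u (s' a) p = C.bracket u (s a) p + ∑ c, (η c * C.act v (G a c) p) • s c p := by
    intro u v a huv
    rw [C.bracket_congr_right u (hs'ta a)]
    simp only [t, map_sum, C.bracket_mulSec, sec_sum_apply, sec_add_apply, mulSec_apply,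
      Finset.sum_add_distrib, C.act_smul]
    congr 1
    · have : ∀ c, (η c • G a c) p = if a = c then 1 else 0 := by
        intro c
        change η c * G a c p = _
        rw [hGp]
        split_ifs with hc
        · rw [hc, hη]
        · rw [mul_zero]
      simp only [this, ite_smul, one_smul, zero_smul, Finset.sum_ite_eq, Finset.mem_univ, if_true]
    · refine Finset.sum_congr rfl fun c _ => ?_
      change (η c * C.act u (G a c) p) • s c p = _
      rw [C.act_congr huv (Eventually.of_forall fun _ => rfl)]
  have hV : ∀ a b, C.bracket (s' a) (s' b) p = C.bracket (s a) (s b) p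
      + ∑ c, (η c * (al b c a - al a c b)) • s c p + z a b := by
    intro a b
    have h1 : C.bracket (s' a) (s b) p = z a b - C.bracket (s b) (s' a) p := by
      simp only [z, add_sub_cancel_right]
    have h2 : C.bracket (s a) (s b) p = - C.bracket (s b) (s a) p :=
      C.bracket_antisymm (c := if a = b then η a else 0) (h.pairing.mono fun x hx => hx a b)
    rw [hbr (s' a) (s a) b (hp a), h1, hbr (s b) (s b) a rfl, h2]
    simp only [al, mul_sub, sub_smul, Finset.sum_sub_distrib]
    abel
  let C3 : Fin k → Fin k → Fin k → ℝ := fun a b c => C.pairing p (C.bracket (s a) (s b) p) (s c p)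
  have hC1 : ∀ a b c, C3 a b c = - C3 b a c := fun a b c => by
    simp only [C3]
    rw [C.bracket_antisymm (c := if a = b then η a else 0) (h.pairing.mono fun x hx => hx a b),
      map_neg, LinearMap.neg_apply]
  have hC2 : ∀ a b c, C3 a b c = - C3 a c b := fun a b c => by
    have h1 := C.act_pair (s a) (s b) (s c) p
    rw [C.act_eq_zero_of_const (c := if b = c then η b else 0) (h.pairing.mono fun x hx => hx b c),
      C.pairing_symm p (s b p)] at h1
    simp only [C3]; linarith
  have hC : ∀ a b c, C3 b c a = C3 a b c := fun a b c => by rw [hC2, hC1, neg_neg]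
  have hsp : ∀ c d, C.pairing p (s c p) (s d p) = if c = d then η c else 0 :=
    h.pairing.self_of_nhds
  have hsum1 : ∀ (f : Fin k → ℝ) d, C.pairing p (∑ c, (η c * f c) • s c p) (s d p) = f d := by
    intro f d
    simp only [map_sum, LinearMap.sum_apply, map_smul, LinearMap.smul_apply, hsp, smul_eq_mul,
      mul_ite, mul_zero, Finset.sum_ite_eq', Finset.mem_univ, if_true]
    rw [mul_right_comm, hη, one_mul]
  have hC3' : ∀ a b c, C.pairing p (C.bracket (s' a) (s' b) p) (s' c p) =
      C3 a b c + (al b c a - al a c b) + al a b c := by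
    intro a b c
    rw [hV, hp, map_add, map_add, LinearMap.add_apply, LinearMap.add_apply, hsum1, hz]
  have hN : ∀ a b, C.pairing p (C.bracket (s' a) (s' b) p) (C.bracket (s' a) (s' b) p) =
      C.pairing p (C.bracket (s a) (s b) p) (C.bracket (s a) (s b) p) + 2 * K a b
      + ∑ c, η c * (2 * ((al b c a - al a c b) * C3 a b c) + (al b c a - al a c b) ^ 2
        + 2 * ((al b c a - al a c b) * al a b c)) := by
    intro a b
    have e1 : C.pairing p (z a b) (C.bracket (s a) (s b) p) = K a b := hz a b (C.bracket (s a) (s b))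
    have e2 : ∀ v, C.pairing p (∑ c, (η c * (al b c a - al a c b)) • s c p) v =
        ∑ c, η c * ((al b c a - al a c b) * C.pairing p v (s c p)) := by
      intro v
      simp only [map_sum, LinearMap.sum_apply, map_smul, LinearMap.smul_apply, smul_eq_mul,
        mul_assoc, C.pairing_symm p v]
    have e3 : ∀ v w, C.pairing p v w = C.pairing p w v := C.pairing_symm p
    rw [hV]
    simp only [map_add, LinearMap.add_apply]
    rw [hzz, e1, e3 _ (z a b), e1, e3 (C.bracket (s a) (s b) p) (∑ c, _), e3 (z a b) (∑ c, _), e2, e2,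
      e2]
    simp only [hsum1, hz]
    simp only [mul_add, Finset.sum_add_distrib]
    have e4 : ∀ f g : Fin k → ℝ, ∑ c, η c * (2 * (f c * g c)) = 2 * ∑ c, η c * (f c * g c) := by
      intro f g
      rw [Finset.mul_sum]
      exact Finset.sum_congr rfl fun c _ => by ring
    rw [e4, e4]
    simp only [sq, C3, al]
    ring
  have key := scalar_invariance_algebra η C3 al H K
    (fun a b => C.pairing p (C.bracket (s a) (s b) p) (C.bracket (s a) (s b) p))
    (fun a => C.act (s a) (D.toLin (s a)) p) (fun a => D.toLin (s a) p)
    (fun a b c => hanti (s c) a b) hC hH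
  simp only [scalarON, hdD, hDp, hC3', hN]
  exact key

end Scalar

/-! ### The generalized Ricci tensor in frames and its tensoriality. -/

section Ricci

variable {n : ℕ} {M : Type*} [TopologicalSpace M] [ChartedSpace (EuclideanSpace ℝ (Fin n)) M]
  [IsManifold (𝓡 n) ∞ M] {F : Type*} [NormedAddCommGroup F] [NormedSpace ℝ F]
  [FiniteDimensional ℝ F]
  {E : M → Type*} [TopologicalSpace (TotalSpace F E)] [∀ x, TopologicalSpace (E x)]
  [∀ x, AddCommGroup (E x)] [∀ x, Module ℝ (E x)] [FiberBundle F E] [VectorBundle ℝ F E]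
  {C : CourantAlgebroid n F E} (V : GenPseudometric C)

namespace GenPseudometric

theorem plusSec_apply (u : Sec n F E) (x : M) : V.plusSec u x = V.proj x (u x) := rfl

theorem minusSec_apply (u : Sec n F E) (x : M) : V.minusSec u x = u x - V.proj x (u x) := rfl

theorem proj_of_mem {x : M} {v : E x} (h : v ∈ V.plus x) : V.proj x v = v :=
  V.proj_eq h fun _ _ => rfl

theorem mem_minus_iff {x : M} {v : E x} :
    v ∈ V.minus x ↔ ∀ z ∈ V.plus x, C.pairing x z v = 0 := Iff.rfl

theorem proj_of_mem_minus {x : M} {v : E x} (h : v ∈ V.minus x) : V.proj x v = 0 :=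
  V.proj_eq (V.plus x).zero_mem fun z hz => by rw [V.mem_minus_iff.1 h z hz, map_zero]

theorem pairing_proj {x : M} {z : E x} (hz : z ∈ V.plus x) (v : E x) :
    C.pairing x z (V.proj x v) = C.pairing x z v := by
  have h : V.proj x (v - V.proj x v) = 0 := by
    rw [map_sub, V.proj_of_mem (V.proj_mem x v), sub_self]
  have h2 := (Submodule.projection_apply_eq_zero_iff (V.isCompl x)).1 h
  have h3 : C.pairing x z (v - V.proj x v) = 0 := h2 z hz
  rw [map_sub, sub_eq_zero] at h3
  exact h3.symm

theorem sub_proj_mem (x : M) (v : E x) : v - V.proj x v ∈ V.minus x := by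
  rw [mem_minus_iff]
  intro z hz
  rw [map_sub, V.pairing_proj hz, sub_self]

theorem isPlus_plusSec (u : Sec n F E) : V.IsPlus (V.plusSec u) := fun x => V.proj_mem x _

theorem isMinus_minusSec (u : Sec n F E) : V.IsMinus (V.minusSec u) := fun x => V.sub_proj_mem x _

variable {V} in
theorem IsPlus.plusSec_eq {a : Sec n F E} (h : V.IsPlus a) : V.plusSec a = a := by
  ext x; exact V.proj_of_mem (h x)

variable {V} in
theorem IsMinus.plusSec_eq {a : Sec n F E} (h : V.IsMinus a) : V.plusSec a = 0 := by
  ext x; exact V.proj_of_mem_minus (h x)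

theorem plusSec_add (u v : Sec n F E) : V.plusSec (u + v) = V.plusSec u + V.plusSec v := by
  ext x; exact map_add (V.proj x) _ _

theorem plusSec_sub (u v : Sec n F E) : V.plusSec (u - v) = V.plusSec u - V.plusSec v := by
  ext x; exact map_sub (V.proj x) _ _

theorem plusSec_zero : V.plusSec (0 : Sec n F E) = 0 := by
  ext x; exact map_zero (V.proj x)

theorem plusSec_mulSec (f : C^∞⟮𝓡 n, M; ℝ⟯) (u : Sec n F E) :
    V.plusSec (mulSec f u) = mulSec f (V.plusSec u) := by
  ext x; exact map_smul (V.proj x) _ _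

theorem minusSec_add (u v : Sec n F E) : V.minusSec (u + v) = V.minusSec u + V.minusSec v := by
  simp only [minusSec, plusSec_add]; abel

theorem minusSec_sub (u v : Sec n F E) : V.minusSec (u - v) = V.minusSec u - V.minusSec v := by
  simp only [minusSec, plusSec_sub]; abel

theorem minusSec_zero : V.minusSec (0 : Sec n F E) = 0 := by
  simp only [minusSec, plusSec_zero, sub_zero]

theorem minusSec_mulSec (f : C^∞⟮𝓡 n, M; ℝ⟯) (u : Sec n F E) :
    V.minusSec (mulSec f u) = mulSec f (V.minusSec u) := by
  ext x
  simp only [minusSec, plusSec_mulSec, sec_sub_apply, mulSec_apply, smul_sub]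

variable {V} in
theorem IsMinus.minusSec_eq {a : Sec n F E} (h : V.IsMinus a) : V.minusSec a = a := by
  rw [minusSec, h.plusSec_eq, sub_zero]

variable {V} in
theorem IsPlus.minusSec_eq {a : Sec n F E} (h : V.IsPlus a) : V.minusSec a = 0 := by
  rw [minusSec, h.plusSec_eq, sub_self]

variable {V} in
theorem IsPlus.pair_minus {a b : Sec n F E} (ha : V.IsPlus a) (hb : V.IsMinus b) (x : M) :
    C.pairing x (a x) (b x) = 0 := hb x _ (ha x)

variable {V} in
theorem IsMinus.pair_plus {a b : Sec n F E} (hb : V.IsMinus b) (ha : V.IsPlus a) (x : M) :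
    C.pairing x (b x) (a x) = 0 := by rw [C.pairing_symm]; exact hb x _ (ha x)

theorem plusSec_congr {u v : Sec n F E} {p : M} (h : ∀ᶠ x in 𝓝 p, u x = v x) :
    ∀ᶠ x in 𝓝 p, V.plusSec u x = V.plusSec v x := by
  filter_upwards [h] with x hx
  rw [plusSec_apply, plusSec_apply, hx]

theorem minusSec_congr {u v : Sec n F E} {p : M} (h : ∀ᶠ x in 𝓝 p, u x = v x) :
    ∀ᶠ x in 𝓝 p, V.minusSec u x = V.minusSec v x := by
  filter_upwards [h] with x hx
  rw [minusSec_apply, minusSec_apply, hx]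

variable {V} in
theorem IsPlus.mulSec {a : Sec n F E} (h : V.IsPlus a) (f : C^∞⟮𝓡 n, M; ℝ⟯) :
    V.IsPlus (mulSec f a) := fun x => (V.plus x).smul_mem _ (h x)

variable {V} in
theorem IsMinus.mulSec {a : Sec n F E} (h : V.IsMinus a) (f : C^∞⟮𝓡 n, M; ℝ⟯) :
    V.IsMinus (mulSec f a) := fun x => (V.minus x).smul_mem _ (h x)

end GenPseudometric

variable [T2Space M] [ContMDiffVectorBundle ∞ F E (𝓡 n)]

theorem CourantAlgebroid.mulSec_bracket (C : CourantAlgebroid n F E) {u v : Sec n F E}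
    (h : ∀ x, C.pairing x (u x) (v x) = 0) (f : C^∞⟮𝓡 n, M; ℝ⟯) :
    C.bracket (mulSec f u) v = mulSec f (C.bracket u v) - mulSec (C.act v f) u := by
  ext x
  rw [C.bracket_antisymm (c := 0) (Eventually.of_forall fun y => by simp [h]), C.bracket_mulSec,
    sec_sub_apply, mulSec_apply, C.bracket_antisymm (u := u) (v := v) (c := 0)
      (Eventually.of_forall h), sec_add_apply, mulSec_apply, smul_neg, neg_add, sub_eq_add_neg]

namespace GenPseudometric

/-- For orthogonal sections the anomaly of the first slot is `-(a · f) u`, which lies in `V₋` and is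
removed by the projection. This and the analogous statement for `V₋` make `[[ · , b]₋, a]₊` linear
over functions. -/
theorem plusSec_mulSec_bracket {u a : Sec n F E} (hu : V.IsMinus u) (ha : V.IsPlus a)
    (f : C^∞⟮𝓡 n, M; ℝ⟯) :
    V.plusSec (C.bracket (mulSec f u) a) = mulSec f (V.plusSec (C.bracket u a)) := by
  rw [C.mulSec_bracket (hu.pair_plus ha), plusSec_sub, (hu.mulSec _).plusSec_eq, sub_zero,
    plusSec_mulSec]

theorem minusSec_mulSec_bracket {v b : Sec n F E} (hv : V.IsPlus v) (hb : V.IsMinus b)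
    (f : C^∞⟮𝓡 n, M; ℝ⟯) :
    V.minusSec (C.bracket (mulSec f v) b) = mulSec f (V.minusSec (C.bracket v b)) := by
  rw [C.mulSec_bracket (hv.pair_minus hb), minusSec_sub, (hv.mulSec _).minusSec_eq, sub_zero,
    minusSec_mulSec]

theorem ricOp_mulSec {a b v : Sec n F E} (ha : V.IsPlus a) (hb : V.IsMinus b) (hv : V.IsPlus v)
    (f : C^∞⟮𝓡 n, M; ℝ⟯) : V.ricOp a b (mulSec f v) = mulSec f (V.ricOp a b v) := by
  rw [ricOp, minusSec_mulSec_bracket V hv hb, plusSec_mulSec_bracket V (V.isMinus_minusSec _) ha,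
    ricOp]

theorem ricOp_congr {a b v a' b' v' : Sec n F E} {p : M} (h1 : ∀ᶠ x in 𝓝 p, a x = a' x)
    (h2 : ∀ᶠ x in 𝓝 p, b x = b' x) (h3 : ∀ᶠ x in 𝓝 p, v x = v' x) :
    V.ricOp a b v p = V.ricOp a' b' v' p :=
  (V.plusSec_congr (C.bracket_congr (V.minusSec_congr (C.bracket_congr h3 h2)) h1)).self_of_nhds

theorem ricOp_add_sec (a b v w : Sec n F E) : V.ricOp a b (v + w) = V.ricOp a b v + V.ricOp a b w := by
  simp only [ricOp, map_add, LinearMap.add_apply, minusSec_add, plusSec_add]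

/-- The linear map `v ↦ [[v, b]₋, a]₊` on sections. -/
def ricOpHom (a b : Sec n F E) : Sec n F E →+ Sec n F E where
  toFun := V.ricOp a b
  map_zero' := by
    simp only [ricOp, map_zero, LinearMap.zero_apply, minusSec_zero, plusSec_zero]
  map_add' := V.ricOp_add_sec a b

theorem ricOp_sum {ι : Type*} (I : Finset ι) (a b : Sec n F E) (v : ι → Sec n F E) :
    V.ricOp a b (∑ i ∈ I, v i) = ∑ i ∈ I, V.ricOp a b (v i) :=
  map_sum (V.ricOpHom a b) v I

variable {V} {p : M} {k : ℕ} {s : Fin k → Sec n F E} {η : Fin k → ℝ}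

theorem expand_near {W : ∀ x, Submodule ℝ (E x)} (h : IsONFrame C W p s η) {v : Sec n F E}
    (hv : ∀ᶠ x in 𝓝 p, v x ∈ W x) :
    ∀ᶠ x in 𝓝 p, v x = (∑ i, mulSec (η i • C.pair (s i) v) (s i)) x := by
  filter_upwards [h.expand, hv] with x hx hvx
  rw [sec_sum_apply]
  exact hx _ hvx

theorem ricOp_expand (h : IsONFrame C V.plus p s η) (hs : ∀ i, V.IsPlus (s i)) {a b v : Sec n F E}
    (ha : V.IsPlus a) (hb : V.IsMinus b) (hv : V.IsPlus v) :
    V.ricOp a b v p = ∑ i, (η i * C.pairing p (s i p) (v p)) • V.ricOp a b (s i) p := by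
  rw [V.ricOp_congr (Eventually.of_forall fun _ => rfl) (Eventually.of_forall fun _ => rfl)
    (expand_near h (Eventually.of_forall hv)), ricOp_sum, sec_sum_apply]
  refine Finset.sum_congr rfl fun i _ => ?_
  rw [V.ricOp_mulSec ha hb (hs i)]
  rfl

/-- Linearity over functions provides an endomorphism with the property in the definition of
`ricEnd`, so the default value `0` does not occur. It is unique because every vector of `V₊` is the
value of a global section of `V₊`. -/
theorem trace_ricEnd (h : IsONFrame C V.plus p s η) (hs : ∀ i, V.IsPlus (s i)) {a b : Sec n F E}
    (ha : V.IsPlus a) (hb : V.IsMinus b) :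
    LinearMap.trace ℝ (V.plus p) (V.ricEnd a b p) =
      ∑ i, η i * C.pairing p (s i p) (V.ricOp a b (s i) p) := by
  have hfd := VectorBundle.finiteDimensional ℝ F E p
  let φ : Fin k → (V.plus p →ₗ[ℝ] ℝ) := fun i =>
    (η i • C.pairing p (s i p)) ∘ₗ (V.plus p).subtype
  let r : Fin k → V.plus p := fun i => ⟨V.ricOp a b (s i) p, V.proj_mem p _⟩
  -- Written as a sum of rank one maps, the endomorphism has its trace displayed.
  let T : V.plus p →ₗ[ℝ] V.plus p := ∑ i, (φ i).smulRight (r i)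
  have hT : ∀ w : V.plus p, (T w : E p) =
      ∑ i, (η i * C.pairing p (s i p) w) • V.ricOp a b (s i) p := by
    intro w
    simp only [T, LinearMap.sum_apply, AddSubmonoidClass.coe_finsetSum, Submodule.coe_sum]
    rfl
  have hex : ∃ T : V.plus p →ₗ[ℝ] V.plus p, ∀ (v : Sec n F E) (hv : V.IsPlus v),
      (T ⟨v p, hv p⟩ : E p) = V.ricOp a b v p :=
    ⟨T, fun v hv => by rw [hT, ricOp_expand h hs ha hb hv]⟩
  have hTe : V.ricEnd a b p = T := by
    rw [ricEnd, dif_pos hex]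
    refine LinearMap.ext fun w => Subtype.ext ?_
    obtain ⟨t, ht⟩ := exists_section_through (n := n) (F := F) p (w : E p)
    have hw : w = ⟨V.plusSec t p, V.isPlus_plusSec t p⟩ := Subtype.ext (by
      change (w : E p) = V.proj p (t p)
      rw [ht, V.proj_of_mem w.2])
    rw [hw, hex.choose_spec _ (V.isPlus_plusSec t), hT, ricOp_expand h hs ha hb (V.isPlus_plusSec t)]
  rw [hTe, map_sum]
  refine Finset.sum_congr rfl fun i _ => ?_
  rw [LinearMap.trace_smulRight]
  rfl

/-- The generalized Ricci tensor in an orthonormal frame of `V₊`. -/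
theorem GRic_eq (h : IsONFrame C V.plus p s η) (hs : ∀ i, V.IsPlus (s i)) (D : Divergence C)
    {a b : Sec n F E} (ha : V.IsPlus a) (hb : V.IsMinus b) :
    V.GRic D a b p = D.toLin (V.plusSec (C.bracket b a)) p - C.act b (D.toLin a) p
      - ∑ i, η i * C.pairing p (s i p) (V.ricOp a b (s i) p) := by
  rw [GRic, trace_ricEnd h hs ha hb]
  rfl

theorem act_expand {W : ∀ x, Submodule ℝ (E x)} (h : IsONFrame C W p s η) {v : E p} (hv : v ∈ W p)
    (f : M → ℝ) :
    deriveAlong (C.anchor p v) f =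
      ∑ i, η i * C.pairing p (s i p) v * deriveAlong (C.anchor p (s i p)) f := by
  rw [h.expand.self_of_nhds v hv]
  change mfderiv (𝓡 n) 𝓘(ℝ, ℝ) f p (C.anchor p _) = _
  rw [map_sum, map_sum]
  refine Finset.sum_congr rfl fun i _ => ?_
  rw [map_smul, map_smul, ← h.expand.self_of_nhds v hv]
  rfl

/-- The Leibniz term of the divergence is `[b, a]₊ · f`. The endomorphism changes by the rank one
map `v ↦ (v · f) [b, a]₊`, whose trace is the same function. -/
theorem GRic_mulSec_right (h : IsONFrame C V.plus p s η) (hs : ∀ i, V.IsPlus (s i))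
    (D : Divergence C) {a b : Sec n F E} (ha : V.IsPlus a) (hb : V.IsMinus b)
    (f : C^∞⟮𝓡 n, M; ℝ⟯) : V.GRic D a (mulSec f b) p = f p * V.GRic D a b p := by
  rw [GRic_eq h hs D ha hb, GRic_eq h hs D ha (hb.mulSec f), V.plusSec_mulSec_bracket hb ha,
    D.map_mulSec, C.mulSec_act]
  have h1 : ∀ i, V.ricOp a (mulSec f b) (s i) p =
      f p • V.ricOp a b (s i) p + C.act (s i) f p • V.plusSec (C.bracket b a) p := by
    intro i
    rw [ricOp, C.bracket_mulSec, minusSec_add, minusSec_mulSec, minusSec_mulSec, map_add,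
      LinearMap.add_apply, plusSec_add, V.plusSec_mulSec_bracket (V.isMinus_minusSec _) ha,
      V.plusSec_mulSec_bracket (V.isMinus_minusSec _) ha, hb.minusSec_eq]
    rfl
  have h2 := act_expand h (V.isPlus_plusSec (C.bracket b a) p) f
  simp only [h1, map_add, map_smul, smul_eq_mul, mul_add, Finset.sum_add_distrib]
  change f p * D.toLin (V.plusSec (C.bracket b a)) p + C.act (V.plusSec (C.bracket b a)) f p
    - f p * C.act b (D.toLin a) p - _ = _
  rw [C.act_apply, h2, mul_sub, mul_sub, Finset.mul_sum]
  have h3 : ∀ i, η i * (f p * C.pairing p (s i p) (V.ricOp a b (s i) p)) =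
      f p * (η i * C.pairing p (s i p) (V.ricOp a b (s i) p)) := fun i => by ring
  have h4 : ∀ i, η i * (C.act (s i) f p * C.pairing p (s i p) (V.plusSec (C.bracket b a) p)) =
      η i * C.pairing p (s i p) (V.plusSec (C.bracket b a) p) *
        deriveAlong (C.anchor p (s i p)) f := fun i => by rw [← C.act_apply]; ring
  simp only [h3, h4]
  ring

/-- The two divergence terms leave `[b, a]₊ · f + a · b · f - b · a · f`, and the trace changes by
`[a, b]₋ · f`. These agree because the anchor preserves brackets and `[b, a] = -[a, b]` for
orthogonal sections. -/
theorem GRic_mulSec_left (h : IsONFrame C V.plus p s η) (hs : ∀ i, V.IsPlus (s i))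
    (D : Divergence C) {a b : Sec n F E} (ha : V.IsPlus a) (hb : V.IsMinus b)
    (f : C^∞⟮𝓡 n, M; ℝ⟯) : V.GRic D (mulSec f a) b p = f p * V.GRic D a b p := by
  rw [GRic_eq h hs D ha hb, GRic_eq h hs D (ha.mulSec f) hb]
  have h0 : D.toLin (V.plusSec (C.bracket b (mulSec f a))) p = f p * D.toLin (V.plusSec (C.bracket b a)) p
      + C.act (V.plusSec (C.bracket b a)) f p + C.act b f p * D.toLin a p + C.act a (C.act b f) p := by
    rw [C.bracket_mulSec, plusSec_add, plusSec_mulSec, plusSec_mulSec, ha.plusSec_eq, map_add,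
      D.map_mulSec, D.map_mulSec]
    exact (add_assoc _ _ _).symm
  have h0' : C.act b (D.toLin (mulSec f a)) p = f p * C.act b (D.toLin a) p
      + C.act b f p * D.toLin a p + C.act b (C.act a f) p := by
    rw [D.map_mulSec, C.act_add, C.act_mul]
    change f p * C.act b (D.toLin a) p + D.toLin a p * C.act b f p + _ = _
    ring
  have h1 : ∀ i, V.ricOp (mulSec f a) b (s i) p =
      f p • V.ricOp a b (s i) p + C.act (V.minusSec (C.bracket (s i) b)) f p • a p := by
    intro i
    rw [ricOp, C.bracket_mulSec, plusSec_add, plusSec_mulSec, plusSec_mulSec, ha.plusSec_eq]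
    rfl
  have h2 : V.minusSec (C.bracket a b) p =
      ∑ i, (η i * C.pairing p (s i p) (a p)) • V.minusSec (C.bracket (s i) b) p := by
    have e := (V.minusSec_congr (C.bracket_congr (expand_near h (Eventually.of_forall ha))
      (Eventually.of_forall fun x => rfl : ∀ᶠ x in 𝓝 p, b x = b x))).self_of_nhds
    rw [e, map_sum, LinearMap.sum_apply]
    have hm : ∀ u : Fin k → Sec n F E, V.minusSec (∑ i, u i) = ∑ i, V.minusSec (u i) := fun u =>
      map_sum (⟨⟨V.minusSec, V.minusSec_zero⟩, V.minusSec_add⟩ : Sec n F E →+ Sec n F E) u _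
    rw [hm, sec_sum_apply]
    refine Finset.sum_congr rfl fun i _ => ?_
    rw [V.minusSec_mulSec_bracket (hs i) hb]
    rfl
  have h3 : C.act (V.minusSec (C.bracket a b)) f p =
      ∑ i, η i * (C.act (V.minusSec (C.bracket (s i) b)) f p * C.pairing p (s i p) (a p)) := by
    rw [C.act_apply, h2]
    change mfderiv (𝓡 n) 𝓘(ℝ, ℝ) f p (C.anchor p _) = _
    rw [map_sum, map_sum]
    refine Finset.sum_congr rfl fun i _ => ?_
    rw [map_smul, map_smul]
    change η i * C.pairing p (s i p) (a p) * C.act (V.minusSec (C.bracket (s i) b)) f p = _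
    ring
  have h4 : C.act (V.plusSec (C.bracket b a)) f p + C.act a (C.act b f) p - C.act b (C.act a f) p
      = C.act (V.minusSec (C.bracket a b)) f p := by
    have e1 : C.act (C.bracket a b) f p = C.act a (C.act b f) p - C.act b (C.act a f) p := by
      rw [C.act_bracket]; rfl
    have e2 : ∀ x, C.bracket b a x = - C.bracket a b x := fun x =>
      C.bracket_antisymm (c := 0) (Eventually.of_forall (hb.pair_plus ha))
    have e3 : V.plusSec (C.bracket b a) p = V.minusSec (C.bracket a b) p - C.bracket a b p := by
      rw [plusSec_apply, e2, minusSec_apply, map_neg]; abel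
    have e4 : C.act (V.plusSec (C.bracket b a)) f p =
        C.act (V.minusSec (C.bracket a b)) f p - C.act (C.bracket a b) f p := by
      rw [C.act_apply, e3]
      change mfderiv (𝓡 n) 𝓘(ℝ, ℝ) f p (C.anchor p _) = _
      rw [map_sub, map_sub]
      rfl
    rw [e4, e1]; ring
  rw [h0, h0']
  simp only [h1, map_add, map_smul, smul_eq_mul, mul_add, Finset.sum_add_distrib]
  rw [← h3, ← h4, mul_sub, mul_sub, Finset.mul_sum]
  have h5 : ∀ i, η i * (f p * C.pairing p (s i p) (V.ricOp a b (s i) p)) =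
      f p * (η i * C.pairing p (s i p) (V.ricOp a b (s i) p)) := fun i => by ring
  simp only [h5]
  ring

theorem GRic_add_left (h : IsONFrame C V.plus p s η) (hs : ∀ i, V.IsPlus (s i)) (D : Divergence C)
    {a a' b : Sec n F E} (ha : V.IsPlus a) (ha' : V.IsPlus a') (hb : V.IsMinus b) :
    V.GRic D (a + a') b p = V.GRic D a b p + V.GRic D a' b p := by
  have haa : V.IsPlus (a + a') := fun x => (V.plus x).add_mem (ha x) (ha' x)
  rw [GRic_eq h hs D ha hb, GRic_eq h hs D ha' hb, GRic_eq h hs D haa hb]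
  have h1 : ∀ i, V.ricOp (a + a') b (s i) p = V.ricOp a b (s i) p + V.ricOp a' b (s i) p := by
    intro i
    simp only [ricOp, map_add, plusSec_add, sec_add_apply]
  simp only [h1, map_add, plusSec_add, C.act_add, mul_add, Finset.sum_add_distrib]
  simp only [ContMDiffMap.coe_add, Pi.add_apply]
  ring

theorem GRic_add_right (h : IsONFrame C V.plus p s η) (hs : ∀ i, V.IsPlus (s i)) (D : Divergence C)
    {a b b' : Sec n F E} (ha : V.IsPlus a) (hb : V.IsMinus b) (hb' : V.IsMinus b') :
    V.GRic D a (b + b') p = V.GRic D a b p + V.GRic D a b' p := by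
  have hbb : V.IsMinus (b + b') := fun x => (V.minus x).add_mem (hb x) (hb' x)
  rw [GRic_eq h hs D ha hb, GRic_eq h hs D ha hb', GRic_eq h hs D ha hbb]
  have h1 : ∀ i, V.ricOp a (b + b') (s i) p = V.ricOp a b (s i) p + V.ricOp a b' (s i) p := by
    intro i
    simp only [ricOp, map_add, LinearMap.add_apply, minusSec_add, plusSec_add, sec_add_apply]
  simp only [h1, map_add, LinearMap.add_apply, plusSec_add, C.add_act, mul_add,
    Finset.sum_add_distrib]
  simp only [ContMDiffMap.coe_add, Pi.add_apply]
  ring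

theorem GRic_congr (h : IsONFrame C V.plus p s η) (hs : ∀ i, V.IsPlus (s i)) (D : Divergence C)
    {a b a' b' : Sec n F E} (ha : V.IsPlus a) (hb : V.IsMinus b) (ha' : V.IsPlus a')
    (hb' : V.IsMinus b') (haa : ∀ᶠ x in 𝓝 p, a x = a' x) (hbb : ∀ᶠ x in 𝓝 p, b x = b' x) :
    V.GRic D a b p = V.GRic D a' b' p := by
  rw [GRic_eq h hs D ha hb, GRic_eq h hs D ha' hb',
    (D.congr (V.plusSec_congr (C.bracket_congr hbb haa))).self_of_nhds,
    C.act_congr hbb.self_of_nhds (D.congr haa)]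
  congr 1
  refine Finset.sum_congr rfl fun i _ => ?_
  rw [V.ricOp_congr haa hbb (Eventually.of_forall fun _ => rfl)]

/-- `GRic` vanishes at `p` if it vanishes on frames of `V₊` and `V₋`. -/
theorem GRic_eq_zero_of_frames (h : IsONFrame C V.plus p s η) (hs : ∀ i, V.IsPlus (s i))
    (D : Divergence C) {l : ℕ} {t : Fin l → Sec n F E} {θ : Fin l → ℝ}
    (ht : IsONFrame C V.minus p t θ) (ht' : ∀ i, V.IsMinus (t i))
    (h0 : ∀ i j, V.GRic D (s i) (t j) p = 0) {a b : Sec n F E} (ha : V.IsPlus a)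
    (hb : V.IsMinus b) : V.GRic D a b p = 0 := by
  have hz1 : ∀ b, V.IsMinus b → V.GRic D 0 b p = 0 := by
    intro b hb
    have h1 := GRic_add_left h hs D (a := 0) (a' := 0) (fun x => (V.plus x).zero_mem)
      (fun x => (V.plus x).zero_mem) hb
    rw [add_zero] at h1
    linarith
  have hz2 : ∀ a, V.IsPlus a → V.GRic D a 0 p = 0 := by
    intro a ha
    have h1 := GRic_add_right h hs D (b := 0) (b' := 0) ha (fun x => (V.minus x).zero_mem)
      (fun x => (V.minus x).zero_mem)
    rw [add_zero] at h1
    linarith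
  have hp1 : ∀ (I : Finset (Fin k)) (g : Fin k → C^∞⟮𝓡 n, M; ℝ⟯),
      V.IsPlus (∑ i ∈ I, mulSec (g i) (s i)) := by
    intro I g x
    rw [sec_sum_apply]
    exact (V.plus x).sum_mem fun i _ => (V.plus x).smul_mem _ (hs i x)
  have hp2 : ∀ (I : Finset (Fin l)) (g : Fin l → C^∞⟮𝓡 n, M; ℝ⟯),
      V.IsMinus (∑ i ∈ I, mulSec (g i) (t i)) := by
    intro I g x
    rw [sec_sum_apply]
    exact (V.minus x).sum_mem fun i _ => (V.minus x).smul_mem _ (ht' i x)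
  have h1 : ∀ i (g : Fin l → C^∞⟮𝓡 n, M; ℝ⟯) (I : Finset (Fin l)),
      V.GRic D (s i) (∑ j ∈ I, mulSec (g j) (t j)) p = 0 := by
    intro i g I
    classical
    induction I using Finset.induction_on with
    | empty => rw [Finset.sum_empty, hz2 _ (hs i)]
    | insert j I hj ih =>
      rw [Finset.sum_insert hj, GRic_add_right h hs D (hs i) ((ht' j).mulSec _) (hp2 I g), ih,
        GRic_mulSec_right h hs D (hs i) (ht' j), h0, mul_zero, add_zero]
  have h2 : ∀ (f : Fin k → C^∞⟮𝓡 n, M; ℝ⟯) (g : Fin l → C^∞⟮𝓡 n, M; ℝ⟯) (I : Finset (Fin k)),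
      V.GRic D (∑ i ∈ I, mulSec (f i) (s i)) (∑ j, mulSec (g j) (t j)) p = 0 := by
    intro f g I
    classical
    induction I using Finset.induction_on with
    | empty => rw [Finset.sum_empty, hz1 _ (hp2 _ g)]
    | insert j I hj ih =>
      rw [Finset.sum_insert hj, GRic_add_left h hs D ((hs j).mulSec _) (hp1 I f) (hp2 _ g), ih,
        GRic_mulSec_left h hs D (hs j) (hp2 _ g), h1, mul_zero, add_zero]
  rw [GRic_congr h hs D ha hb (hp1 Finset.univ _) (hp2 Finset.univ _)
    (expand_near h (Eventually.of_forall ha)) (expand_near ht (Eventually.of_forall hb)), h2]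

end GenPseudometric

end Ricci

/-! ### Half-densities in a chart and the quotient `σ⁻¹ L L σ`. -/

section Chart

variable {n : ℕ} {M : Type*} [TopologicalSpace M] [ChartedSpace (EuclideanSpace ℝ (Fin n)) M]
  [IsManifold (𝓡 n) ∞ M]

theorem mdifferentiableAt_extChartAt_symm_of_mem {p : M} {y : EuclideanSpace ℝ (Fin n)}
    (hy : y ∈ (extChartAt (𝓡 n) p).target) :
    MDifferentiableAt (𝓡 n) (𝓡 n) (extChartAt (𝓡 n) p).symm y :=
  (((contMDiffOn_extChartAt_symm (I := 𝓡 n) (n := ∞) p) y hy).contMDiffAt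
    ((isOpen_extChartAt_target p).mem_nhds hy)).mdifferentiableAt (by simp)

theorem mdifferentiableAt_extChartAt_of_mem {p q : M} (hq : q ∈ (extChartAt (𝓡 n) p).source) :
    MDifferentiableAt (𝓡 n) (𝓡 n) (extChartAt (𝓡 n) p) q :=
  ((contMDiffOn_extChartAt (I := 𝓡 n) (n := ∞) (x := p) q
    (by rwa [extChartAt_source] at hq)).contMDiffAt
    ((by rw [← extChartAt_source (I := 𝓡 n)]; exact (isOpen_extChartAt_source p).mem_nhds hq))).mdifferentiableAt
      (by simp)

theorem deriveAlong_chart {p q : M} (hq : q ∈ (extChartAt (𝓡 n) p).source)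
    (X : ∀ q : M, TangentSpace (𝓡 n) q) {f : M → ℝ}
    (hf : MDifferentiableAt (𝓡 n) 𝓘(ℝ, ℝ) f q) :
    deriveAlong (X q) f = fderiv ℝ (f ∘ (extChartAt (𝓡 n) p).symm) (extChartAt (𝓡 n) p q)
      (chartVec p X (extChartAt (𝓡 n) p q)) := by
  have hy : extChartAt (𝓡 n) p q ∈ (extChartAt (𝓡 n) p).target := (extChartAt (𝓡 n) p).map_source hq
  have hinv : (extChartAt (𝓡 n) p).symm (extChartAt (𝓡 n) p q) = q := (extChartAt (𝓡 n) p).left_inv hq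
  have h1 : f =ᶠ[𝓝 q] (f ∘ (extChartAt (𝓡 n) p).symm) ∘ extChartAt (𝓡 n) p := by
    filter_upwards [(isOpen_extChartAt_source p).mem_nhds hq] with z hz
    simp only [Function.comp_apply, (extChartAt (𝓡 n) p).left_inv hz]
  have h2 : MDifferentiableAt (𝓡 n) 𝓘(ℝ, ℝ) (f ∘ (extChartAt (𝓡 n) p).symm) (extChartAt (𝓡 n) p q) := by
    refine MDifferentiableAt.comp _ ?_ (mdifferentiableAt_extChartAt_symm_of_mem hy)
    rw [hinv]; exact hf
  rw [deriveAlong_congr _ h1, deriveAlong_comp _ h2 (mdifferentiableAt_extChartAt_of_mem hq)]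
  unfold deriveAlong chartVec
  rw [mfderiv_eq_fderiv, hinv]
  rfl

theorem eventually_chart_symm {p : M} {P : M → Prop} (h : ∀ᶠ q in 𝓝 p, P q) :
    ∀ᶠ y in 𝓝 (extChartAt (𝓡 n) p p), P ((extChartAt (𝓡 n) p).symm y) ∧
      extChartAt (𝓡 n) p ((extChartAt (𝓡 n) p).symm y) = y := by
  have hc : ContinuousAt (extChartAt (𝓡 n) p).symm (extChartAt (𝓡 n) p p) :=
    continuousAt_extChartAt_symm p
  have h1 : Tendsto (extChartAt (𝓡 n) p).symm (𝓝 (extChartAt (𝓡 n) p p)) (𝓝 p) := by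
    have := hc.tendsto
    rwa [extChartAt_to_inv] at this
  filter_upwards [h1.eventually h, (isOpen_extChartAt_target (I := 𝓡 n) p).mem_nhds
    (mem_extChartAt_target p)] with y hy hy'
  exact ⟨hy, (extChartAt (𝓡 n) p).right_inv hy'⟩

/-- By the Leibniz rule `L_X σ² = 2 σ L_X σ`, so `σ⁻¹ L_X σ` is half of `div_{σ²} X`. -/
theorem lieCoord_half {X : EuclideanSpace ℝ (Fin n) → EuclideanSpace ℝ (Fin n)}
    {s : EuclideanSpace ℝ (Fin n) → ℝ} {y : EuclideanSpace ℝ (Fin n)}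
    (hs : DifferentiableAt ℝ s y) (h0 : s y ≠ 0) :
    lieCoord (1 / 2) X s y =
      1 / 2 * s y * ((s y ^ 2)⁻¹ * lieCoord 1 X (fun z => s z ^ 2) y) := by
  unfold lieCoord
  rw [fderiv_fun_pow 2 hs]
  simp only [Nat.add_one_sub_one, pow_one, smul_apply, smul_eq_mul, nsmul_eq_mul]
  field_simp
  simp only [Nat.cast_ofNat]

end Chart

section Laplacian

variable {n : ℕ} {M : Type*} [TopologicalSpace M] [ChartedSpace (EuclideanSpace ℝ (Fin n)) M]
  [IsManifold (𝓡 n) ∞ M] {F : Type*} [NormedAddCommGroup F] [NormedSpace ℝ F]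
  {E : M → Type*} [TopologicalSpace (TotalSpace F E)] [∀ x, TopologicalSpace (E x)]
  [∀ x, AddCommGroup (E x)] [∀ x, Module ℝ (E x)] [FiberBundle F E] [VectorBundle ℝ F E]

/-- Since `L_u σ = (d / 2) σ` near `p`, a second Lie derivative differentiates `d / 2` and then
multiplies it by `d' / 2`. Only `d` has to represent the divergence in a neighbourhood; `d'` is
needed at the point alone. -/
theorem lieCoord_lieCoord (C : CourantAlgebroid n F E) {p : M} {σ : HalfDensity n M}
    (hσ : σ.RegularNear p) {u v : Sec n F E} {d d' : C^∞⟮𝓡 n, M; ℝ⟯}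
    (hd : ∀ᶠ q in 𝓝 p, σ.divSq p (fun z => C.anchor z (u z)) (extChartAt (𝓡 n) p q) = d q)
    (hd' : σ.divSq p (fun z => C.anchor z (v z)) (extChartAt (𝓡 n) p p) = d' p) :
    (σ.coeff p (extChartAt (𝓡 n) p p))⁻¹ *
      lieCoord (1 / 2) (chartVec p fun q => C.anchor q (v q))
        (lieCoord (1 / 2) (chartVec p fun q => C.anchor q (u q)) (σ.coeff p)) (extChartAt (𝓡 n) p p) =
      1 / 2 * C.act v d p + 1 / 4 * (d p * d' p) := by
  set y := extChartAt (𝓡 n) p p with hy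
  set s := σ.coeff p with hs
  let g : EuclideanSpace ℝ (Fin n) → ℝ := d ∘ (extChartAt (𝓡 n) p).symm
  have hgy : g y = d p := by simp only [g, y, Function.comp_apply, extChartAt_to_inv]
  have hL : lieCoord (1 / 2) (chartVec p fun q => C.anchor q (u q)) s =ᶠ[𝓝 y]
      fun z => 1 / 2 * (s z * g z) := by
    filter_upwards [hσ, eventually_chart_symm hd] with z hz hz'
    rw [lieCoord_half (hz.1.differentiableAt (by simp)) hz.2]
    have h1 := hz'.1
    rw [hz'.2] at h1
    unfold HalfDensity.divSq at h1
    rw [h1, mul_assoc]; rfl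
  obtain ⟨hsd, hs0⟩ := hσ.self_of_nhds
  have hsd' : DifferentiableAt ℝ s y := hsd.differentiableAt (by simp)
  have hgd : DifferentiableAt ℝ g y := by
    rw [← mdifferentiableAt_iff_differentiableAt]
    exact MDifferentiableAt.comp y (smooth_mdiff d _)
      (mdifferentiableAt_extChartAt_symm_of_mem (mem_extChartAt_target p))
  have h2 := lieCoord_half (X := chartVec p fun q => C.anchor q (v q)) hsd' hs0
  unfold HalfDensity.divSq at hd'
  rw [hd'] at h2
  have hact : C.act v d p = fderiv ℝ g y (chartVec p (fun q => C.anchor q (v q)) y) :=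
    deriveAlong_chart (mem_extChartAt_source p) (fun q => C.anchor q (v q)) (smooth_mdiff d p)
  unfold lieCoord at h2 ⊢
  change (s y)⁻¹ * (fderiv ℝ (lieCoord (1 / 2) (chartVec p fun q => C.anchor q (u q)) s) y _ +
    _ * lieCoord (1 / 2) (chartVec p fun q => C.anchor q (u q)) s y) = _
  rw [hL.fderiv_eq, hL.self_of_nhds, 
    fderiv_const_mul (show DifferentiableAt ℝ (fun z => s z * g z) y from hsd'.mul hgd),
    fderiv_fun_mul hsd' hgd]
  simp only [smul_apply, add_apply, smul_eq_mul]
  rw [← hact, hgy]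
  have hs0' : s y ≠ 0 := hs0
  field_simp
  linear_combination (8 * d p) * h2

end Laplacian

/-! ### Contractions with a dual frame rewritten in an orthonormal frame. -/

section Contraction

variable {W : Type*} [AddCommGroup W] [Module ℝ W]

/-- The change of frame has constant coefficients, so real bilinearity suffices. This matters
because `W` will be the space of sections and the forms in question contain brackets and
derivatives. -/
theorem sum_dual_frame {k : ℕ} (u : Fin k → W) (g P : Matrix (Fin k) (Fin k) ℝ) (η : Fin k → ℝ)
    (hg : g⁻¹ = P.transpose * Matrix.diagonal η * P) (b : W →ₗ[ℝ] W →ₗ[ℝ] ℝ) :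
    ∑ i, b (u i) (∑ j, g⁻¹ i j • u j) =
      ∑ c, η c * b (∑ i, P c i • u i) (∑ i, P c i • u i) := by
  have h1 : ∀ i j, g⁻¹ i j = ∑ c, η c * (P c i * P c j) := by
    intro i j
    rw [hg, Matrix.mul_apply]
    refine Finset.sum_congr rfl fun c _ => ?_
    rw [Matrix.mul_diagonal, Matrix.transpose_apply]; ring
  simp only [map_sum, map_smul, LinearMap.sum_apply, LinearMap.smul_apply, smul_eq_mul, h1]
  have e1 : ∀ i, ∑ j, (∑ c, η c * (P c i * P c j)) * b (u i) (u j) =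
      ∑ c, ∑ j, η c * (P c i * P c j) * b (u i) (u j) := by
    intro i
    rw [Finset.sum_comm]
    exact Finset.sum_congr rfl fun j _ => by rw [Finset.sum_mul]
  rw [Finset.sum_congr rfl fun i _ => e1 i, Finset.sum_comm]
  refine Finset.sum_congr rfl fun c _ => ?_
  rw [Finset.mul_sum, Finset.sum_comm]
  refine Finset.sum_congr rfl fun i _ => ?_
  rw [Finset.mul_sum, Finset.mul_sum]
  exact Finset.sum_congr rfl fun j _ => by ring

/-- Orthonormalization of a frame by a constant matrix. -/
theorem exists_orthonormalizing [FiniteDimensional ℝ W] (B : LinearMap.BilinForm ℝ W)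
    (hB : ∀ u v, B u v = B v u) (U : Submodule ℝ W)
    (hU : ∀ v ∈ U, (∀ w ∈ U, B v w = 0) → v = 0) {k : ℕ} (u : Fin k → W)
    (hli : LinearIndependent ℝ u) (hsp : Submodule.span ℝ (Set.range u) = U)
    (g : Matrix (Fin k) (Fin k) ℝ) (hg : ∀ i j, B (u i) (u j) = g i j) :
    ∃ (P : Matrix (Fin k) (Fin k) ℝ) (η : Fin k → ℝ), (∀ i, η i * η i = 1) ∧
      P * g * P.transpose = Matrix.diagonal η ∧ g⁻¹ = P.transpose * Matrix.diagonal η * P := by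
  obtain ⟨w, η, h1, h2, h3⟩ : ∃ (w : Fin k → W) (η : Fin k → ℝ),
      (∀ i, w i ∈ U) ∧ (∀ i, η i * η i = 1) ∧ ∀ i j, B (w i) (w j) = if i = j then η i else 0 := by
    have hk : finrank ℝ U = k := by rw [← hsp, finrank_span_eq_card hli, Fintype.card_fin]
    have := exists_orthonormal_family B hB U hU
    rwa [hk] at this
  have hc : ∀ i, ∃ c : Fin k → ℝ, ∑ j, c j • u j = w i := fun i =>
    (Submodule.mem_span_range_iff_exists_fun ℝ).1 (by rw [hsp]; exact h1 i)
  choose P hP using hc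
  have hD : (Matrix.of P) * g * (Matrix.of P).transpose = Matrix.diagonal η := by
    ext i j
    rw [Matrix.diagonal_apply, ← h3, ← hP, ← hP]
    simp only [Matrix.mul_apply, Matrix.transpose_apply, Matrix.of_apply, map_sum, map_smul,
      LinearMap.sum_apply, LinearMap.smul_apply, smul_eq_mul, hg, Finset.sum_mul, Finset.mul_sum]
    refine Finset.sum_congr rfl fun a _ => Finset.sum_congr rfl fun b _ => by ring
  refine ⟨Matrix.of P, η, h2, hD, ?_⟩
  refine Matrix.inv_eq_right_inv ?_
  have hDD : Matrix.diagonal η * Matrix.diagonal η = (1 : Matrix (Fin k) (Fin k) ℝ) := by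
    rw [Matrix.diagonal_mul_diagonal, ← Matrix.diagonal_one]
    exact congrArg _ (funext h2)
  have h4 : Matrix.of P * (g * (Matrix.of P).transpose * Matrix.diagonal η) = 1 := by
    rw [← mul_assoc, ← mul_assoc, hD, hDD]
  rw [← mul_assoc, ← mul_assoc]
  -- From `P g Pᵀ η = 1` the factor `P` can be moved to the other end, since a one-sided inverse of
  -- a square matrix is two-sided.
  exact mul_eq_one_comm.1 h4

end Contraction

section Cubic

variable {W : Type*} [AddCommGroup W] [Module ℝ W]

/-- The bilinear contraction is applied to one index at a time. The third index may run over a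
different frame, as needed for `c_{ab c̄}`. -/
theorem sum_dual_cubic {k l : ℕ} (u : Fin k → W) (g P : Matrix (Fin k) (Fin k) ℝ) (η : Fin k → ℝ)
    (hg : g⁻¹ = P.transpose * Matrix.diagonal η * P)
    (u' : Fin l → W) (g' P' : Matrix (Fin l) (Fin l) ℝ) (η' : Fin l → ℝ)
    (hg' : g'⁻¹ = P'.transpose * Matrix.diagonal η' * P') (T : W →ₗ[ℝ] W →ₗ[ℝ] W →ₗ[ℝ] ℝ) :
    ∑ a, ∑ b, ∑ d, T (u a) (u b) (u' d) *
        T (∑ j, g⁻¹ a j • u j) (∑ j, g⁻¹ b j • u j) (∑ j, g'⁻¹ d j • u' j) =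
      ∑ a, ∑ b, ∑ d, η a * η b * η' d *
        T (∑ i, P a i • u i) (∑ i, P b i • u i) (∑ i, P' d i • u' i) ^ 2 := by
  let up : Fin k → W := fun a => ∑ j, g⁻¹ a j • u j
  let ε : Fin k → W := fun a => ∑ j, P a j • u j
  let φ : Fin l → W := fun a => ∑ j, P' a j • u' j
  have hmul : ∀ (L L' : W →ₗ[ℝ] ℝ), ∑ i, L (u i) * L' (up i) = ∑ c, η c * (L (ε c) * L' (ε c)) :=
    fun L L' => sum_dual_frame u g P η hg ((LinearMap.mul ℝ ℝ).compl₁₂ L L')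
  have hmul' : ∀ (L L' : W →ₗ[ℝ] ℝ), ∑ i, L (u' i) * L' (∑ j, g'⁻¹ i j • u' j) =
      ∑ c, η' c * (L (φ c) * L' (φ c)) :=
    fun L L' => sum_dual_frame u' g' P' η' hg' ((LinearMap.mul ℝ ℝ).compl₁₂ L L')
  calc _ = ∑ a, ∑ b, ∑ d, η' d * (T (u a) (u b) (φ d) * T (up a) (up b) (φ d)) :=
        Finset.sum_congr rfl fun a _ => Finset.sum_congr rfl fun b _ => hmul' _ _
    _ = ∑ a, ∑ d, ∑ b, η b * (η' d * (T (u a) (ε b) (φ d) * T (up a) (ε b) (φ d))) := by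
        refine Finset.sum_congr rfl fun a _ => ?_
        rw [Finset.sum_comm]
        refine Finset.sum_congr rfl fun d _ => ?_
        rw [← Finset.mul_sum]
        have := hmul ((T (u a)).flip (φ d)) ((T (up a)).flip (φ d))
        simp only [LinearMap.flip_apply] at this
        rw [this, Finset.mul_sum]
        exact Finset.sum_congr rfl fun b _ => by ring
    _ = ∑ d, ∑ b, ∑ a, η a * (η b * (η' d * (T (ε a) (ε b) (φ d) * T (ε a) (ε b) (φ d)))) := by
        rw [Finset.sum_comm]
        refine Finset.sum_congr rfl fun d _ => ?_
        rw [Finset.sum_comm]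
        refine Finset.sum_congr rfl fun b _ => ?_
        have := hmul ((T.flip (ε b)).flip (φ d)) ((T.flip (ε b)).flip (φ d))
        simp only [LinearMap.flip_apply] at this
        rw [← Finset.mul_sum, ← Finset.mul_sum, this, Finset.mul_sum, Finset.mul_sum]
        exact Finset.sum_congr rfl fun b _ => by ring
    _ = _ := by
        rw [Finset.sum_comm]
        rw [Finset.sum_congr rfl fun b _ => Finset.sum_comm, Finset.sum_comm]
        refine Finset.sum_congr rfl fun a _ => Finset.sum_congr rfl fun b _ =>
          Finset.sum_congr rfl fun d _ => ?_
        simp only [ε, φ]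
        ring

end Cubic

/-! ### The half-density form of the scalar curvature equals the frame formula. -/

section ScalarRhs

variable {n : ℕ} {M : Type*} [TopologicalSpace M] [ChartedSpace (EuclideanSpace ℝ (Fin n)) M]
  [IsManifold (𝓡 n) ∞ M] {F : Type*} [NormedAddCommGroup F] [NormedSpace ℝ F]
  [FiniteDimensional ℝ F]
  {E : M → Type*} [TopologicalSpace (TotalSpace F E)] [∀ x, TopologicalSpace (E x)]
  [∀ x, AddCommGroup (E x)] [∀ x, Module ℝ (E x)] [FiberBundle F E] [VectorBundle ℝ F E]
  {C : CourantAlgebroid n F E}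

/-- A constant change of frame that orthonormalizes the Gram matrix. -/
theorem isONFrame_of_constant {W : ∀ x, Submodule ℝ (E x)} {p : M} {k : ℕ} {u : Fin k → Sec n F E}
    {g P : Matrix (Fin k) (Fin k) ℝ} {η : Fin k → ℝ} (hη : ∀ i, η i * η i = 1)
    (hP : P * g * P.transpose = Matrix.diagonal η)
    (hnd : ∀ x, ∀ v ∈ W x, (∀ w ∈ W x, C.pairing x v w = 0) → v = 0)
    (hu : ∀ᶠ x in 𝓝 p, LinearIndependent ℝ (fun i => u i x) ∧
      Submodule.span ℝ (Set.range fun i => u i x) = W x)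
    (hg : ∀ᶠ x in 𝓝 p, ∀ i j, C.pairing x (u i x) (u j x) = g i j) :
    IsONFrame C W p (fun c => ∑ i, P c i • u i) η := by
  have hval : ∀ c x, (∑ i, P c i • u i) x = ∑ i, P c i • u i x := fun c x => by
    rw [sec_sum_apply]; rfl
  have hp : ∀ᶠ x in 𝓝 p, ∀ i j, C.pairing x ((∑ a, P i a • u a) x) ((∑ a, P j a • u a) x) =
      if i = j then η i else 0 := by
    filter_upwards [hg] with x hx i j
    rw [← Matrix.diagonal_apply, ← hP, hval, hval]
    simp only [Matrix.mul_apply, Matrix.transpose_apply, map_sum, map_smul,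
      LinearMap.sum_apply, LinearMap.smul_apply, smul_eq_mul, hx, Finset.sum_mul, Finset.mul_sum]
    refine Finset.sum_congr rfl fun a _ => Finset.sum_congr rfl fun b _ => by ring
  have hm : ∀ᶠ x in 𝓝 p, ∀ i, (∑ a, P i a • u a) x ∈ W x := by
    filter_upwards [hu] with x hx i
    rw [hval, ← hx.2]
    exact Submodule.sum_mem _ fun j _ => Submodule.smul_mem _ _ (Submodule.subset_span ⟨j, rfl⟩)
  refine isONFrame_of_complete hη hp hm ?_
  filter_upwards [hp, hm, hu] with x h1 h2 h3 v hv hv0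
  have := VectorBundle.finiteDimensional ℝ F E x
  exact complete_of_finrank (C.pairing x) (C.pairing_symm x) (hnd x) hη h1 h2
    (by rw [← h3.2, finrank_span_eq_card h3.1, Fintype.card_fin]) hv hv0

theorem GenPseudometric.minus_nondeg (V : GenPseudometric C) (x : M) :
    ∀ v ∈ V.minus x, (∀ w ∈ V.minus x, C.pairing x v w = 0) → v = 0 := by
  intro v hv h
  refine C.eq_of_pairing fun z => ?_
  rw [map_zero, LinearMap.zero_apply]
  have hz : z = V.proj x z + (z - V.proj x z) := by abel
  rw [hz, map_add, h _ (V.sub_proj_mem x z), add_zero, C.pairing_symm]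
  exact hv _ (V.proj_mem x z)

/-- The trilinear map `⟨u, [v, w]⟩` at `p`. -/
def bracketForm (C : CourantAlgebroid n F E) (p : M) :
    Sec n F E →ₗ[ℝ] Sec n F E →ₗ[ℝ] Sec n F E →ₗ[ℝ] ℝ where
  toFun u := C.bracket.compr₂ (C.pairing p (u p) ∘ₗ
    (⟨⟨fun v : Sec n F E => v p, fun _ _ => rfl⟩, fun _ _ => rfl⟩ : Sec n F E →ₗ[ℝ] E p))
  map_add' u v := by
    ext a b
    change C.pairing p (u p + v p) _ = _
    rw [map_add]; rfl
  map_smul' c u := by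
    ext a b
    change C.pairing p (c • u p) _ = _
    rw [map_smul]; rfl

theorem bracketForm_apply (p : M) (u v w : Sec n F E) :
    bracketForm C p u v w = C.pairing p (u p) (C.bracket v w p) := rfl

theorem CourantAlgebroid.pair_add_right (C : CourantAlgebroid n F E) (e u v : Sec n F E) :
    C.pair e (u + v) = C.pair e u + C.pair e v := by
  ext x; exact map_add (C.pairing x (e x)) _ _

theorem CourantAlgebroid.pair_smul_right (C : CourantAlgebroid n F E) (c : ℝ) (e u : Sec n F E) :
    C.pair e (c • u) = c • C.pair e u := by
  ext x; exact map_smul (C.pairing x (e x)) _ _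

theorem CourantAlgebroid.act_sub (C : CourantAlgebroid n F E) (u : Sec n F E)
    (f g : C^∞⟮𝓡 n, M; ℝ⟯) : C.act u (f - g) = C.act u f - C.act u g := by
  have h := C.act_add u (f - g) g
  rw [sub_add_cancel] at h
  rw [h, add_sub_cancel_right]

theorem CourantAlgebroid.smul_act (C : CourantAlgebroid n F E) (c : ℝ) (u : Sec n F E)
    (f : C^∞⟮𝓡 n, M; ℝ⟯) : C.act (c • u) f = c • C.act u f := by
  ext x
  change deriveAlong (C.anchor x (c • u x)) f = _
  rw [map_smul, deriveAlong_smul_vec]; rfl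

variable [T2Space M] [ContMDiffVectorBundle ∞ F E (𝓡 n)]

/-- The expression for the generalized scalar curvature in terms of a half-density agrees with the
one in an orthonormal frame. -/
theorem scalar_rhs_eq {V : GenPseudometric C} {p : M} (B : AdaptedFrame V p)
    {P : Matrix (Fin B.k) (Fin B.k) ℝ} {η : Fin B.k → ℝ} (hη : ∀ i, η i * η i = 1)
    (hP : P * B.g * P.transpose = Matrix.diagonal η)
    (hP' : B.g⁻¹ = P.transpose * Matrix.diagonal η * P)
    {Q : Matrix (Fin B.l) (Fin B.l) ℝ} {θ : Fin B.l → ℝ} (hθ : ∀ i, θ i * θ i = 1)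
    (hQ : Q * B.h * Q.transpose = Matrix.diagonal θ)
    (hQ' : B.h⁻¹ = Q.transpose * Matrix.diagonal θ * Q)
    (D : Divergence C) {σ : HalfDensity n M} {e : Sec n F E} (hσ : σ.RegularNear p)
    (he : ∀ᶠ q in 𝓝 p, ∀ a : Sec n F E,
      D.toLin a q - σ.divSq p (fun z => C.anchor z (a z)) (extChartAt (𝓡 n) p q) =
        C.pairing q (e q) (a q)) :
    B.laplacianQuot σ + C.pairing p (V.plusSec e p) (V.plusSec e p)
      + 2 * σ.divSq p (fun z => C.anchor z (V.plusSec e z)) (extChartAt (𝓡 n) p p) =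
    scalarON D (fun c => ∑ i, P c i • B.e i) η p := by
  set ε : Fin B.k → Sec n F E := fun c => ∑ i, P c i • B.e i with hε
  set φ : Fin B.l → Sec n F E := fun c => ∑ i, Q c i • B.f i with hφ
  have hεON : IsONFrame C V.plus p ε η :=
    isONFrame_of_constant hη hP V.nondeg B.frame_e B.pairing_e
  have hφON : IsONFrame C V.minus p φ θ :=
    isONFrame_of_constant hθ hQ V.minus_nondeg B.frame_f B.pairing_f
  -- A globally smooth and linear stand-in for `div_{σ²}`, with which it agrees near `p`.
  let δ : Sec n F E → C^∞⟮𝓡 n, M; ℝ⟯ := fun u => D.toLin u - C.pair e u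
  have hδ : ∀ u : Sec n F E, ∀ᶠ q in 𝓝 p,
      σ.divSq p (fun z => C.anchor z (u z)) (extChartAt (𝓡 n) p q) = δ u q := by
    intro u
    filter_upwards [he] with q hq
    change _ = D.toLin u q - C.pairing q (e q) (u q)
    rw [← hq u]; ring
  have hδadd : ∀ u v, δ (u + v) = δ u + δ v := fun u v => by
    simp only [δ, map_add, C.pair_add_right]; abel
  have hδsmul : ∀ (c : ℝ) u, δ (c • u) = c • δ u := fun c u => by
    simp only [δ, map_smul, C.pair_smul_right, smul_sub]
  -- This is `σ⁻¹ L_v L_u σ` at `p`, as computed by `lieCoord_lieCoord`, packaged as a bilinear map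
  -- so that it can be contracted in the orthonormal frame.
  let b : Sec n F E →ₗ[ℝ] Sec n F E →ₗ[ℝ] ℝ := LinearMap.mk₂ ℝ
    (fun u v => 1 / 2 * C.act v (δ u) p + 1 / 4 * (δ u p * δ v p))
    (fun u u' v => by
      rw [hδadd, C.act_add]
      simp only [ContMDiffMap.coe_add, Pi.add_apply]; ring)
    (fun c u v => by
      rw [hδsmul, C.act_smul]
      simp only [ContMDiffMap.coe_smul, Pi.smul_apply, smul_eq_mul]; ring)
    (fun u v v' => by
      rw [hδadd, C.add_act]
      simp only [ContMDiffMap.coe_add, Pi.add_apply]; ring)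
    (fun c u v => by
      rw [hδsmul, C.smul_act]
      simp only [ContMDiffMap.coe_smul, Pi.smul_apply, smul_eq_mul]; ring)
  have hb : ∀ u v, b u v = 1 / 2 * C.act v (δ u) p + 1 / 4 * (δ u p * δ v p) := fun _ _ => rfl
  have hlap : B.laplacianQuot σ = 4 * ∑ c, η c * b (ε c) (ε c)
      - 1 / 6 * ∑ a, ∑ b, ∑ d, η a * η b * η d * bracketForm C p (ε a) (ε b) (ε d) ^ 2
      - 1 / 2 * ∑ a, ∑ b, ∑ d, η a * η b * θ d * bracketForm C p (ε a) (ε b) (φ d) ^ 2 := by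
    rw [← sum_dual_cubic B.e B.g P η hP' B.e B.g P η hP' (bracketForm C p),
      ← sum_dual_cubic B.e B.g P η hP' B.f B.h Q θ hQ' (bracketForm C p),
      ← sum_dual_frame B.e B.g P η hP' b]
    have hs : ∀ a, b (B.e a) (∑ j, B.g⁻¹ a j • B.e j) = (σ.coeff p (extChartAt (𝓡 n) p p))⁻¹ *
        lieCoord (1 / 2) (chartVec p fun q => C.anchor q (B.eUp a q))
          (lieCoord (1 / 2) (chartVec p fun q => C.anchor q (B.e a q)) (σ.coeff p))
          (extChartAt (𝓡 n) p p) := fun a =>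
      (lieCoord_lieCoord C hσ (hδ (B.e a)) (hδ (B.eUp a)).self_of_nhds).symm
    rw [Finset.sum_congr rfl fun a _ => hs a, ← Finset.mul_sum]
    rfl
  have hplus : ∀ᶠ x in 𝓝 p, V.plusSec e x = (∑ c, mulSec (η c • C.pair e (ε c)) (ε c)) x := by
    filter_upwards [GenPseudometric.expand_near hεON
      (Eventually.of_forall (V.isPlus_plusSec e)), hεON.mem] with x hx hm
    rw [hx, sec_sum_apply, sec_sum_apply]
    refine Finset.sum_congr rfl fun c _ => ?_
    change (η c * C.pairing x (ε c x) (V.proj x (e x))) • ε c x =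
      (η c * C.pairing x (e x) (ε c x)) • ε c x
    rw [V.pairing_proj (hm c), C.pairing_symm]
  have hDplus : D.toLin (V.plusSec e) p = ∑ c, η c * (C.pair e (ε c) p * D.toLin (ε c) p
      + C.act (ε c) (C.pair e (ε c)) p) := by
    rw [(D.congr hplus).self_of_nhds]
    simp only [map_sum, D.map_mulSec, C.act_smul, smooth_sum_apply]
    refine Finset.sum_congr rfl fun c _ => ?_
    change η c * C.pair e (ε c) p * _ + η c * _ = _
    ring
  have hee : C.pairing p (V.plusSec e p) (V.plusSec e p) = ∑ c, η c * (C.pair e (ε c) p) ^ 2 := by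
    have h1 : C.pairing p (V.plusSec e p) (V.plusSec e p) = C.pairing p (V.plusSec e p) (e p) :=
      V.pairing_proj (V.isPlus_plusSec e p) (e p)
    rw [h1, C.pairing_symm, hplus.self_of_nhds]
    simp only [sec_sum_apply, map_sum, mulSec_apply, map_smul]
    refine Finset.sum_congr rfl fun c _ => ?_
    change η c * C.pair e (ε c) p * C.pair e (ε c) p = _
    ring
  have hdiv : σ.divSq p (fun z => C.anchor z (V.plusSec e z)) (extChartAt (𝓡 n) p p) =
      D.toLin (V.plusSec e) p - C.pairing p (V.plusSec e p) (V.plusSec e p) := by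
    rw [(hδ (V.plusSec e)).self_of_nhds]
    change D.toLin (V.plusSec e) p - C.pairing p (e p) (V.plusSec e p) = _
    rw [C.pairing_symm p (e p), ← V.pairing_proj (V.isPlus_plusSec e p) (e p)]
    rfl
  have hbs : ∀ c, b (ε c) (ε c) = 1 / 2 * (C.act (ε c) (D.toLin (ε c)) p
      - C.act (ε c) (C.pair e (ε c)) p) + 1 / 4 * ((D.toLin (ε c) p - C.pair e (ε c) p) *
        (D.toLin (ε c) p - C.pair e (ε c) p)) := by
    intro c
    rw [hb]
    simp only [δ, C.act_sub]
    rfl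
  have hT1 : ∑ a, ∑ b, ∑ d, η a * η b * η d * bracketForm C p (ε a) (ε b) (ε d) ^ 2 =
      ∑ a, ∑ b, ∑ d, η a * η b * η d * C.pairing p (C.bracket (ε a) (ε b) p) (ε d p) ^ 2 := by
    rw [← sum_cyclic fun a b d => η a * η b * η d * C.pairing p (C.bracket (ε a) (ε b) p) (ε d p) ^ 2]
    refine Finset.sum_congr rfl fun a _ => Finset.sum_congr rfl fun b _ =>
      Finset.sum_congr rfl fun d _ => ?_
    rw [bracketForm_apply, C.pairing_symm]
    ring
  -- Invariance of the pairing turns `c_{ab c̄}` into a component of a bracket of two `V₊` sections,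
  -- and completeness sums its squares to the norm minus the `V₊` part. The cubic coefficient thus
  -- becomes `-1/6 + 1/2 = 1/3`.
  have hT2 : ∑ a, ∑ b, ∑ d, η a * η b * θ d * bracketForm C p (ε a) (ε b) (φ d) ^ 2 =
      ∑ a, ∑ b, η a * η b * C.pairing p (C.bracket (ε a) (ε b) p) (C.bracket (ε a) (ε b) p)
      - ∑ a, ∑ b, ∑ d, η a * η b * η d * C.pairing p (C.bracket (ε a) (ε b) p) (ε d p) ^ 2 := by
    have h1 : ∀ a b d, bracketForm C p (ε a) (ε b) (φ d) =
        - C.pairing p (C.bracket (ε b) (ε a) p) (φ d p) := by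
      intro a b d
      have h2 := C.act_pair (ε b) (ε a) (φ d) p
      rw [C.act_eq_zero_of_const (c := 0) (by
        filter_upwards [hεON.mem, hφON.mem] with x h1 h2
        exact h2 d _ (h1 a))] at h2
      rw [bracketForm_apply]
      linarith
    have h2 : ∀ v : E p, C.pairing p v v = ∑ d, η d * C.pairing p v (ε d p) ^ 2 +
        ∑ d, θ d * C.pairing p v (φ d p) ^ 2 := by
      intro v
      have e1 := hεON.expand.self_of_nhds _ (V.proj_mem p v)
      have e2 := hφON.expand.self_of_nhds _ (V.sub_proj_mem p v)
      have e3 : ∀ d, C.pairing p (ε d p) (V.proj p v) = C.pairing p v (ε d p) := fun d => by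
        rw [V.pairing_proj (hεON.mem.self_of_nhds d), C.pairing_symm]
      have e4 : ∀ d, C.pairing p (φ d p) (v - V.proj p v) = C.pairing p v (φ d p) := fun d => by
        have : C.pairing p (V.proj p v) (φ d p) = 0 := hφON.mem.self_of_nhds d _ (V.proj_mem p v)
        rw [C.pairing_symm, map_sub, LinearMap.sub_apply, this, sub_zero]
      have e5 : v = V.proj p v + (v - V.proj p v) := by abel
      have e6 : C.pairing p v v = C.pairing p v (V.proj p v) + C.pairing p v (v - V.proj p v) := by
        rw [← map_add, ← e5]
      rw [e6]
      nth_rewrite 1 [e1]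
      nth_rewrite 1 [e2]
      simp only [map_sum, map_smul, smul_eq_mul, e3, e4]
      congr 1 <;> exact Finset.sum_congr rfl fun d _ => by ring
    rw [← Finset.sum_sub_distrib]
    rw [Finset.sum_comm]
    refine Finset.sum_congr rfl fun a _ => ?_
    rw [← Finset.sum_sub_distrib]
    refine Finset.sum_congr rfl fun b _ => ?_
    rw [h2 (C.bracket (ε a) (ε b) p), mul_add, Finset.mul_sum, Finset.mul_sum]
    have e7 : ∑ i, η a * η b * (η i * C.pairing p (C.bracket (ε a) (ε b) p) (ε i p) ^ 2) =
        ∑ d, η a * η b * η d * C.pairing p (C.bracket (ε a) (ε b) p) (ε d p) ^ 2 :=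
      Finset.sum_congr rfl fun d _ => by ring
    rw [e7, add_sub_cancel_left]
    refine Finset.sum_congr rfl fun d _ => ?_
    rw [h1]; ring
  rw [hdiv, hlap, hT1, hT2, hDplus, hee]
  simp only [hbs]
  unfold scalarON
  -- With `x = ⟨e, ε_c⟩`, all terms containing `x`, its derivative and its square cancel, so the
  -- auxiliary section `e` disappears.
  have hfin : 4 * ∑ c, η c * (1 / 2 * (C.act (ε c) (D.toLin (ε c)) p
      - C.act (ε c) (C.pair e (ε c)) p) + 1 / 4 * ((D.toLin (ε c) p - C.pair e (ε c) p) *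
        (D.toLin (ε c) p - C.pair e (ε c) p))) + ∑ c, η c * (C.pair e (ε c) p) ^ 2 +
      2 * (∑ c, η c * (C.pair e (ε c) p * D.toLin (ε c) p + C.act (ε c) (C.pair e (ε c)) p) -
        ∑ c, η c * (C.pair e (ε c) p) ^ 2) =
      ∑ a, η a * (2 * C.act (ε a) (D.toLin (ε a)) p + D.toLin (ε a) p * D.toLin (ε a) p) := by
    rw [Finset.mul_sum, ← Finset.sum_add_distrib, ← Finset.sum_sub_distrib, Finset.mul_sum,
      ← Finset.sum_add_distrib]
    exact Finset.sum_congr rfl fun c _ => by ring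
  rw [← hfin]
  ring

end ScalarRhs

/-! ### The density of a chart and its divergence. -/

section ChartDensity

variable {n : ℕ} {M : Type*} [TopologicalSpace M] [ChartedSpace (EuclideanSpace ℝ (Fin n)) M]
  [IsManifold (𝓡 n) ∞ M]

theorem mfderiv_extChartAt_symm_apply {p : M} {y : EuclideanSpace ℝ (Fin n)}
    (hy : y ∈ (extChartAt (𝓡 n) p).target) (v : EuclideanSpace ℝ (Fin n)) :
    (mfderiv (𝓡 n) (𝓡 n) (extChartAt (𝓡 n) p) ((extChartAt (𝓡 n) p).symm y)
      (mfderiv (𝓡 n) (𝓡 n) (extChartAt (𝓡 n) p).symm y v) : EuclideanSpace ℝ (Fin n)) = v := by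
  have h1 := mfderiv_comp (I := 𝓡 n) (I' := 𝓡 n) (I'' := 𝓡 n) y
    (mdifferentiableAt_extChartAt_of_mem ((extChartAt (𝓡 n) p).map_target hy))
    (mdifferentiableAt_extChartAt_symm_of_mem hy)
  have h2 : (extChartAt (𝓡 n) p ∘ (extChartAt (𝓡 n) p).symm) =ᶠ[𝓝 y] id := by
    filter_upwards [(isOpen_extChartAt_target (I := 𝓡 n) p).mem_nhds hy] with z hz
    exact (extChartAt (𝓡 n) p).right_inv hz
  have h3 := h2.mfderiv_eq (I := 𝓡 n) (I' := 𝓡 n)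
  rw [mfderiv_id] at h3
  exact (congrArg (fun L : EuclideanSpace ℝ (Fin n) →L[ℝ] EuclideanSpace ℝ (Fin n) => L v)
    (h1.symm.trans h3))

/-- The half-density `|dy|^{1/2}` of the chart at `p`. -/
def chartDensity (p : M) : HalfDensity n M where
  val q v := √|(EuclideanSpace.basisFun (Fin n) ℝ).toBasis.det fun i =>
    (mfderiv (𝓡 n) (𝓡 n) (extChartAt (𝓡 n) p) q (v i) : EuclideanSpace ℝ (Fin n))|
  map_linear q A v := by
    let b := (EuclideanSpace.basisFun (Fin n) ℝ).toBasis
    let L : EuclideanSpace ℝ (Fin n) →ₗ[ℝ] EuclideanSpace ℝ (Fin n) :=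
      (mfderiv (𝓡 n) (𝓡 n) (extChartAt (𝓡 n) p) q).toLinearMap
    let A' : EuclideanSpace ℝ (Fin n) →ₗ[ℝ] EuclideanSpace ℝ (Fin n) := A
    let v' : Fin n → EuclideanSpace ℝ (Fin n) := v
    have h1 : b.det (L ∘ (A' ∘ v')) = LinearMap.det A' * b.det (L ∘ v') := by
      rw [b.det_comp, b.det_comp, b.det_comp]; ring
    have h2 : √|b.det (L ∘ (A' ∘ v'))| = √|LinearMap.det A'| * √|b.det (L ∘ v')| := by
      rw [h1, abs_mul, Real.sqrt_mul (abs_nonneg _)]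
    exact h2

theorem chartDensity_coeff (p : M) {y : EuclideanSpace ℝ (Fin n)}
    (hy : y ∈ (extChartAt (𝓡 n) p).target) : (chartDensity (n := n) p).coeff p y = 1 := by
  have h : (chartDensity (n := n) p).coeff p y =
      √|(EuclideanSpace.basisFun (Fin n) ℝ).toBasis.det fun i =>
        (mfderiv (𝓡 n) (𝓡 n) (extChartAt (𝓡 n) p) ((extChartAt (𝓡 n) p).symm y)
          (mfderiv (𝓡 n) (𝓡 n) (extChartAt (𝓡 n) p).symm y
            (EuclideanSpace.basisFun (Fin n) ℝ i)) : EuclideanSpace ℝ (Fin n))| := rfl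
  rw [h]
  have h2 : (fun i => (mfderiv (𝓡 n) (𝓡 n) (extChartAt (𝓡 n) p) ((extChartAt (𝓡 n) p).symm y)
          (mfderiv (𝓡 n) (𝓡 n) (extChartAt (𝓡 n) p).symm y
            (EuclideanSpace.basisFun (Fin n) ℝ i)) : EuclideanSpace ℝ (Fin n))) =
      (EuclideanSpace.basisFun (Fin n) ℝ).toBasis := by
    funext i
    rw [mfderiv_extChartAt_symm_apply hy]
    exact (congrFun (EuclideanSpace.basisFun (Fin n) ℝ).coe_toBasis i).symm
  rw [h2, Basis.det_self]
  simp

theorem chartDensity_eventually (p : M) {y : EuclideanSpace ℝ (Fin n)}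
    (hy : y ∈ (extChartAt (𝓡 n) p).target) : (chartDensity (n := n) p).coeff p =ᶠ[𝓝 y] fun _ => 1 := by
  filter_upwards [(isOpen_extChartAt_target (I := 𝓡 n) p).mem_nhds hy] with z hz
  exact chartDensity_coeff p hz

theorem chartDensity_regularNear (p : M) : (chartDensity (n := n) p).RegularNear p := by
  filter_upwards [(isOpen_extChartAt_target (I := 𝓡 n) p).mem_nhds (mem_extChartAt_target p)] with y hy
  refine ⟨contDiffAt_const.congr_of_eventuallyEq (chartDensity_eventually p hy), ?_⟩
  rw [chartDensity_coeff p hy]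
  exact one_ne_zero

/-- The coefficient of the density is constantly `1`, which leaves the coordinate divergence `∂ᵢ
Xⁱ`. -/
theorem chartDensity_divSq (p : M) (X : ∀ q : M, TangentSpace (𝓡 n) q) {y : EuclideanSpace ℝ (Fin n)}
    (hy : y ∈ (extChartAt (𝓡 n) p).target) : (chartDensity (n := n) p).divSq p X y =
      LinearMap.trace ℝ _ (fderiv ℝ (chartVec p X) y).toLinearMap := by
  unfold HalfDensity.divSq lieCoord
  have h : (fun z => (chartDensity (n := n) p).coeff p z ^ 2) =ᶠ[𝓝 y] fun _ => (1 : ℝ) := by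
    filter_upwards [chartDensity_eventually p hy] with z hz
    rw [hz]; norm_num
  rw [h.fderiv_eq]
  have h1 : (chartDensity (n := n) p).coeff p y ^ 2 = 1 := h.self_of_nhds
  simp [h1, chartDensity_coeff p hy]

/-- The coordinate expression is the tangent bundle trivialization at `p` read through the inverse
chart, and smoothness of a section is smoothness in a trivialization. -/
theorem chartVec_contDiffOn (p : M) (X : ∀ q : M, TangentSpace (𝓡 n) q)
    (hX : ContMDiff (𝓡 n) (𝓡 n).tangent ∞ (fun x => (⟨x, X x⟩ : TangentBundle (𝓡 n) M))) :
    ContDiffOn ℝ ∞ (chartVec p X) (extChartAt (𝓡 n) p).target := by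
  let e := trivializationAt (EuclideanSpace ℝ (Fin n)) (TangentSpace (𝓡 n) : M → Type _) p
  have h1 := (e.contMDiffOn_section_baseSet_iff (IB := 𝓡 n) (n := ∞) (s := X)).1 hX.contMDiffOn
  have hb : e.baseSet = (extChartAt (𝓡 n) p).source := by
    rw [extChartAt_source]; rfl
  have h2 : ContMDiffOn (𝓡 n) 𝓘(ℝ, EuclideanSpace ℝ (Fin n)) ∞
      ((fun x => (e ⟨x, X x⟩).2) ∘ (extChartAt (𝓡 n) p).symm) (extChartAt (𝓡 n) p).target := by
    refine h1.comp (contMDiffOn_extChartAt_symm p) ?_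
    intro y hy
    rw [hb]
    exact (extChartAt (𝓡 n) p).map_target hy
  rw [contMDiffOn_iff_contDiffOn] at h2
  refine h2.congr fun y hy => ?_
  have hs : (extChartAt (𝓡 n) p).symm y ∈ (extChartAt (𝓡 n) p).source :=
    (extChartAt (𝓡 n) p).map_target hy
  have h3 := TangentBundle.continuousLinearMapAt_trivializationAt (I := 𝓡 n) (x₀ := p)
    (x := (extChartAt (𝓡 n) p).symm y) (by rwa [extChartAt_source] at hs)
  unfold chartVec
  rw [← h3]
  exact e.continuousLinearMapAt_apply_of_mem (R := ℝ) (hb ▸ hs) _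

theorem contDiffOn_trace_fderiv {X : EuclideanSpace ℝ (Fin n) → EuclideanSpace ℝ (Fin n)}
    {U : Set (EuclideanSpace ℝ (Fin n))} (hU : IsOpen U) (hX : ContDiffOn ℝ ∞ X U) :
    ContDiffOn ℝ ∞ (fun y => LinearMap.trace ℝ _ (fderiv ℝ X y).toLinearMap) U := by
  let tr : (EuclideanSpace ℝ (Fin n) →L[ℝ] EuclideanSpace ℝ (Fin n)) →L[ℝ] ℝ :=
    LinearMap.toContinuousLinearMap
      (LinearMap.trace ℝ (EuclideanSpace ℝ (Fin n)) ∘ₗ ContinuousLinearMap.coeLM ℝ)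
  exact tr.contDiff.comp_contDiffOn (hX.fderiv_of_isOpen hU (by simp))

end ChartDensity

section ChartDiv

variable {n : ℕ} {M : Type*} [TopologicalSpace M] [ChartedSpace (EuclideanSpace ℝ (Fin n)) M]
  [IsManifold (𝓡 n) ∞ M] {F : Type*} [NormedAddCommGroup F] [NormedSpace ℝ F]
  {E : M → Type*} [TopologicalSpace (TotalSpace F E)] [∀ x, TopologicalSpace (E x)]
  [∀ x, AddCommGroup (E x)] [∀ x, Module ℝ (E x)] [FiberBundle F E] [VectorBundle ℝ F E]
  (C : CourantAlgebroid n F E)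

/-- The divergence of the density `|dy|` of the chart at `p`. -/
def chartDiv (p : M) (u : Sec n F E) (q : M) : ℝ :=
  LinearMap.trace ℝ _ (fderiv ℝ (chartVec p fun z => C.anchor z (u z))
    (extChartAt (𝓡 n) p q)).toLinearMap

theorem chartDiv_smooth (p : M) (u : Sec n F E) {q : M} (hq : q ∈ (extChartAt (𝓡 n) p).source) :
    ContMDiffAt (𝓡 n) 𝓘(ℝ, ℝ) ∞ (chartDiv C p u) q := by
  have h1 := contDiffOn_trace_fderiv (isOpen_extChartAt_target (I := 𝓡 n) p)
    (chartVec_contDiffOn p (fun z => C.anchor z (u z)) (C.anchor_smooth u))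
  have hy := (extChartAt (𝓡 n) p).map_source hq
  have h2 := h1.contDiffAt ((isOpen_extChartAt_target (I := 𝓡 n) p).mem_nhds hy)
  have h3 : ContMDiffAt (𝓡 n) (𝓡 n) ∞ (extChartAt (𝓡 n) p) q :=
    contMDiffAt_extChartAt' (by rwa [extChartAt_source] at hq)
  exact h2.contMDiffAt.comp q h3

theorem chartDiv_congr (p : M) {u v : Sec n F E} {q : M} (hq : q ∈ (extChartAt (𝓡 n) p).source)
    (h : ∀ᶠ x in 𝓝 q, u x = v x) : chartDiv C p u q = chartDiv C p v q := by
  unfold chartDiv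
  have hy := (extChartAt (𝓡 n) p).map_source hq
  have h1 : Tendsto (extChartAt (𝓡 n) p).symm (𝓝 (extChartAt (𝓡 n) p q)) (𝓝 q) := by
    have := (mdifferentiableAt_extChartAt_symm_of_mem hy).continuousAt.tendsto
    rwa [(extChartAt (𝓡 n) p).left_inv hq] at this
  have h2 : (chartVec p fun z => C.anchor z (u z)) =ᶠ[𝓝 (extChartAt (𝓡 n) p q)]
      chartVec p fun z => C.anchor z (v z) := by
    filter_upwards [h1.eventually h] with y hy
    exact congrArg (fun w => (mfderiv (𝓡 n) (𝓡 n) (extChartAt (𝓡 n) p)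
      ((extChartAt (𝓡 n) p).symm y) (C.anchor _ w) : EuclideanSpace ℝ (Fin n))) hy
  rw [h2.fderiv_eq]

theorem chartDiv_sum_mulSec (p : M) {k : ℕ} (f : Fin k → C^∞⟮𝓡 n, M; ℝ⟯) (s : Fin k → Sec n F E)
    {q : M} (hq : q ∈ (extChartAt (𝓡 n) p).source) :
    chartDiv C p (∑ i, mulSec (f i) (s i)) q =
      ∑ i, (f i q * chartDiv C p (s i) q + C.act (s i) (f i) q) := by
  have hy := (extChartAt (𝓡 n) p).map_source hq
  have hinv : (extChartAt (𝓡 n) p).symm (extChartAt (𝓡 n) p q) = q := (extChartAt (𝓡 n) p).left_inv hq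
  let g : Fin k → EuclideanSpace ℝ (Fin n) → ℝ := fun i => f i ∘ (extChartAt (𝓡 n) p).symm
  let X : Fin k → EuclideanSpace ℝ (Fin n) → EuclideanSpace ℝ (Fin n) := fun i =>
    chartVec p fun z => C.anchor z (s i z)
  have hX : ∀ i, DifferentiableAt ℝ (X i) (extChartAt (𝓡 n) p q) := fun i =>
    ((chartVec_contDiffOn p (fun z => C.anchor z (s i z)) (C.anchor_smooth (s i))).contDiffAt
      ((isOpen_extChartAt_target (I := 𝓡 n) p).mem_nhds hy)).differentiableAt (by simp)
  have hg : ∀ i, DifferentiableAt ℝ (g i) (extChartAt (𝓡 n) p q) := fun i => by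
    rw [← mdifferentiableAt_iff_differentiableAt]
    exact MDifferentiableAt.comp _ (smooth_mdiff (f i) _)
      (mdifferentiableAt_extChartAt_symm_of_mem hy)
  have h1 : (chartVec p fun z => C.anchor z ((∑ i, mulSec (f i) (s i)) z)) =
      fun y => ∑ i, g i y • X i y := by
    funext y
    unfold chartVec
    simp only [sec_sum_apply, mulSec_apply, map_sum, map_smul]
    rfl
  unfold chartDiv
  rw [h1, fderiv_fun_sum (A := fun i y => g i y • X i y)
    fun i _ => (hg i).smul (hX i)]
  have h2 : ∀ i, fderiv ℝ (fun y => g i y • X i y) (extChartAt (𝓡 n) p q) =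
      g i (extChartAt (𝓡 n) p q) • fderiv ℝ (X i) (extChartAt (𝓡 n) p q) +
      (fderiv ℝ (g i) (extChartAt (𝓡 n) p q)).smulRight (X i (extChartAt (𝓡 n) p q)) :=
    fun i => fderiv_fun_smul (hg i) (hX i)
  have h3 : (∑ i, fderiv ℝ (fun y => g i y • X i y) (extChartAt (𝓡 n) p q)).toLinearMap =
      ∑ i, (g i (extChartAt (𝓡 n) p q) • (fderiv ℝ (X i) (extChartAt (𝓡 n) p q)).toLinearMap +
      (fderiv ℝ (g i) (extChartAt (𝓡 n) p q)).toLinearMap.smulRight (X i (extChartAt (𝓡 n) p q))) := by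
    simp only [h2]
    ext v
    simp
  rw [h3, map_sum]
  refine Finset.sum_congr rfl fun i _ => ?_
  rw [map_add, map_smul, LinearMap.trace_smulRight, smul_eq_mul]
  congr 1
  · simp only [g, Function.comp_apply, hinv]; rfl
  · exact (deriveAlong_chart hq (fun z => C.anchor z (s i z)) (smooth_mdiff (f i) q)).symm

variable {C}

theorem isSubbundle_top [T2Space M] [FiniteDimensional ℝ F] [ContMDiffVectorBundle ∞ F E (𝓡 n)] :
    IsSubbundle n F (fun x => (⊤ : Submodule ℝ (E x))) := fun p =>
  ⟨_, exists_local_frame F E p⟩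

theorem exists_ONFrame_top [T2Space M] [FiniteDimensional ℝ F] [ContMDiffVectorBundle ∞ F E (𝓡 n)]
    (C : CourantAlgebroid n F E) (p : M) :
    ∃ (k : ℕ) (s : Fin k → Sec n F E) (η : Fin k → ℝ), IsONFrame C (fun _ => ⊤) p s η :=
  exists_ONFrame' C isSubbundle_top (fun x v _ h => C.eq_of_pairing fun z => by
    rw [h z trivial, map_zero, LinearMap.zero_apply]) p

/-- Near `p` every divergence differs from the one of the chart density by `⟨e, · ⟩`. -/
theorem exists_div_sub_chartDiv [T2Space M] [FiniteDimensional ℝ F]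
    [ContMDiffVectorBundle ∞ F E (𝓡 n)] (D : Divergence C) (p : M) :
    ∃ e : Sec n F E, ∀ᶠ q in 𝓝 p, ∀ a : Sec n F E,
      D.toLin a q - (chartDensity (n := n) p).divSq p (fun z => C.anchor z (a z)) (extChartAt (𝓡 n) p q)
        = C.pairing q (e q) (a q) := by
  obtain ⟨k, s, η, hs⟩ := exists_ONFrame_top C p
  have hsrc : ∀ᶠ q in 𝓝 p, q ∈ (extChartAt (𝓡 n) p).source :=
    (isOpen_extChartAt_source p).mem_nhds (mem_extChartAt_source p)
  have hψ : ∀ i, ∃ ψ : C^∞⟮𝓡 n, M; ℝ⟯, ∀ᶠ q in 𝓝 p, ψ q = D.toLin (s i) q - chartDiv C p (s i) q :=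
    fun i => exists_smooth_extend (by
      filter_upwards [hsrc] with q hq
      exact (D.toLin (s i)).contMDiff.contMDiffAt.sub (chartDiv_smooth C p (s i) hq))
  choose ψ hψ using hψ
  -- Two divergences satisfy the same Leibniz rule, so their difference is linear over functions. It
  -- is represented by the section whose pairings with the frame are its values `ψ i` on the frame.
  refine ⟨∑ i, mulSec (η i • ψ i) (s i), ?_⟩
  filter_upwards [hsrc, eventually_all.2 hψ, hs.eventually] with q hq h1 h2 a
  rw [chartDensity_divSq p _ ((extChartAt (𝓡 n) p).map_source hq)]
  change D.toLin a q - chartDiv C p a q = _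
  have h3 := GenPseudometric.expand_near h2 (v := a) (Eventually.of_forall fun _ => trivial)
  rw [(D.congr h3).self_of_nhds, chartDiv_congr C p hq h3, chartDiv_sum_mulSec C p _ _ hq]
  simp only [map_sum, D.map_mulSec, smooth_sum_apply, sec_sum_apply, LinearMap.sum_apply,
    ← Finset.sum_sub_distrib, mulSec_apply, map_smul, LinearMap.smul_apply, smul_eq_mul]
  refine Finset.sum_congr rfl fun i _ => ?_
  change (η i * C.pairing q (s i q) (a q)) * D.toLin (s i) q + C.act (s i) (η i • C.pair (s i) a) q -
    ((η i * C.pairing q (s i q) (a q)) * chartDiv C p (s i) q + _) = (η i * ψ i q) * _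
  rw [h1]
  ring

end ChartDiv

/-! ### The scalar equation as vanishing of `scalarON` on orthonormal frames. -/

section ScalarZero

variable {n : ℕ} {M : Type*} [TopologicalSpace M] [ChartedSpace (EuclideanSpace ℝ (Fin n)) M]
  [IsManifold (𝓡 n) ∞ M] {F : Type*} [NormedAddCommGroup F] [NormedSpace ℝ F]
  [FiniteDimensional ℝ F]
  {E : M → Type*} [TopologicalSpace (TotalSpace F E)] [∀ x, TopologicalSpace (E x)]
  [∀ x, AddCommGroup (E x)] [∀ x, Module ℝ (E x)] [FiberBundle F E] [VectorBundle ℝ F E]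
  [T2Space M] [ContMDiffVectorBundle ∞ F E (𝓡 n)]
  {C : CourantAlgebroid n F E}

theorem finrank_fibre (p : M) : finrank ℝ (E p) = finrank ℝ F :=
  ((trivializationAt F E p).linearEquivAt ℝ p (mem_baseSet_trivializationAt F E p)).finrank_eq

theorem IsONFrame.finrank_eq {W : ∀ x, Submodule ℝ (E x)} {p : M} {k : ℕ} {s : Fin k → Sec n F E}
    {η : Fin k → ℝ} (h : IsONFrame C W p s η) : finrank ℝ (W p) = k := by
  have h1 := finrank_span_eq_card h.linearIndependent.self_of_nhds
  rwa [h.span.self_of_nhds, Fintype.card_fin] at h1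

namespace GenPseudometric

theorem exists_ONFrame_plus (V : GenPseudometric C) (p : M) :
    ∃ (k : ℕ) (s : Fin k → Sec n F E) (η : Fin k → ℝ), IsONFrame C V.plus p s η ∧
      ∀ i, V.IsPlus (s i) := by
  obtain ⟨k, s, η, hs⟩ := exists_ONFrame' C V.subbundle V.nondeg p
  refine ⟨k, fun i => V.plusSec (s i), η, hs.congr ?_, fun i => V.isPlus_plusSec _⟩
  filter_upwards [hs.mem] with x hx i
  exact V.proj_of_mem (hx i)

/-- Since `V₋` is given only as a fibrewise complement, its smooth sections are obtained by
projection. An orthonormal basis at `p` is extended, projected and orthonormalized; completeness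
nearby follows because the ranks of `E` and `V₊`, hence of `V₋`, are locally constant. -/
theorem exists_ONFrame_minus (V : GenPseudometric C) (p : M) :
    ∃ (l : ℕ) (t : Fin l → Sec n F E) (θ : Fin l → ℝ), IsONFrame C V.minus p t θ ∧
      ∀ i, V.IsMinus (t i) := by
  have hfd := VectorBundle.finiteDimensional ℝ F E
  obtain ⟨k, s, η, hs, -⟩ := V.exists_ONFrame_plus p
  have hdim : ∀ᶠ x in 𝓝 p, finrank ℝ (V.minus x) = finrank ℝ (V.minus p) := by
    filter_upwards [hs.eventually] with x hx
    have h1 := Submodule.finrank_add_eq_of_isCompl (V.isCompl x)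
    have h2 := Submodule.finrank_add_eq_of_isCompl (V.isCompl p)
    rw [finrank_fibre (F := F), hx.finrank_eq] at h1
    rw [finrank_fibre (F := F), hs.finrank_eq] at h2
    omega
  obtain ⟨w, θ, hw, hθ, hwp⟩ := exists_orthonormal_family (C.pairing p) (C.pairing_symm p)
    (V.minus p) (V.minus_nondeg p)
  have hex : ∀ i, ∃ u : Sec n F E, u p = w i := fun i => exists_section_through p _
  choose u hu using hex
  have hup : ∀ i, V.minusSec (u i) p = w i := fun i => by
    rw [V.minusSec_apply, hu, V.proj_of_mem_minus (hw i), sub_zero]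
  obtain ⟨t, htp, ht, hspan⟩ := exists_gramSchmidt C p (fun i => V.minusSec (u i)) θ hθ
    fun i j => by rw [hup, hup]; exact hwp i j
  have hm : ∀ i, V.IsMinus (t i) := fun i x => by
    refine (Submodule.span_le.2 ?_) (hspan x i)
    rintro _ ⟨j, rfl⟩
    exact V.isMinus_minusSec (u j) x
  refine ⟨_, t, θ, isONFrame_of_complete hθ ht (Eventually.of_forall fun x i => hm i x) ?_, hm⟩
  filter_upwards [ht, hdim] with x hx hd v hv h0
  exact complete_of_finrank (C.pairing x) (C.pairing_symm x) (V.minus_nondeg x) hθ hx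
    (fun i => hm i x) hd hv h0

/-- Orthonormal frames of `V₊` and `V₋` form an adapted frame. -/
def adaptedFrame {V : GenPseudometric C} {p : M} {k l : ℕ} {s : Fin k → Sec n F E}
    {t : Fin l → Sec n F E} {η : Fin k → ℝ} {θ : Fin l → ℝ} (hs : IsONFrame C V.plus p s η)
    (ht : IsONFrame C V.minus p t θ) : AdaptedFrame V p where
  k := k
  l := l
  e := s
  f := t
  g := Matrix.diagonal η
  h := Matrix.diagonal θ
  frame_e := hs.linearIndependent.and hs.span
  frame_f := ht.linearIndependent.and ht.span
  pairing_e := hs.pairing.mono fun x hx i j => by rw [hx, Matrix.diagonal_apply]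
  pairing_f := ht.pairing.mono fun x hx i j => by rw [hx, Matrix.diagonal_apply]

theorem diagonal_inv_of_sq {k : ℕ} {η : Fin k → ℝ} (hη : ∀ i, η i * η i = 1) :
    (Matrix.diagonal η)⁻¹ = Matrix.diagonal η := by
  refine Matrix.inv_eq_left_inv ?_
  rw [Matrix.diagonal_mul_diagonal, ← Matrix.diagonal_one]
  exact congrArg _ (funext hη)

/-- To use the hypothesis, one admissible triple of adapted frame, half-density and section is
needed: the given frame completed by one of `V₋`, the chart density, and the section representing
the difference of divergences. -/
theorem scalarON_eq_zero {V : GenPseudometric C} {D : Divergence C}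
    (hV : IsScalarCurvature V D fun _ => 0) {p : M} {k : ℕ} {s : Fin k → Sec n F E}
    {η : Fin k → ℝ} (hs : IsONFrame C V.plus p s η) : scalarON D s η p = 0 := by
  obtain ⟨l, t, θ, ht, -⟩ := V.exists_ONFrame_minus p
  obtain ⟨e, he⟩ := exists_div_sub_chartDiv D p
  have h := hV p (adaptedFrame hs ht) (chartDensity p) e (chartDensity_regularNear p) he
  -- The adapted frame is already orthonormal, so the orthonormalizing matrices are identities.
  have hone : ∀ {j : ℕ} (ζ : Fin j → ℝ), (1 : Matrix (Fin j) (Fin j) ℝ) * Matrix.diagonal ζ *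
      (1 : Matrix (Fin j) (Fin j) ℝ).transpose = Matrix.diagonal ζ := fun ζ => by simp
  have hone' : ∀ {j : ℕ} {ζ : Fin j → ℝ}, (∀ i, ζ i * ζ i = 1) → (Matrix.diagonal ζ)⁻¹ =
      (1 : Matrix (Fin j) (Fin j) ℝ).transpose * Matrix.diagonal ζ * 1 := fun hζ => by
    simpa using diagonal_inv_of_sq hζ
  rw [scalar_rhs_eq (adaptedFrame hs ht) (P := (1 : Matrix (Fin k) (Fin k) ℝ)) (η := η) hs.sq
    (hone η) (hone' hs.sq) (Q := (1 : Matrix (Fin l) (Fin l) ℝ)) (θ := θ) ht.sq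
    (hone θ) (hone' ht.sq) D (chartDensity_regularNear p) he] at h
  have h1 : (fun c => ∑ i, (1 : Matrix (Fin k) (Fin k) ℝ) c i • s i) = s := by
    funext c
    simp [Matrix.one_apply]
  rw [← h1]
  exact h.symm

theorem isScalarCurvature_zero {V : GenPseudometric C} {D : Divergence C}
    (h : ∀ (p : M) (k : ℕ) (s : Fin k → Sec n F E) (η : Fin k → ℝ), IsONFrame C V.plus p s η →
      scalarON D s η p = 0) : IsScalarCurvature V D fun _ => 0 := by
  intro p B σ e hσ he
  have hfd := VectorBundle.finiteDimensional ℝ F E p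
  obtain ⟨P, η, hη, hP, hP'⟩ := exists_orthonormalizing (C.pairing p) (C.pairing_symm p) (V.plus p)
    (V.nondeg p) (fun i => B.e i p) B.frame_e.self_of_nhds.1 B.frame_e.self_of_nhds.2 B.g
    B.pairing_e.self_of_nhds
  obtain ⟨Q, θ, hθ, hQ, hQ'⟩ := exists_orthonormalizing (C.pairing p) (C.pairing_symm p) (V.minus p)
    (V.minus_nondeg p) (fun i => B.f i p) B.frame_f.self_of_nhds.1 B.frame_f.self_of_nhds.2 B.h
    B.pairing_f.self_of_nhds
  rw [scalar_rhs_eq B hη hP hP' hθ hQ hQ' D hσ he]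
  exact (h p _ _ η (isONFrame_of_constant hη hP V.nondeg B.frame_e B.pairing_e)).symm

end GenPseudometric

end ScalarZero

/-! ### Naturality of the frame formulas under pullback. -/

section PullbackRelations

variable {n m : ℕ} {M M' : Type*}
  [TopologicalSpace M] [ChartedSpace (EuclideanSpace ℝ (Fin n)) M] [IsManifold (𝓡 n) ∞ M]
  [TopologicalSpace M'] [ChartedSpace (EuclideanSpace ℝ (Fin m)) M'] [IsManifold (𝓡 m) ∞ M']
  {F : Type*} [NormedAddCommGroup F] [NormedSpace ℝ F]
  {E : M → Type*} [TopologicalSpace (TotalSpace F E)] [∀ x, TopologicalSpace (E x)]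
  [∀ x, AddCommGroup (E x)] [∀ x, Module ℝ (E x)] [FiberBundle F E] [VectorBundle ℝ F E]
  {τ : ContMDiffMap (𝓡 m) (𝓡 n) M' M ∞}
  {C : CourantAlgebroid n F E} {C' : CourantAlgebroid m F ((τ : M' → M) *ᵖ E)}

variable (τ) in
theorem pullSec_apply (u : Sec n F E) (x : M') : pullSec τ u x = (u (τ x) : E (τ x)) := rfl

namespace IsCAPullback

variable (H : IsCAPullback τ C C')
include H

theorem deriveAlong_pull (x : M') (v : E (τ x)) (f : C^∞⟮𝓡 n, M; ℝ⟯) :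
    deriveAlong (C'.anchor x v) (f.comp τ) = deriveAlong (C.anchor (τ x) v) f := by
  rw [← H.anchor]
  exact deriveAlong_comp _ (smooth_mdiff f _) ((τ.contMDiff x).mdifferentiableAt (by simp))

theorem act_pull (u : Sec n F E) (f : C^∞⟮𝓡 n, M; ℝ⟯) :
    C'.act (pullSec τ u) (f.comp τ) = (C.act u f).comp τ := by
  ext x
  exact H.deriveAlong_pull x (u (τ x)) f

theorem isONFrame_pull {W : ∀ x, Submodule ℝ (E x)} {x : M'} {k : ℕ} {s : Fin k → Sec n F E}
    {η : Fin k → ℝ} (h : IsONFrame C W (τ x) s η) :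
    IsONFrame C' (fun y => W (τ y)) x (fun i => pullSec τ (s i)) η := by
  have hc := τ.contMDiff.continuous.continuousAt (x := x)
  refine ⟨h.sq, ?_, hc.eventually h.mem, ?_⟩
  · filter_upwards [hc.eventually h.pairing] with y hy i j
    exact (H.pairing y _ _).trans (hy i j)
  · filter_upwards [hc.eventually h.expand] with y hy v hv
    refine (hy v hv).trans (Finset.sum_congr rfl fun i _ => ?_)
    exact congrArg (fun r : ℝ => (η i * r) • pullSec τ (s i) y) (H.pairing y (s i (τ y)) v).symm

/-- Every ingredient of the frame formula commutes with pullback of sections. No half-density is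
involved, which is essential since densities on `M` do not pull back to densities on `M'`. -/
theorem scalarON_pull {D : Divergence C} {D' : Divergence C'} (hD : IsPullbackDiv D D')
    {k : ℕ} (s : Fin k → Sec n F E) (η : Fin k → ℝ) (x : M') :
    scalarON D' (fun i => pullSec τ (s i)) η x = scalarON D s η (τ x) := by
  have hD' : ∀ u, D'.toLin (pullSec τ u) = (D.toLin u).comp τ := fun u => by
    ext y
    exact hD u y
  unfold scalarON
  simp only [hD', H.act_pull, H.bracket, pullSec_apply, H.pairing]
  rfl

end IsCAPullback

end PullbackRelations

section PullbackMetric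

variable {n m : ℕ} {M M' : Type*}
  [TopologicalSpace M] [ChartedSpace (EuclideanSpace ℝ (Fin n)) M] [IsManifold (𝓡 n) ∞ M]
  [TopologicalSpace M'] [ChartedSpace (EuclideanSpace ℝ (Fin m)) M'] [IsManifold (𝓡 m) ∞ M']
  {F : Type*} [NormedAddCommGroup F] [NormedSpace ℝ F] [FiniteDimensional ℝ F]
  {E : M → Type*} [TopologicalSpace (TotalSpace F E)] [∀ x, TopologicalSpace (E x)]
  [∀ x, AddCommGroup (E x)] [∀ x, Module ℝ (E x)] [FiberBundle F E] [VectorBundle ℝ F E]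
  {τ : ContMDiffMap (𝓡 m) (𝓡 n) M' M ∞}
  {C : CourantAlgebroid n F E} {C' : CourantAlgebroid m F ((τ : M' → M) *ᵖ E)}

namespace IsCAPullback

variable (H : IsCAPullback τ C C')

theorem proj_pull (V : GenPseudometric C) (x : M') (v : E (τ x)) :
    (H.pullMetric V).proj x v = V.proj (τ x) v := by
  refine (H.pullMetric V).proj_eq (V.proj_mem (τ x) v) fun z hz => ?_
  exact (H.pairing x z v).trans ((V.pairing_proj hz v).symm.trans (H.pairing x z _).symm)

theorem plusSec_pull (V : GenPseudometric C) (u : Sec n F E) :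
    (H.pullMetric V).plusSec (pullSec τ u) = pullSec τ (V.plusSec u) := by
  ext x
  exact H.proj_pull V x _

theorem minusSec_pull (V : GenPseudometric C) (u : Sec n F E) :
    (H.pullMetric V).minusSec (pullSec τ u) = pullSec τ (V.minusSec u) := by
  unfold GenPseudometric.minusSec
  rw [H.plusSec_pull]
  rfl

theorem ricOp_pull (V : GenPseudometric C) (a b v : Sec n F E) :
    (H.pullMetric V).ricOp (pullSec τ a) (pullSec τ b) (pullSec τ v) =
      pullSec τ (V.ricOp a b v) := by
  unfold GenPseudometric.ricOp
  rw [H.bracket, H.minusSec_pull, H.bracket, H.plusSec_pull]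

theorem minus_pull (V : GenPseudometric C) (x : M') :
    (H.pullMetric V).minus x = V.minus (τ x) := by
  ext v
  rw [GenPseudometric.mem_minus_iff]
  refine Iff.trans ?_ (GenPseudometric.mem_minus_iff V (x := τ x)).symm
  exact forall₂_congr fun z _ => ⟨fun h => (H.pairing x z v).symm.trans h,
    fun h => (H.pairing x z v).trans h⟩

variable [T2Space M] [T2Space M'] [ContMDiffVectorBundle ∞ F E (𝓡 n)]

theorem GRic_pull {V : GenPseudometric C} {D : Divergence C} {D' : Divergence C'}
    (hD : IsPullbackDiv D D') {a b : Sec n F E} (ha : V.IsPlus a) (hb : V.IsMinus b) (x : M') :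
    (H.pullMetric V).GRic D' (pullSec τ a) (pullSec τ b) x = V.GRic D a b (τ x) := by
  have hD' : ∀ u, D'.toLin (pullSec τ u) = (D.toLin u).comp τ := fun u => by
    ext y
    exact hD u y
  obtain ⟨k, s, η, hs, hs'⟩ := V.exists_ONFrame_plus (τ x)
  have hb' : (H.pullMetric V).IsMinus (pullSec τ b) := fun y => by
    rw [H.minus_pull]
    exact hb (τ y)
  rw [V.GRic_eq hs hs' D ha hb, (H.pullMetric V).GRic_eq (H.isONFrame_pull hs)
    (fun i y => hs' i (τ y)) D' (fun y => ha (τ y)) hb']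
  simp only [H.bracket, H.plusSec_pull, hD', H.act_pull, H.ricOp_pull, pullSec_apply, H.pairing]
  rfl

/-- Pulled back frames of `V₊` and `V₋` are frames of the pulled back bundles, so tensoriality
reduces the claim to pulled back sections. -/
theorem GRic_pull_eq_zero {V : GenPseudometric C} {D : Divergence C} {D' : Divergence C'}
    (hD : IsPullbackDiv D D')
    (h0 : ∀ a b : Sec n F E, V.IsPlus a → V.IsMinus b → ∀ p, V.GRic D a b p = 0)
    {a b : Sec m F ((τ : M' → M) *ᵖ E)} (ha : (H.pullMetric V).IsPlus a)
    (hb : (H.pullMetric V).IsMinus b) (x : M') : (H.pullMetric V).GRic D' a b x = 0 := by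
  obtain ⟨k, s, η, hs, hs'⟩ := V.exists_ONFrame_plus (τ x)
  obtain ⟨l, t, θ, ht, ht'⟩ := V.exists_ONFrame_minus (τ x)
  have hmin : (H.pullMetric V).minus = fun y => V.minus (τ y) := funext (H.minus_pull V)
  refine (H.pullMetric V).GRic_eq_zero_of_frames (H.isONFrame_pull hs) (fun i y => hs' i (τ y)) D'
    (t := fun i => pullSec τ (t i)) (θ := θ) (hmin ▸ H.isONFrame_pull ht) (fun i y => ?_)
    (fun i j => ?_) ha hb
  · rw [hmin]
    exact ht' i (τ y)
  · rw [H.GRic_pull hD (hs' i) (ht' j)]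
    exact h0 _ _ (hs' i) (ht' j) _

end IsCAPullback

end PullbackMetric

/-! ### Existence of the pullback divergence. -/

section PullbackDiv

variable {n m : ℕ} {M M' : Type*}
  [TopologicalSpace M] [ChartedSpace (EuclideanSpace ℝ (Fin n)) M] [IsManifold (𝓡 n) ∞ M]
  [TopologicalSpace M'] [ChartedSpace (EuclideanSpace ℝ (Fin m)) M'] [IsManifold (𝓡 m) ∞ M']
  {F : Type*} [NormedAddCommGroup F] [NormedSpace ℝ F] [FiniteDimensional ℝ F]
  {E : M → Type*} [TopologicalSpace (TotalSpace F E)] [∀ x, TopologicalSpace (E x)]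
  [∀ x, AddCommGroup (E x)] [∀ x, Module ℝ (E x)] [FiberBundle F E] [VectorBundle ℝ F E]
  {τ : ContMDiffMap (𝓡 m) (𝓡 n) M' M ∞}
  {C : CourantAlgebroid n F E} {C' : CourantAlgebroid m F ((τ : M' → M) *ᵖ E)}
  [T2Space M] [T2Space M'] [ContMDiffVectorBundle ∞ F E (𝓡 n)]

/-- The divergence of `u = Σ ηᵢ ⟨τ^* sᵢ, u⟩ τ^* sᵢ` on `τ^* E` that extends the divergence `D`. -/
def pullDivAux (C' : CourantAlgebroid m F ((τ : M' → M) *ᵖ E)) (D : Divergence C) {k : ℕ}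
    (s : Fin k → Sec n F E) (η : Fin k → ℝ) (u : Sec m F ((τ : M' → M) *ᵖ E)) : C^∞⟮𝓡 m, M'; ℝ⟯ :=
  ∑ i, η i • (C'.pair (pullSec τ (s i)) u * (D.toLin (s i)).comp τ
    + C'.act (pullSec τ (s i)) (C'.pair (pullSec τ (s i)) u))

namespace IsCAPullback

variable (H : IsCAPullback τ C C')
include H

/-- The right-hand side is the value forced by the Leibniz rule and involves only the expansion of
`u`. Hence the frame formula does not depend on the frame `s`, while the left-hand side shows that
the value does not depend on the expansion. -/
theorem pullDivAux_eq (D : Divergence C) {k : ℕ} {s : Fin k → Sec n F E} {η : Fin k → ℝ} {x : M'}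
    (hs : IsONFrame C (fun _ => ⊤) (τ x) s η) {u : Sec m F ((τ : M' → M) *ᵖ E)} {l : ℕ}
    (t : Fin l → Sec n F E) (g : Fin l → C^∞⟮𝓡 m, M'; ℝ⟯)
    (hu : ∀ᶠ y in 𝓝 x, u y = (∑ j, mulSec (g j) (pullSec τ (t j))) y) :
    pullDivAux C' D s η u x =
      ∑ j, (g j x * D.toLin (t j) (τ x) + C'.act (pullSec τ (t j)) (g j) x) := by
  have hf : ∀ i, ∀ᶠ y in 𝓝 x, C'.pair (pullSec τ (s i)) u y =
      (∑ j, g j * (C.pair (s i) (t j)).comp τ) y := fun i => by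
    filter_upwards [hu] with y hy
    rw [C'.pair_apply, hy, sec_sum_apply, map_sum, smooth_sum_apply]
    refine Finset.sum_congr rfl fun j _ => ?_
    rw [mulSec_apply, map_smul, pullSec_apply, pullSec_apply, H.pairing]
    rfl
  have hdt : ∀ j, D.toLin (t j) (τ x) = ∑ i, η i * (C.pair (s i) (t j) (τ x) * D.toLin (s i) (τ x)
      + C.act (s i) (C.pair (s i) (t j)) (τ x)) := fun j => by
    rw [(D.congr (GenPseudometric.expand_near hs (v := t j)
      (Eventually.of_forall fun _ => trivial))).self_of_nhds, map_sum, smooth_sum_apply]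
    refine Finset.sum_congr rfl fun i _ => ?_
    rw [D.map_mulSec, C.act_smul]
    change η i * _ * _ + η i * _ = _
    ring
  have hat : ∀ j, C'.act (pullSec τ (t j)) (g j) x =
      ∑ i, η i * C.pair (s i) (t j) (τ x) * C'.act (pullSec τ (s i)) (g j) x := fun j => by
    rw [C'.act_apply, GenPseudometric.act_expand (H.isONFrame_pull hs) (v := pullSec τ (t j) x)
      trivial (g j)]
    refine Finset.sum_congr rfl fun i _ => ?_
    rw [pullSec_apply, pullSec_apply, H.pairing]
    rfl
  have hact : ∀ i, C'.act (pullSec τ (s i)) (C'.pair (pullSec τ (s i)) u) x =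
      ∑ j, (g j x * C.act (s i) (C.pair (s i) (t j)) (τ x) +
        C.pair (s i) (t j) (τ x) * C'.act (pullSec τ (s i)) (g j) x) := fun i => by
    rw [C'.act_congr rfl (hf i), C'.act_sum, smooth_sum_apply]
    refine Finset.sum_congr rfl fun j _ => ?_
    rw [C'.act_mul, H.act_pull]
    rfl
  unfold pullDivAux
  simp only [hdt, hat, smooth_sum_apply]
  have h1 : ∀ i, (η i • (C'.pair (pullSec τ (s i)) u * (D.toLin (s i)).comp τ
      + C'.act (pullSec τ (s i)) (C'.pair (pullSec τ (s i)) u))) x =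
      ∑ j, η i * (g j x * C.pair (s i) (t j) (τ x) * D.toLin (s i) (τ x) +
        (g j x * C.act (s i) (C.pair (s i) (t j)) (τ x) +
        C.pair (s i) (t j) (τ x) * C'.act (pullSec τ (s i)) (g j) x)) := fun i => by
    change η i * (C'.pair (pullSec τ (s i)) u x * D.toLin (s i) (τ x) + _) = _
    rw [hact, (hf i).self_of_nhds, smooth_sum_apply, Finset.sum_mul, ← Finset.sum_add_distrib,
      Finset.mul_sum]
    rfl
  rw [Finset.sum_congr rfl fun i _ => h1 i, Finset.sum_comm]
  refine Finset.sum_congr rfl fun j _ => ?_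
  rw [Finset.mul_sum, ← Finset.sum_add_distrib]
  exact Finset.sum_congr rfl fun i _ => by ring

theorem exists_pullbackDiv (D : Divergence C) : ∃ D' : Divergence C', IsPullbackDiv D D' := by
  choose k s η hs using exists_ONFrame_top C
  -- The frames are chosen separately at each point with no continuity. Near `x` the frame chosen at
  -- `τ x` may replace the one chosen at `τ y`, which gives smoothness.
  have hex : ∀ (x : M') (u : Sec m F ((τ : M' → M) *ᵖ E)), ∀ᶠ y in 𝓝 x,
      pullDivAux C' D (s (τ y)) (η (τ y)) u y = pullDivAux C' D (s (τ x)) (η (τ x)) u y := by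
    intro x u
    have h1 := H.isONFrame_pull (hs (τ x))
    have h2 := GenPseudometric.expand_near h1 (v := u) (Eventually.of_forall fun _ => trivial)
    filter_upwards [h2.eventually_nhds, τ.contMDiff.continuous.continuousAt.eventually
      (hs (τ x)).eventually] with y hy hy'
    rw [H.pullDivAux_eq D (hs (τ y)) _ _ hy, H.pullDivAux_eq D hy' _ _ hy]
  let φ : Sec m F ((τ : M' → M) *ᵖ E) → C^∞⟮𝓡 m, M'; ℝ⟯ := fun u =>
    ⟨fun y => pullDivAux C' D (s (τ y)) (η (τ y)) u y, fun x =>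
      (pullDivAux C' D (s (τ x)) (η (τ x)) u).contMDiff.contMDiffAt.congr_of_eventuallyEq (hex x u)⟩
  have hφ : ∀ u x, φ u x = pullDivAux C' D (s (τ x)) (η (τ x)) u x := fun _ _ => rfl
  refine ⟨⟨⟨⟨φ, fun u v => ?_⟩, fun c u => ?_⟩, fun f u x => ?_⟩, fun u x => ?_⟩
  · ext x
    change φ (u + v) x = φ u x + φ v x
    rw [hφ, hφ, hφ]
    unfold pullDivAux
    simp only [C'.pair_add_right, C'.act_add, smooth_sum_apply, ← Finset.sum_add_distrib]
    refine Finset.sum_congr rfl fun i _ => ?_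
    change η (τ x) i * ((_ + _) * _ + (_ + _)) = η (τ x) i * (_ * _ + _) + η (τ x) i * (_ * _ + _)
    ring
  · ext x
    change φ (c • u) x = c * φ u x
    rw [hφ, hφ]
    unfold pullDivAux
    simp only [C'.pair_smul_right, C'.act_smul, smooth_sum_apply, Finset.mul_sum]
    refine Finset.sum_congr rfl fun i _ => ?_
    change η (τ x) i * ((c * _) * _ + (c * _)) = c * (η (τ x) i * (_ * _ + _))
    ring
  · change φ (mulSec f u) x = f x * φ u x + _
    have h1 := H.isONFrame_pull (hs (τ x))
    have h2 : ∀ i, C'.pair (pullSec τ (s (τ x) i)) (mulSec f u) =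
        f * C'.pair (pullSec τ (s (τ x) i)) u := fun i => by
      ext y
      change C'.pairing y _ (f y • u y) = f y * _
      rw [map_smul]
      rfl
    rw [GenPseudometric.act_expand h1 (v := u x) trivial f, hφ, hφ]
    unfold pullDivAux
    simp only [h2, C'.act_mul, smooth_sum_apply, Finset.mul_sum, ← Finset.sum_add_distrib]
    refine Finset.sum_congr rfl fun i _ => ?_
    change η (τ x) i * (f x * C'.pairing x _ _ * _ + (f x * _ + C'.pairing x _ _ * deriveAlong _ _))
      = f x * (η (τ x) i * (C'.pairing x _ _ * _ + _)) + _
    ring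
  · change φ (pullSec τ u) x = _
    -- A pulled back section is its own expansion with a single term of coefficient `1`.
    rw [hφ, H.pullDivAux_eq D (hs (τ x)) (l := 1) (fun _ => u) (fun _ => 1)
      (Eventually.of_forall fun y => by simp)]
    rw [C'.act_eq_zero_of_const (c := 1) (Eventually.of_forall fun _ => rfl)]
    simp

end IsCAPullback

end PullbackDiv

/-! ### Local sections of submersions, locally constant functions, smooth coefficients. -/

section Submersion

variable {m d : ℕ} {M N : Type*}
  [TopologicalSpace M] [ChartedSpace (EuclideanSpace ℝ (Fin m)) M] [IsManifold (𝓡 m) ∞ M]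
  [TopologicalSpace N] [ChartedSpace (EuclideanSpace ℝ (Fin d)) N] [IsManifold (𝓡 d) ∞ N]

/-- A submersion has local sections. -/
theorem exists_local_section {f : M → N} {x : M} (h : IsSubmersionAt (𝓡 m) (𝓡 d) ∞ f x) :
    ∃ σ : N → M, ContMDiffAt (𝓡 d) (𝓡 m) ∞ σ (f x) ∧ σ (f x) = x ∧ ∀ᶠ y in 𝓝 (f x), f (σ y) = y := by
  let e := h.domChart
  let e' := h.codChart
  have hx : x ∈ e.source := h.mem_domChart_source
  have hfx : f x ∈ e'.source := h.mem_codChart_source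
  let c := (h.equiv (e x)).2
  -- In normal form the submersion is a projection to the first factor; the section freezes the
  -- second coordinate at its value at `x`.
  let ζ : N → EuclideanSpace ℝ (Fin m) := fun y => h.equiv.symm (e' y, c)
  have hw : ∀ z ∈ e.target, e' (f (e.symm z)) = (h.equiv z).1 := fun z hz =>
    h.writtenInCharts (show z ∈ (e.extend (𝓡 m)).target by simpa using hz)
  have hζx : ζ (f x) = e x := by
    have h1 := hw (e x) (e.map_source hx)
    rw [e.left_inv hx] at h1
    change h.equiv.symm (e' (f x), c) = _
    rw [h1]
    exact h.equiv.symm_apply_apply (e x)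
  have hζ : ContMDiffAt (𝓡 d) (𝓡 m) ∞ ζ (f x) := by
    have h1 : ContDiff ℝ ∞ fun w : EuclideanSpace ℝ (Fin d) => h.equiv.symm (w, c) :=
      h.equiv.symm.contDiff.comp (contDiff_prodMk_left c)
    exact h1.contMDiff.contMDiffAt.comp (f x)
      (contMDiffAt_of_mem_maximalAtlas h.codChart_mem_maximalAtlas hfx)
  refine ⟨fun y => e.symm (ζ y), ?_, ?_, ?_⟩
  · have h2 : ContMDiffAt (𝓡 m) (𝓡 m) ∞ e.symm (ζ (f x)) := by
      rw [hζx]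
      exact contMDiffAt_symm_of_mem_maximalAtlas h.domChart_mem_maximalAtlas (e.map_source hx)
    exact h2.comp (f x) hζ
  · change e.symm (ζ (f x)) = x
    rw [hζx, e.left_inv hx]
  · have h3 : ∀ᶠ y in 𝓝 (f x), ζ y ∈ e.target :=
      hζ.continuousAt.eventually (by
        rw [hζx]
        exact e.open_target.mem_nhds (e.map_source hx))
    filter_upwards [h3, e'.open_source.mem_nhds hfx] with y hy hy'
    have h4 := hw _ hy
    have h5 : h.equiv (ζ y) = (e' y, c) := h.equiv.apply_symm_apply _
    rw [h5] at h4
    exact e'.injOn (h.source_subset_preimage_source (e.map_target hy)) hy' h4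

end Submersion

section LocallyConstant

variable {r : ℕ} {S : Type*} [TopologicalSpace S] [ChartedSpace (EuclideanSpace ℝ (Fin r)) S]
  [IsManifold (𝓡 r) ∞ S]

theorem isLocallyConstant_of_mfderiv_eq_zero {φ : S → ℝ} (hφ : MDifferentiable (𝓡 r) 𝓘(ℝ, ℝ) φ)
    (h0 : ∀ g, mfderiv (𝓡 r) 𝓘(ℝ, ℝ) φ g = 0) : IsLocallyConstant φ := by
  rw [IsLocallyConstant.iff_eventually_eq]
  intro g
  let e := extChartAt (𝓡 r) g
  have hd : ∀ y ∈ e.target, HasFDerivAt (φ ∘ e.symm) (0 : EuclideanSpace ℝ (Fin r) →L[ℝ] ℝ) y := by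
    intro y hy
    have h1 := (hφ (e.symm y)).hasMFDerivAt.comp y
      (mdifferentiableAt_extChartAt_symm_of_mem hy).hasMFDerivAt
    rw [h0] at h1
    have h2 := h1.hasFDerivAt
    exact h2.congr_fderiv (ContinuousLinearMap.zero_comp (mfderiv (𝓡 r) (𝓡 r) e.symm y))
  obtain ⟨ε, hε, hb⟩ := Metric.isOpen_iff.1 (isOpen_extChartAt_target (I := 𝓡 r) g) _
    (mem_extChartAt_target (I := 𝓡 r) g)
  have h3 : ∀ᶠ x in 𝓝 g, e x ∈ Metric.ball (e g) ε :=
    (continuousAt_extChartAt (I := 𝓡 r) g).eventually (Metric.ball_mem_nhds _ hε)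
  filter_upwards [h3, (isOpen_extChartAt_source (I := 𝓡 r) g).mem_nhds
    (mem_extChartAt_source (I := 𝓡 r) g)] with x hx hxs
  have h4 := Metric.isOpen_ball.is_const_of_fderiv_eq_zero (𝕜 := ℝ) (f := φ ∘ e.symm)
    (convex_ball (e g) ε).isPreconnected
    (fun y hy => (hd y (hb hy)).differentiableAt.differentiableWithinAt)
    (fun y hy => (hd y (hb hy)).fderiv) hx (Metric.mem_ball_self hε)
  simp only [Function.comp_apply] at h4
  rwa [e.left_inv hxs, e.left_inv (mem_extChartAt_source g)] at h4

end LocallyConstant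

section Solve

variable {n : ℕ} {M : Type*} [TopologicalSpace M] [ChartedSpace (EuclideanSpace ℝ (Fin n)) M]
  [IsManifold (𝓡 n) ∞ M]

theorem contMDiffAt_det {ι : Type*} [Fintype ι] [DecidableEq ι] {A : M → Matrix ι ι ℝ} {p : M}
    (hA : ∀ i j, ContMDiffAt (𝓡 n) 𝓘(ℝ, ℝ) ∞ (fun x => A x i j) p) :
    ContMDiffAt (𝓡 n) 𝓘(ℝ, ℝ) ∞ (fun x => (A x).det) p := by
  simp only [Matrix.det_apply']
  exact contMDiffAt_finsetSum fun σ _ =>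
    contMDiffAt_const.mul (contMDiffAt_finsetProd fun i _ => hA _ _)

theorem contMDiffAt_inv_apply {ι : Type*} [Fintype ι] [DecidableEq ι] {A : M → Matrix ι ι ℝ} {p : M}
    (hA : ∀ i j, ContMDiffAt (𝓡 n) 𝓘(ℝ, ℝ) ∞ (fun x => A x i j) p) (h0 : (A p).det ≠ 0) (i j : ι) :
    ContMDiffAt (𝓡 n) 𝓘(ℝ, ℝ) ∞ (fun x => (A x)⁻¹ i j) p := by
  have h1 : ContMDiffAt (𝓡 n) 𝓘(ℝ, ℝ) ∞ (fun x => (A x).adjugate i j) p := by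
    simp only [Matrix.adjugate_apply]
    refine contMDiffAt_det fun i' j' => ?_
    simp only [Matrix.updateRow_apply]
    split_ifs
    · exact contMDiffAt_const
    · exact hA _ _
  have h2 : (fun x => (A x)⁻¹ i j) = fun x => ((A x).det)⁻¹ * (A x).adjugate i j := by
    funext x
    simp [Matrix.inv_def, Ring.inverse_eq_inv']
  rw [h2]
  exact ((contMDiffAt_det hA).inv₀ h0).mul h1

variable {F : Type*} [NormedAddCommGroup F] [NormedSpace ℝ F] [FiniteDimensional ℝ F]
  {E : M → Type*} [TopologicalSpace (TotalSpace F E)] [∀ x, TopologicalSpace (E x)]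
  [∀ x, AddCommGroup (E x)] [∀ x, Module ℝ (E x)] [FiberBundle F E] [VectorBundle ℝ F E]
  [T2Space M] [ContMDiffVectorBundle ∞ F E (𝓡 n)]

/-- A section in the span of pointwise linearly independent sections is locally a combination of
them with smooth coefficients. -/
theorem exists_smooth_coeffs (C : CourantAlgebroid n F E) {k : ℕ} (c : Fin k → Sec n F E) {p : M}
    (hc : LinearIndependent ℝ fun i => c i p) {w : Sec n F E}
    (hw : ∀ᶠ x in 𝓝 p, ∃ g : Fin k → ℝ, w x = ∑ i, g i • c i x) :
    ∃ f : Fin k → C^∞⟮𝓡 n, M; ℝ⟯, ∀ᶠ x in 𝓝 p, w x = (∑ i, mulSec (f i) (c i)) x := by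
  have hfd := VectorBundle.finiteDimensional ℝ F E p
  -- The components of a left inverse are functionals dual to the `c i p`. Nondegeneracy of the
  -- pairing represents them by vectors, which extend to sections `v j`. Pairing with these gives a
  -- linear system whose matrix is the identity at `p`, so the coefficients are found by inverting
  -- it nearby.
  obtain ⟨φ, hφ⟩ := LinearMap.exists_leftInverse_of_injective
    (Fintype.linearCombination ℝ fun i => c i p)
    (LinearMap.ker_eq_bot.2 hc.fintypeLinearCombination_injective)
  have hφc : ∀ i, φ (c i p) = Pi.single i 1 := fun i => by
    have := LinearMap.congr_fun hφ (Pi.single i 1)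
    simpa using this
  have hv : ∀ j, ∃ v : Sec n F E, ∀ z, C.pairing p (v p) z = φ z j := fun j => by
    obtain ⟨v, hv⟩ := exists_section_through (n := n) (F := F) p
      (((C.pairing p).toDual (C.pairing_nondeg p)).symm (LinearMap.proj j ∘ₗ φ))
    refine ⟨v, fun z => ?_⟩
    rw [hv, LinearMap.BilinForm.apply_toDual_symm_apply]
    rfl
  choose v hv using hv
  let A : M → Matrix (Fin k) (Fin k) ℝ := fun x => Matrix.of fun j i => C.pairing x (v j x) (c i x)
  have hAs : ∀ x j i, ContMDiffAt (𝓡 n) 𝓘(ℝ, ℝ) ∞ (fun x => A x j i) x :=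
    fun x j i => C.pairing_smooth (v j) (c i) x
  have hAp : A p = 1 := by
    ext j i
    change C.pairing p (v j p) (c i p) = _
    rw [hv, hφc, Pi.single_apply, Matrix.one_apply]
  have hdet : ∀ᶠ x in 𝓝 p, (A x).det ≠ 0 :=
    (contMDiffAt_det (hAs p)).continuousAt.eventually_ne (by rw [hAp, Matrix.det_one]; simp)
  have hf : ∀ i, ∃ f : C^∞⟮𝓡 n, M; ℝ⟯, ∀ᶠ x in 𝓝 p,
      f x = ∑ j, (A x)⁻¹ i j * C.pairing x (v j x) (w x) := fun i =>
    exists_smooth_extend (by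
      filter_upwards [hdet] with x hx
      exact contMDiffAt_finsetSum fun j _ =>
        (contMDiffAt_inv_apply (hAs x) hx i j).mul (C.pairing_smooth (v j) w x))
  choose f hf using hf
  refine ⟨f, ?_⟩
  filter_upwards [hdet, hw, eventually_all.2 hf] with x hx hw hf
  obtain ⟨g, hg⟩ := hw
  have h1 : (A x).mulVec g = fun j => C.pairing x (v j x) (w x) := by
    funext j
    rw [hg, map_sum]
    change ∑ i, A x j i * g i = _
    refine Finset.sum_congr rfl fun i _ => ?_
    rw [map_smul, smul_eq_mul, mul_comm]
    rfl
  have h2 : (A x)⁻¹.mulVec (fun j => C.pairing x (v j x) (w x)) = g := by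
    rw [← h1, Matrix.mulVec_mulVec, Matrix.nonsing_inv_mul _ hx.isUnit, Matrix.one_mulVec]
  rw [sec_sum_apply, hg]
  refine Finset.sum_congr rfl fun i _ => ?_
  rw [mulSec_apply, hf, ← congrFun h2 i]
  rfl

end Solve

/-! ### Admissibility and equivariance of the pulled back data. -/

section PullbackEquivariant

variable {n m : ℕ} {M M' : Type*}
  [TopologicalSpace M] [ChartedSpace (EuclideanSpace ℝ (Fin n)) M] [IsManifold (𝓡 n) ∞ M]
  [TopologicalSpace M'] [ChartedSpace (EuclideanSpace ℝ (Fin m)) M'] [IsManifold (𝓡 m) ∞ M']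
  {F : Type*} [NormedAddCommGroup F] [NormedSpace ℝ F] [FiniteDimensional ℝ F]
  {E : M → Type*} [TopologicalSpace (TotalSpace F E)] [∀ x, TopologicalSpace (E x)]
  [∀ x, AddCommGroup (E x)] [∀ x, Module ℝ (E x)] [FiberBundle F E] [VectorBundle ℝ F E]
  {τ : ContMDiffMap (𝓡 m) (𝓡 n) M' M ∞}
  {C : CourantAlgebroid n F E} {C' : CourantAlgebroid m F ((τ : M' → M) *ᵖ E)}
  [T2Space M] [T2Space M'] [ContMDiffVectorBundle ∞ F E (𝓡 n)]
  {𝔰 : Type*} [LieRing 𝔰] [LieAlgebra ℝ 𝔰]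

namespace IsCAPullback

variable (H : IsCAPullback τ C C') {X : EquivariantStructure 𝔰 C}

theorem pullEquivariant_χ (s : 𝔰) : (H.pullEquivariant X).χ s = pullSec τ (X.χ s) := rfl

/-- Sections of `τ^* V₊` are combinations of pulled back frames. The Leibniz rule in the second slot
only adds multiples of these frames, so invariance need only be known on `M`. -/
theorem admissible_pull {V : GenPseudometric C} (hV : X.Admissible V) :
    (H.pullEquivariant X).Admissible (H.pullMetric V) := by
  refine ⟨fun s a ha x => ?_, fun x v hv t => ?_⟩
  · obtain ⟨k, e, η, he, he'⟩ := V.exists_ONFrame_plus (τ x)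
    have h1 := GenPseudometric.expand_near (H.isONFrame_pull he) (v := a) (Eventually.of_forall ha)
    rw [C'.bracket_congr_right _ h1, map_sum, sec_sum_apply]
    refine Submodule.sum_mem _ fun i _ => ?_
    rw [C'.bracket_mulSec, H.pullEquivariant_χ, H.bracket, sec_add_apply, mulSec_apply, mulSec_apply]
    exact Submodule.add_mem _ (Submodule.smul_mem _ _ (hV.1 s _ (he' i) (τ x)))
      (Submodule.smul_mem _ _ (he' i (τ x)))
  · exact (H.pairing x _ v).trans (hV.2 (τ x) hv t)

/-- Both sides of the invariance condition obey the same rule under `u ↦ f u`, because the anchor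
preserves brackets. It therefore suffices to check pulled back frames. -/
theorem isEquivariantDiv_pull {D : Divergence C} {D' : Divergence C'} (hD : IsPullbackDiv D D')
    (hX : X.IsEquivariantDiv D) : (H.pullEquivariant X).IsEquivariantDiv D' := by
  have hD' : ∀ u, D'.toLin (pullSec τ u) = (D.toLin u).comp τ := fun u => by
    ext y
    exact hD u y
  refine ⟨fun s u x => ?_, fun s x => (hD _ x).trans (hX.2 s (τ x))⟩
  change C'.act ((H.pullEquivariant X).χ s) (D'.toLin u) x = _
  rw [H.pullEquivariant_χ]
  obtain ⟨k, e, η, he⟩ := exists_ONFrame_top C (τ x)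
  have h1 := GenPseudometric.expand_near (H.isONFrame_pull he) (v := u)
    (Eventually.of_forall fun _ => trivial)
  rw [C'.act_congr rfl (D'.congr h1), (D'.congr (C'.bracket_congr (u := pullSec τ (X.χ s))
    (Eventually.of_forall fun _ => rfl) h1)).self_of_nhds]
  simp only [map_sum, C'.act_sum, smooth_sum_apply]
  refine Finset.sum_congr rfl fun i _ => ?_
  rw [D'.map_mulSec, C'.bracket_mulSec, map_add, D'.map_mulSec, D'.map_mulSec, C'.act_add, C'.act_mul,
    H.bracket, hD', hD', H.act_pull, ← H.bracket, C'.act_bracket]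
  have h2 : C.act (X.χ s) (D.toLin (e i)) = D.toLin (C.bracket (X.χ s) (e i)) := by
    ext y
    exact hX.1 s (e i) y
  rw [h2]
  exact congrArg (fun φ : C^∞⟮𝓡 m, M'; ℝ⟯ => φ x) (by ring)

end IsCAPullback

end PullbackEquivariant

/-! ### Invariant sections of `𝔰_E^⊥` and their divergences. -/

section Equivariant

variable {n : ℕ} {M : Type*} [TopologicalSpace M] [ChartedSpace (EuclideanSpace ℝ (Fin n)) M]
  [IsManifold (𝓡 n) ∞ M] {F : Type*} [NormedAddCommGroup F] [NormedSpace ℝ F]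
  [FiniteDimensional ℝ F]
  {E : M → Type*} [TopologicalSpace (TotalSpace F E)] [∀ x, TopologicalSpace (E x)]
  [∀ x, AddCommGroup (E x)] [∀ x, Module ℝ (E x)] [FiberBundle F E] [VectorBundle ℝ F E]
  [T2Space M] [ContMDiffVectorBundle ∞ F E (𝓡 n)]
  {𝔰 : Type*} [LieRing 𝔰] [LieAlgebra ℝ 𝔰]
  {C : CourantAlgebroid n F E} {X : EquivariantStructure 𝔰 C}

namespace EquivariantStructure

theorem InvPerp.add {u v : Sec n F E} (hu : X.InvPerp u) (hv : X.InvPerp v) : X.InvPerp (u + v) :=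
  ⟨fun x => (X.perp x).add_mem (hu.1 x) (hv.1 x), fun s => by rw [map_add, hu.2, hv.2, add_zero]⟩

theorem InvPerp.smul {u : Sec n F E} (hu : X.InvPerp u) (c : ℝ) : X.InvPerp (c • u) :=
  ⟨fun x => (X.perp x).smul_mem c (hu.1 x), fun s => by rw [map_smul, hu.2, smul_zero]⟩

theorem InvPerp.sub {u v : Sec n F E} (hu : X.InvPerp u) (hv : X.InvPerp v) : X.InvPerp (u - v) :=
  ⟨fun x => (X.perp x).sub_mem (hu.1 x) (hv.1 x), fun s => by rw [map_sub, hu.2, hv.2, sub_zero]⟩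

theorem InvPerp.mulSec {u : Sec n F E} (hu : X.InvPerp u) {f : C^∞⟮𝓡 n, M; ℝ⟯}
    (hf : ∀ s, C.act (X.χ s) f = 0) : X.InvPerp (mulSec f u) := by
  refine ⟨fun x => (X.perp x).smul_mem _ (hu.1 x), fun s => ?_⟩
  rw [C.bracket_mulSec, hu.2, hf]
  ext x
  simp

/-- Since brackets with `χ(s)` preserve `V₊` and the pairing, they preserve `V₋` as well and so
commute with the projection. -/
theorem InvPerp.plusSec {V : GenPseudometric C} (hV : X.Admissible V) {u : Sec n F E}
    (hu : X.InvPerp u) : X.InvPerp (V.plusSec u) := by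
  refine ⟨fun x => hV.2 x (V.isPlus_plusSec u x), fun s => ?_⟩
  have hm : V.IsMinus (C.bracket (X.χ s) (V.minusSec u)) := fun x => by
    rw [GenPseudometric.mem_minus_iff]
    intro z hz
    obtain ⟨a, ha⟩ := exists_section_through (n := n) (F := F) x z
    have h1 := C.act_pair (X.χ s) (V.plusSec a) (V.minusSec u) x
    rw [C.act_eq_zero_of_const (c := 0) (Eventually.of_forall fun y =>
      (V.isPlus_plusSec a).pair_minus (V.isMinus_minusSec u) y),
      (hV.1 s _ (V.isPlus_plusSec a)).pair_minus (V.isMinus_minusSec u), zero_add] at h1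
    rw [h1, V.plusSec_apply, ha, V.proj_of_mem hz]
  have h2 : C.bracket (X.χ s) (V.plusSec u) + C.bracket (X.χ s) (V.minusSec u) = 0 := by
    rw [← map_add, GenPseudometric.minusSec, add_sub_cancel, hu.2]
  have h3 := congrArg V.plusSec h2
  rwa [V.plusSec_add, (hV.1 s _ (V.isPlus_plusSec u)).plusSec_eq, hm.plusSec_eq, add_zero,
    V.plusSec_zero] at h3

theorem InvPerp.bracket {u v : Sec n F E} (hu : X.InvPerp u) (hv : X.InvPerp v)
    (h : ∀ x, C.bracket u v x ∈ X.perp x) : X.InvPerp (C.bracket u v) := by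
  refine ⟨h, fun s => ?_⟩
  rw [C.jacobi, hu.2, hv.2, map_zero, map_zero, LinearMap.zero_apply, add_zero]

theorem IsEquivariantDiv.act_eq_zero {D : Divergence C} (hD : X.IsEquivariantDiv D)
    {u : Sec n F E} (hu : X.InvPerp u) (s : 𝔰) : C.act (X.χ s) (D.toLin u) = 0 := by
  ext x
  have := hD.1 s u x
  rw [hu.2, map_zero] at this
  exact this

/-- An equivariant divergence vanishes on the invariant sections of `𝔰_E`. -/
theorem IsEquivariantDiv.eq_zero [FiniteDimensional ℝ 𝔰] {D : Divergence C}
    (hD : X.IsEquivariantDiv D) {w : Sec n F E} (hw : ∀ s, C.bracket (X.χ s) w = 0)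
    (hwχ : ∀ x, ∃ s, X.χ s x = w x) : D.toLin w = 0 := by
  ext p
  let b := finBasis ℝ 𝔰
  let ev : ∀ x : M, 𝔰 →ₗ[ℝ] E x := fun x =>
    { toFun := fun s => X.χ s x
      map_add' := fun s t => by rw [map_add, sec_add_apply]
      map_smul' := fun c s => by rw [map_smul, sec_smul_apply]; rfl }
  have hev : ∀ x, LinearMap.ker (ev x) = ⊥ := fun x => LinearMap.ker_eq_bot.2 (X.injective x)
  have hli : LinearIndependent ℝ fun i => X.χ (b i) p := b.linearIndependent.map' (ev p) (hev p)
  obtain ⟨f, hf⟩ := exists_smooth_coeffs C (fun i => X.χ (b i)) hli (w := w)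
    (Eventually.of_forall fun x => by
      obtain ⟨s, hs⟩ := hwχ x
      refine ⟨b.repr s, ?_⟩
      rw [← hs]
      change ev x s = ∑ i, b.repr s i • ev x (b i)
      simp only [← map_smul, ← map_sum]
      rw [b.sum_repr])
  -- Invariance of `w = ∑ f_i χ(b_i)`, read in `𝔰` through the injectivity of `χ` at `p`. Its `j`-th
  -- component, summed over `j`, gives `∑ χ(b_j) · f_j = ∑ f_i Tr ad_{b_i}`, which cancels `∑ f_i
  -- div χ(b_i)`.
  have h1 : ∀ j, ∑ i, (f i p • ⁅b j, b i⁆ + C.act (X.χ (b j)) (f i) p • b i) = 0 := fun j => by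
    have h2 := C.bracket_congr_right (X.χ (b j)) hf
    rw [hw, map_sum, sec_sum_apply, sec_zero_apply] at h2
    refine LinearMap.ker_eq_bot.1 (hev p) ?_
    rw [map_zero, map_sum, h2]
    refine Finset.sum_congr rfl fun i _ => ?_
    rw [C.bracket_mulSec, X.bracket, map_add, map_smul, map_smul]
    rfl
  have h3 : ∀ j, C.act (X.χ (b j)) (f j) p = ∑ i, f i p * b.repr ⁅b i, b j⁆ j := fun j => by
    have h4 := congrArg (fun z => b.repr z j) (h1 j)
    simp only [map_sum, map_add, map_smul, Finset.sum_add_distrib, Finsupp.add_apply,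
      Finsupp.smul_apply, Finsupp.finsetSum_apply, b.repr_self, map_zero, Finsupp.zero_apply,
      smul_eq_mul, Finsupp.single_apply, mul_ite, mul_one, mul_zero, Finset.sum_ite_eq',
      Finset.mem_univ, if_true] at h4
    rw [eq_neg_of_add_eq_zero_right h4, ← Finset.sum_neg_distrib]
    refine Finset.sum_congr rfl fun i _ => ?_
    rw [← lie_skew (b i) (b j), map_neg, Finsupp.neg_apply, mul_neg]
  have h5 : ∀ s : 𝔰, LinearMap.trace ℝ 𝔰 (LieAlgebra.ad ℝ 𝔰 s) = ∑ j, b.repr ⁅s, b j⁆ j := fun s => by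
    rw [LinearMap.trace_eq_matrix_trace ℝ b, Matrix.trace]
    refine Finset.sum_congr rfl fun j _ => ?_
    rw [Matrix.diag_apply, LinearMap.toMatrix_apply, LieAlgebra.ad_apply]
  rw [(D.congr hf).self_of_nhds, map_sum, smooth_sum_apply]
  have h6 : ∀ i, D.toLin (mulSec (f i) (X.χ (b i))) p =
      f i p * D.toLin (X.χ (b i)) p + C.act (X.χ (b i)) (f i) p := fun i => by
    rw [D.map_mulSec]
    rfl
  simp only [h6, hD.2, h5, h3, Finset.sum_add_distrib]
  rw [Finset.sum_comm, ← Finset.sum_add_distrib]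
  refine Finset.sum_eq_zero fun i _ => ?_
  rw [← Finset.mul_sum]
  ring

end EquivariantStructure

end Equivariant

/-! ### Descent of functions and lifting of sections along the quotient map. -/

section Reduction

variable {m d r : ℕ} {M N S 𝔰 : Type*}
  [TopologicalSpace M] [ChartedSpace (EuclideanSpace ℝ (Fin m)) M] [IsManifold (𝓡 m) ∞ M]
  [TopologicalSpace N] [ChartedSpace (EuclideanSpace ℝ (Fin d)) N] [IsManifold (𝓡 d) ∞ N]
  [TopologicalSpace S] [ChartedSpace (EuclideanSpace ℝ (Fin r)) S] [Group S] [MulAction S M]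
  [LieRing 𝔰] [LieAlgebra ℝ 𝔰]
  {F : Type*} [NormedAddCommGroup F] [NormedSpace ℝ F] [FiniteDimensional ℝ F]
  {E : M → Type*} [TopologicalSpace (TotalSpace F E)] [∀ x, TopologicalSpace (E x)]
  [∀ x, AddCommGroup (E x)] [∀ x, Module ℝ (E x)] [FiberBundle F E] [VectorBundle ℝ F E]
  {F₁ : Type*} [NormedAddCommGroup F₁] [NormedSpace ℝ F₁] [FiniteDimensional ℝ F₁]
  {E₁ : N → Type*} [TopologicalSpace (TotalSpace F₁ E₁)] [∀ x, TopologicalSpace (E₁ x)]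
  [∀ x, AddCommGroup (E₁ x)] [∀ x, Module ℝ (E₁ x)] [FiberBundle F₁ E₁] [VectorBundle ℝ F₁ E₁]
  [T2Space M] [T2Space N] [ContMDiffVectorBundle ∞ F E (𝓡 m)] [ContMDiffVectorBundle ∞ F₁ E₁ (𝓡 d)]
  {C : CourantAlgebroid m F E} {X : EquivariantStructure 𝔰 C} {C₁ : CourantAlgebroid d F₁ E₁}

/-- A function annihilated by the infinitesimal action is constant on the orbits of the connected
group `S`. -/
theorem IntegratesTo.eq_on_orbits [LieGroup (𝓡 r) ∞ S] [ConnectedSpace S]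
    [ContMDiffSMul (𝓡 r) (𝓡 m) ∞ S M] {Φ : 𝔰 ≃ₗ[ℝ] GroupLieAlgebra (𝓡 r) S}
    (hint : IntegratesTo X Φ) {h : C^∞⟮𝓡 m, M; ℝ⟯} (hh : ∀ s, C.act (X.χ s) h = 0) (g : S) (x : M) :
    h (g • x) = h x := by
  have hsm : ∀ y : M, ContMDiff (𝓡 r) (𝓡 m) ∞ fun k : S => k • y := fun y =>
    (contMDiff_smul (I := 𝓡 r) (I' := 𝓡 m) (n := ∞) (G := S) (M := M)).comp
      (contMDiff_id.prodMk contMDiff_const)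
  -- At the identity the orbit map has derivative `-ρ(χ(s))` in the direction of `s`, and these
  -- vectors annihilate `h`. Since `Φ` is onto, all directions are covered.
  have hone : ∀ y : M, mfderiv (𝓡 r) 𝓘(ℝ, ℝ) (fun k : S => h (k • y)) 1 = 0 := by
    intro y
    ext t
    have h1 := mfderiv_comp (I := 𝓡 r) (I' := 𝓡 m) (I'' := 𝓘(ℝ, ℝ)) (1 : S) (g := h)
      (f := fun k : S => k • y) (smooth_mdiff h _) ((hsm y).mdifferentiableAt (by simp))
    have h2 := congrFun (congrArg DFunLike.coe h1) (Φ (Φ.symm t))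
    have h3 : (mfderiv (𝓡 r) (𝓡 m) (fun k : S => k • y) 1 (Φ (Φ.symm t)) :
        EuclideanSpace ℝ (Fin m)) = -(C.anchor y (X.χ (Φ.symm t) y) : EuclideanSpace ℝ (Fin m)) := by
      have h4 := congrArg (fun v : EuclideanSpace ℝ (Fin m) => -v) (hint (Φ.symm t) y)
      exact ((neg_neg _).symm.trans h4.symm)
    have h5 : (mfderiv (𝓡 m) 𝓘(ℝ, ℝ) h ((1 : S) • y) : EuclideanSpace ℝ (Fin m) →L[ℝ] ℝ) =
        (mfderiv (𝓡 m) 𝓘(ℝ, ℝ) h y : EuclideanSpace ℝ (Fin m) →L[ℝ] ℝ) := by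
      have : ∀ z, z = y → (mfderiv (𝓡 m) 𝓘(ℝ, ℝ) h z : EuclideanSpace ℝ (Fin m) →L[ℝ] ℝ) =
          (mfderiv (𝓡 m) 𝓘(ℝ, ℝ) h y : EuclideanSpace ℝ (Fin m) →L[ℝ] ℝ) := by
        rintro z rfl
        rfl
      exact this _ (one_smul S y)
    have h6 : (mfderiv (𝓡 m) 𝓘(ℝ, ℝ) h y : EuclideanSpace ℝ (Fin m) →L[ℝ] ℝ)
        (C.anchor y (X.χ (Φ.symm t) y)) = 0 :=
      congrArg (fun φ : C^∞⟮𝓡 m, M; ℝ⟯ => φ y) (hh (Φ.symm t))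
    let L : EuclideanSpace ℝ (Fin m) →L[ℝ] ℝ := mfderiv (𝓡 m) 𝓘(ℝ, ℝ) h y
    let L₁ : EuclideanSpace ℝ (Fin m) →L[ℝ] ℝ := mfderiv (𝓡 m) 𝓘(ℝ, ℝ) h ((1 : S) • y)
    have h7 : L₁ (mfderiv (𝓡 r) (𝓡 m) (fun k : S => k • y) 1 (Φ (Φ.symm t))) = 0 :=
      (congrArg L₁ h3).trans ((congrFun (congrArg DFunLike.coe h5) _).trans
        ((L.map_neg _).trans ((congrArg Neg.neg h6).trans neg_zero)))
    rw [Φ.apply_symm_apply] at h2 h7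
    exact h2.trans h7
  have hz : ∀ k : S, mfderiv (𝓡 r) 𝓘(ℝ, ℝ) (fun k : S => h (k • x)) k = 0 := by
    intro k
    -- Right translation moves the point `k` to the identity at the cost of replacing `x` by `k •
    -- x`, where `hone` applies.
    have h1 : (fun k' : S => h (k' • x)) = (fun k' : S => h (k' • (k • x))) ∘ fun k' => k' * k⁻¹ := by
      funext k'
      simp [smul_smul]
    have h2 : MDifferentiableAt (𝓡 r) (𝓡 r) (fun k' : S => k' * k⁻¹) k :=
      (contMDiff_mul_right (I := 𝓡 r) (n := ∞) (a := k⁻¹)).mdifferentiableAt (by simp)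
    have h3 : MDifferentiableAt (𝓡 r) 𝓘(ℝ, ℝ) (fun k' : S => h (k' • (k • x))) (k * k⁻¹) :=
      (h.contMDiff.comp (hsm (k • x))).mdifferentiableAt (by simp)
    rw [h1, mfderiv_comp k h3 h2]
    have h4 : (mfderiv (𝓡 r) 𝓘(ℝ, ℝ) (fun k' : S => h (k' • (k • x))) (k * k⁻¹) :
        EuclideanSpace ℝ (Fin r) →L[ℝ] ℝ) = 0 := by
      have : ∀ a, a = 1 → (mfderiv (𝓡 r) 𝓘(ℝ, ℝ) (fun k' : S => h (k' • (k • x))) a :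
          EuclideanSpace ℝ (Fin r) →L[ℝ] ℝ) = 0 := by
        rintro a rfl
        exact hone (k • x)
      exact this _ (mul_inv_cancel k)
    ext t
    exact congrFun (congrArg DFunLike.coe h4) _
  have hlc := isLocallyConstant_of_mfderiv_eq_zero (φ := fun k : S => h (k • x))
    ((h.contMDiff.comp (hsm x)).mdifferentiable (by simp)) hz
  have := hlc.apply_eq_of_preconnectedSpace g 1
  simpa using this

/-- Smooth functions that are constant on the orbits descend to the quotient manifold. -/
theorem IsQuotientManifold.exists_descend {pr : M → N} (hpr : IsQuotientManifold m d S pr)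
    (h : C^∞⟮𝓡 m, M; ℝ⟯) (hinv : ∀ (g : S) x, h (g • x) = h x) :
    ∃ h₁ : C^∞⟮𝓡 d, N; ℝ⟯, ∀ x, h₁ (pr x) = h x := by
  have hw : ∀ x y, pr x = pr y → h x = h y := fun x y hxy => by
    obtain ⟨g, rfl⟩ := (hpr.fibre x y).1 hxy
    exact (hinv g x).symm
  -- A mere set-theoretic section. The function defined with it is smooth because near each point it
  -- may be computed with a smooth local section, as `h` is constant on fibres.
  let s := Function.surjInv hpr.surjective
  have hs : ∀ y, pr (s y) = y := Function.surjInv_eq hpr.surjective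
  refine ⟨⟨fun y => h (s y), fun y => ?_⟩, fun x => hw _ _ (hs _)⟩
  obtain ⟨σ, hσ, -, hσ'⟩ := exists_local_section (hpr.submersion.isSubmersionAt (s y))
  rw [hs] at hσ hσ'
  refine (h.contMDiff.contMDiffAt.comp y hσ).congr_of_eventuallyEq ?_
  filter_upwards [hσ'] with z hz
  exact hw _ _ ((hs z).trans hz.symm)

/-- The projection to the quotient manifold as a smooth map. -/
def IsQuotientManifold.toMap {pr : M → N} (hpr : IsQuotientManifold m d S pr) :
    ContMDiffMap (𝓡 m) (𝓡 d) M N ∞ := ⟨pr, hpr.submersion.contMDiff⟩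

namespace CAReduction

variable {pr : M → N} (Q : CAReduction X pr C₁)

/-- The invariant section `u` of `𝔰_E^⊥` descends to the section `v` of the reduced bundle. -/
def Lifts (u : Sec m F E) (v : Sec d F₁ E₁) : Prop :=
  ∃ hu : X.InvPerp u, ∀ x, Q.q x ⟨u x, hu.1 x⟩ = v (pr x)

variable {Q}

theorem q_χ (Q : CAReduction X pr C₁) (s : 𝔰) (x : M) :
    Q.q x ⟨X.χ s x, fun t => X.isotropic t s x⟩ = 0 := (Q.q_ker x _).2 ⟨s, rfl⟩

theorem mfderiv_anchor_χ (Q : CAReduction X pr C₁) (s : 𝔰) (x : M) :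
    mfderiv (𝓡 m) (𝓡 d) pr x (C.anchor x (X.χ s x)) = 0 := by
  rw [← Q.anchor x ⟨X.χ s x, fun t => X.isotropic t s x⟩, Q.q_χ, map_zero]

theorem Lifts.pairing {u u' : Sec m F E} {v v' : Sec d F₁ E₁} (h : Q.Lifts u v) (h' : Q.Lifts u' v')
    (x : M) : C.pairing x (u x) (u' x) = C₁.pairing (pr x) (v (pr x)) (v' (pr x)) := by
  obtain ⟨hu, h⟩ := h
  obtain ⟨hu', h'⟩ := h'
  rw [← h, ← h', Q.pairing]

theorem Lifts.add {u u' : Sec m F E} {v v' : Sec d F₁ E₁} (h : Q.Lifts u v) (h' : Q.Lifts u' v') :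
    Q.Lifts (u + u') (v + v') := by
  obtain ⟨hu, h⟩ := h
  obtain ⟨hu', h'⟩ := h'
  refine ⟨hu.add hu', fun x => ?_⟩
  exact ((Q.q x).map_add ⟨u x, hu.1 x⟩ ⟨u' x, hu'.1 x⟩).trans (congrArg₂ (· + ·) (h x) (h' x))

theorem Lifts.sub {u u' : Sec m F E} {v v' : Sec d F₁ E₁} (h : Q.Lifts u v) (h' : Q.Lifts u' v') :
    Q.Lifts (u - u') (v - v') := by
  obtain ⟨hu, h⟩ := h
  obtain ⟨hu', h'⟩ := h'
  refine ⟨hu.sub hu', fun x => ?_⟩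
  exact ((Q.q x).map_sub ⟨u x, hu.1 x⟩ ⟨u' x, hu'.1 x⟩).trans (congrArg₂ (· - ·) (h x) (h' x))

theorem Lifts.smul {u : Sec m F E} {v : Sec d F₁ E₁} (h : Q.Lifts u v) (c : ℝ) :
    Q.Lifts (c • u) (c • v) := by
  obtain ⟨hu, h⟩ := h
  refine ⟨hu.smul c, fun x => ?_⟩
  exact ((Q.q x).map_smul c ⟨u x, hu.1 x⟩).trans (congrArg (c • ·) (h x))

theorem Lifts.bracket {u u' : Sec m F E} {v v' : Sec d F₁ E₁} (h : Q.Lifts u v)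
    (h' : Q.Lifts u' v') : Q.Lifts (C.bracket u u') (C₁.bracket v v') := by
  obtain ⟨hu, h⟩ := h
  obtain ⟨hu', h'⟩ := h'
  have hb := Q.bracket u u' v v' hu hu' h h'
  exact ⟨hu.bracket hu' fun x => (hb x).1, fun x => (hb x).2⟩

/-- The anchor of a lift projects to the anchor of the reduced section, so the chain rule applies.
-/
theorem Lifts.act {u : Sec m F E} {v : Sec d F₁ E₁} (h : Q.Lifts u v)
    (hpr : IsQuotientManifold m d S pr) (f : C^∞⟮𝓡 d, N; ℝ⟯) :
    C.act u (f.comp hpr.toMap) = (C₁.act v f).comp hpr.toMap := by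
  obtain ⟨hu, h⟩ := h
  ext x
  have h1 : CourantT.deriveAlong (C.anchor x (u x)) (f ∘ pr) =
      CourantT.deriveAlong (mfderiv (𝓡 m) (𝓡 d) pr x (C.anchor x (u x))) f :=
    deriveAlong_comp _ (smooth_mdiff f _)
      ((hpr.submersion.contMDiff x).mdifferentiableAt (by simp))
  have h2 := Q.anchor x ⟨u x, hu.1 x⟩
  rw [h] at h2
  rw [← h2] at h1
  exact h1

theorem act_χ_comp (Q : CAReduction X pr C₁) (hpr : IsQuotientManifold m d S pr)
    (f : C^∞⟮𝓡 d, N; ℝ⟯) (s : 𝔰) : C.act (X.χ s) (f.comp hpr.toMap) = 0 := by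
  ext x
  have h1 : CourantT.deriveAlong (C.anchor x (X.χ s x)) (f ∘ pr) =
      CourantT.deriveAlong (mfderiv (𝓡 m) (𝓡 d) pr x (C.anchor x (X.χ s x))) f :=
    deriveAlong_comp _ (smooth_mdiff f _)
      ((hpr.submersion.contMDiff x).mdifferentiableAt (by simp))
  rw [Q.mfderiv_anchor_χ, deriveAlong_zero_vec] at h1
  exact h1

theorem Lifts.mulSec {u : Sec m F E} {v : Sec d F₁ E₁} (h : Q.Lifts u v)
    (hpr : IsQuotientManifold m d S pr) (f : C^∞⟮𝓡 d, N; ℝ⟯) :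
    Q.Lifts (mulSec (f.comp hpr.toMap) u) (mulSec f v) := by
  obtain ⟨hu, h⟩ := h
  refine ⟨hu.mulSec (Q.act_χ_comp hpr f), fun x => ?_⟩
  exact ((Q.q x).map_smul (f (pr x)) ⟨u x, hu.1 x⟩).trans (congrArg (f (pr x) • ·) (h x))

theorem exists_lifts (Q : CAReduction X pr C₁) (v : Sec d F₁ E₁) : ∃ u, Q.Lifts u v := by
  obtain ⟨u, hu, h⟩ := Q.lift v
  exact ⟨u, hu, h⟩

theorem exists_lifted (Q : CAReduction X pr C₁) {u : Sec m F E} (hu : X.InvPerp u) :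
    ∃ v, Q.Lifts u v := by
  obtain ⟨v, h⟩ := Q.descend u hu
  exact ⟨v, hu, h⟩

end CAReduction

end Reduction

/-! ### Existence of the reduced generalized pseudometric and the reduced divergence. -/

section ReducedStructures

variable {m d r : ℕ} {M N S 𝔰 : Type*}
  [TopologicalSpace M] [ChartedSpace (EuclideanSpace ℝ (Fin m)) M] [IsManifold (𝓡 m) ∞ M]
  [TopologicalSpace N] [ChartedSpace (EuclideanSpace ℝ (Fin d)) N] [IsManifold (𝓡 d) ∞ N]
  [TopologicalSpace S] [ChartedSpace (EuclideanSpace ℝ (Fin r)) S] [Group S] [MulAction S M]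
  [LieRing 𝔰] [LieAlgebra ℝ 𝔰]
  {F : Type*} [NormedAddCommGroup F] [NormedSpace ℝ F] [FiniteDimensional ℝ F]
  {E : M → Type*} [TopologicalSpace (TotalSpace F E)] [∀ x, TopologicalSpace (E x)]
  [∀ x, AddCommGroup (E x)] [∀ x, Module ℝ (E x)] [FiberBundle F E] [VectorBundle ℝ F E]
  {F₁ : Type*} [NormedAddCommGroup F₁] [NormedSpace ℝ F₁] [FiniteDimensional ℝ F₁]
  {E₁ : N → Type*} [TopologicalSpace (TotalSpace F₁ E₁)] [∀ x, TopologicalSpace (E₁ x)]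
  [∀ x, AddCommGroup (E₁ x)] [∀ x, Module ℝ (E₁ x)] [FiberBundle F₁ E₁] [VectorBundle ℝ F₁ E₁]
  [T2Space M] [T2Space N] [ContMDiffVectorBundle ∞ F E (𝓡 m)] [ContMDiffVectorBundle ∞ F₁ E₁ (𝓡 d)]
  {C : CourantAlgebroid m F E} {X : EquivariantStructure 𝔰 C} {C₁ : CourantAlgebroid d F₁ E₁}

  {pr : M → N} {Q : CAReduction X pr C₁} {V : GenPseudometric C}

namespace CAReduction

/-- The two vectors differ by an element of `𝔰_E`. As `V₊ ⊂ 𝔰_E^⊥`, that element is orthogonal to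
`V₊` and disappears under the projection. In particular the quotient map is injective on `V₊`. -/
theorem plus_eq_of_q_eq (hV : X.Admissible V) {x : M} {u z : X.perp x} (hz : (z : E x) ∈ V.plus x)
    (h : Q.q x u = Q.q x z) : V.proj x u = z := by
  have h1 : Q.q x (u - z) = 0 := by rw [map_sub, h, sub_self]
  obtain ⟨s, hs⟩ := (Q.q_ker x _).1 h1
  have h2 : V.proj x ((u : E x) - z) = 0 := by
    refine GenPseudometric.proj_of_mem_minus V ((GenPseudometric.mem_minus_iff V).2 fun y hy => ?_)
    have h3 := hV.2 x hy s
    rw [hs, C.pairing_symm] at h3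
    exact h3
  rwa [map_sub, GenPseudometric.proj_of_mem V hz, sub_eq_zero] at h2

theorem eq_zero_of_mem_plus (hV : X.Admissible V) {x : M} {z : X.perp x} (hz : (z : E x) ∈ V.plus x)
    (h : Q.q x z = 0) : (z : E x) = 0 := by
  have := plus_eq_of_q_eq (Q := Q) hV (u := 0) hz (by rw [h, map_zero])
  simpa using this.symm

/-- An arbitrary reduced section through the class of `z` is lifted and projected to `V₊`; the
projection stays invariant and takes the value `z` at `x`. -/
theorem exists_plusLift (hV : X.Admissible V) {x : M} {z : X.perp x} (hz : (z : E x) ∈ V.plus x) :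
    ∃ u v, Q.Lifts u v ∧ V.IsPlus u ∧ u x = z ∧ v (pr x) = Q.q x z := by
  obtain ⟨v, hv⟩ := exists_section_through (n := d) (F := F₁) (pr x) (Q.q x z)
  obtain ⟨u, hu, huv⟩ := Q.exists_lifts v
  obtain ⟨v', hv'⟩ := Q.exists_lifted (hu.plusSec hV)
  have h1 : V.plusSec u x = z := plus_eq_of_q_eq (Q := Q) hV (u := ⟨u x, hu.1 x⟩) hz
    ((huv x).trans hv)
  refine ⟨V.plusSec u, v', hv', V.isPlus_plusSec u, h1, ?_⟩
  obtain ⟨hu', h2⟩ := hv'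
  rw [← h2]
  exact congrArg (Q.q x) (Subtype.ext h1)

variable (Q V) in
/-- The fibres of the generalized pseudometric to which `V₊` descends. -/
def reducedPlus (y : N) : Submodule ℝ (E₁ y) where
  carrier := {w | ∃ u v, Q.Lifts u v ∧ V.IsPlus u ∧ v y = w}
  add_mem' := by
    rintro _ _ ⟨u, v, h, hu, rfl⟩ ⟨u', v', h', hu', rfl⟩
    exact ⟨_, _, h.add h', fun x => (V.plus x).add_mem (hu x) (hu' x), rfl⟩
  zero_mem' := by
    obtain ⟨v, hv⟩ := Q.exists_lifts (0 : Sec d F₁ E₁)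
    refine ⟨0, 0, ?_, fun x => (V.plus x).zero_mem, rfl⟩
    simpa using hv.smul 0
  smul_mem' := by
    rintro c _ ⟨u, v, h, hu, rfl⟩
    exact ⟨_, _, h.smul c, fun x => (V.plus x).smul_mem c (hu x), rfl⟩

theorem reducedPlus_eq (hV : X.Admissible V) (x : M) :
    Q.reducedPlus V (pr x) = ((V.plus x).comap (X.perp x).subtype).map (Q.q x) := by
  ext w
  constructor
  · rintro ⟨u, v, ⟨hu, h⟩, hp, rfl⟩
    exact ⟨⟨u x, hu.1 x⟩, hp x, h x⟩
  · rintro ⟨z, hz, rfl⟩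
    obtain ⟨u, v, h, hu, -, hv⟩ := exists_plusLift (Q := Q) hV (z := z) hz
    exact ⟨u, v, h, hu, hv⟩

theorem finrank_reducedPlus (hV : X.Admissible V) (x : M) :
    finrank ℝ (Q.reducedPlus V (pr x)) = finrank ℝ (V.plus x) := by
  rw [reducedPlus_eq hV]
  let L : V.plus x →ₗ[ℝ] E₁ (pr x) := Q.q x ∘ₗ Submodule.inclusion (hV.2 x)
  have h1 : ((V.plus x).comap (X.perp x).subtype).map (Q.q x) = LinearMap.range L := by
    ext w
    constructor
    · rintro ⟨z, hz, rfl⟩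
      exact ⟨⟨z, hz⟩, rfl⟩
    · rintro ⟨z, rfl⟩
      exact ⟨⟨z, hV.2 x z.2⟩, z.2, rfl⟩
  rw [h1]
  refine LinearMap.finrank_range_of_inj ?_
  rw [← LinearMap.ker_eq_bot, LinearMap.ker_eq_bot']
  intro z hz
  exact Subtype.ext (eq_zero_of_mem_plus (Q := Q) hV (z := ⟨z, hV.2 x z.2⟩) z.2 hz)

theorem reducedPlus_nondeg (hV : X.Admissible V) (hpr : IsQuotientManifold m d S pr) (y : N) :
    ∀ v ∈ Q.reducedPlus V y, (∀ w ∈ Q.reducedPlus V y, C₁.pairing y v w = 0) → v = 0 := by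
  obtain ⟨x, rfl⟩ := hpr.surjective y
  rw [reducedPlus_eq hV]
  rintro _ ⟨z, hz, rfl⟩ h0
  have h1 : (z : E x) = 0 := V.nondeg x z hz fun w hw => by
    have := h0 _ ⟨⟨w, hV.2 x hw⟩, hw, rfl⟩
    rwa [Q.pairing] at this
  rw [show z = 0 from Subtype.ext h1, map_zero]

/-- Reduced sections coming from `V₊` through an orthonormal basis at one point are orthonormalized
nearby. They span because the rank is locally constant: a local section of the projection transports
this property from `V₊` on `M` to `N`. -/
theorem isSubbundle_reducedPlus (hV : X.Admissible V) (hpr : IsQuotientManifold m d S pr) :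
    IsSubbundle d F₁ (Q.reducedPlus V) := by
  intro y
  have hfd := VectorBundle.finiteDimensional ℝ F₁ E₁
  obtain ⟨x, rfl⟩ := hpr.surjective y
  obtain ⟨w, η, hw, hη, hwp⟩ := exists_orthonormal_family (C₁.pairing (pr x))
    (C₁.pairing_symm (pr x)) (Q.reducedPlus V (pr x)) (reducedPlus_nondeg hV hpr (pr x))
  choose u v huv hu hv using hw
  obtain ⟨t, htp, ht, hspan⟩ := exists_gramSchmidt C₁ (pr x) v η hη
    fun i j => by rw [hv, hv]; exact hwp i j
  have hmem : ∀ y i, t i y ∈ Q.reducedPlus V y := fun y i => by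
    refine (Submodule.span_le.2 ?_) (hspan y i)
    rintro _ ⟨j, rfl⟩
    exact ⟨u j, v j, huv j, hu j, rfl⟩
  obtain ⟨σ, hσ, hσx, hσ'⟩ := exists_local_section (hpr.submersion.isSubmersionAt x)
  obtain ⟨k, s, θ, hs, -⟩ := V.exists_ONFrame_plus x
  have hc : Tendsto σ (𝓝 (pr x)) (𝓝 x) := by
    have := hσ.continuousAt.tendsto
    rwa [hσx] at this
  have hON : IsONFrame C₁ (Q.reducedPlus V) (pr x) t η := by
    refine isONFrame_of_complete hη ht (Eventually.of_forall hmem) ?_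
    filter_upwards [ht, hσ', hc.eventually hs.eventually] with z hz hσz hsz v hv h0
    refine complete_of_finrank (C₁.pairing z) (C₁.pairing_symm z) (reducedPlus_nondeg hV hpr z) hη hz
      (hmem z) ?_ hv h0
    rw [← hσz, finrank_reducedPlus hV, finrank_reducedPlus hV, hsz.finrank_eq, hs.finrank_eq]
  exact ⟨_, t, hON.linearIndependent.and hON.span⟩

theorem exists_isReducedMetric (hV : X.Admissible V) (hpr : IsQuotientManifold m d S pr) :
    ∃ V₁ : GenPseudometric C₁, Q.IsReducedMetric V V₁ :=
  ⟨⟨Q.reducedPlus V, isSubbundle_reducedPlus hV hpr, reducedPlus_nondeg hV hpr⟩, reducedPlus_eq hV⟩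

/-- The divergence of a lift is annihilated by `𝔰`, hence descends by `hinv`. Two lifts differ by an
invariant section of `𝔰_E`, on which the divergence vanishes, so the result depends only on the
reduced section. -/
theorem exists_isReducedDiv [FiniteDimensional ℝ 𝔰] {D : Divergence C} (hD : X.IsEquivariantDiv D)
    (hpr : IsQuotientManifold m d S pr)
    (hinv : ∀ h : C^∞⟮𝓡 m, M; ℝ⟯, (∀ s, C.act (X.χ s) h = 0) → ∀ (g : S) x, h (g • x) = h x) :
    ∃ D₁ : Divergence C₁, Q.IsReducedDiv D D₁ := by
  have hex : ∀ v : Sec d F₁ E₁, ∃ f : C^∞⟮𝓡 d, N; ℝ⟯, ∀ u, Q.Lifts u v →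
      ∀ x, f (pr x) = D.toLin u x := by
    intro v
    obtain ⟨u, hu⟩ := Q.exists_lifts v
    obtain ⟨f, hf⟩ := hpr.exists_descend (D.toLin u) (hinv _ (hD.act_eq_zero hu.1))
    refine ⟨f, fun u' hu' x => ?_⟩
    obtain ⟨hi, h0⟩ := hu.sub hu'
    have h1 : D.toLin (u - u') = 0 := hD.eq_zero hi.2 fun y =>
      (Q.q_ker y ⟨(u - u') y, hi.1 y⟩).1 (by rw [h0, sub_self, sec_zero_apply])
    rw [map_sub, sub_eq_zero] at h1
    rw [hf, h1]
  choose φ hφ using hex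
  refine ⟨⟨⟨⟨φ, fun v v' => ?_⟩, fun c v => ?_⟩, fun f v y => ?_⟩, fun u hu v h x => ?_⟩
  · ext y
    obtain ⟨x, rfl⟩ := hpr.surjective y
    obtain ⟨u, hu⟩ := Q.exists_lifts v
    obtain ⟨u', hu'⟩ := Q.exists_lifts v'
    rw [hφ _ _ (hu.add hu'), map_add]
    exact congrArg₂ (· + ·) (hφ _ _ hu x).symm (hφ _ _ hu' x).symm
  · ext y
    obtain ⟨x, rfl⟩ := hpr.surjective y
    obtain ⟨u, hu⟩ := Q.exists_lifts v
    rw [hφ _ _ (hu.smul c), map_smul]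
    exact congrArg (c * ·) (hφ _ _ hu x).symm
  · obtain ⟨x, rfl⟩ := hpr.surjective y
    obtain ⟨u, hu⟩ := Q.exists_lifts v
    change φ (CourantT.mulSec f v) (pr x) = f (pr x) * φ v (pr x) + C₁.act v f (pr x)
    rw [hφ _ _ (hu.mulSec hpr f), D.map_mulSec, hu.act hpr, hφ _ _ hu]
    rfl
  · exact hφ v u ⟨hu, h⟩ x

end CAReduction

end ReducedStructures

/-! ### Curvatures of the reduction in terms of lifts. -/

section ReducedEquations

variable {m d r : ℕ} {M N S 𝔰 : Type*}
  [TopologicalSpace M] [ChartedSpace (EuclideanSpace ℝ (Fin m)) M] [IsManifold (𝓡 m) ∞ M]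
  [TopologicalSpace N] [ChartedSpace (EuclideanSpace ℝ (Fin d)) N] [IsManifold (𝓡 d) ∞ N]
  [TopologicalSpace S] [ChartedSpace (EuclideanSpace ℝ (Fin r)) S] [Group S] [MulAction S M]
  [LieRing 𝔰] [LieAlgebra ℝ 𝔰]
  {F : Type*} [NormedAddCommGroup F] [NormedSpace ℝ F] [FiniteDimensional ℝ F]
  {E : M → Type*} [TopologicalSpace (TotalSpace F E)] [∀ x, TopologicalSpace (E x)]
  [∀ x, AddCommGroup (E x)] [∀ x, Module ℝ (E x)] [FiberBundle F E] [VectorBundle ℝ F E]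
  {F₁ : Type*} [NormedAddCommGroup F₁] [NormedSpace ℝ F₁] [FiniteDimensional ℝ F₁]
  {E₁ : N → Type*} [TopologicalSpace (TotalSpace F₁ E₁)] [∀ x, TopologicalSpace (E₁ x)]
  [∀ x, AddCommGroup (E₁ x)] [∀ x, Module ℝ (E₁ x)] [FiberBundle F₁ E₁] [VectorBundle ℝ F₁ E₁]
  [T2Space M] [T2Space N] [ContMDiffVectorBundle ∞ F E (𝓡 m)] [ContMDiffVectorBundle ∞ F₁ E₁ (𝓡 d)]
  {C : CourantAlgebroid m F E} {X : EquivariantStructure 𝔰 C} {C₁ : CourantAlgebroid d F₁ E₁}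

  {pr : M → N} {Q : CAReduction X pr C₁} {V : GenPseudometric C}

namespace CAReduction

variable {V₁ : GenPseudometric C₁} (hV : X.Admissible V) (hV₁ : Q.IsReducedMetric V V₁)
include hV hV₁

/-- The quotient map preserves pairings and carries `V₊` onto the reduced `V₊`, and these properties
characterize the orthogonal projection. -/
theorem q_proj {x : M} (w : X.perp x) :
    Q.q x ⟨V.proj x w, hV.2 x (V.proj_mem x w)⟩ = V₁.proj (pr x) (Q.q x w) := by
  refine (V₁.proj_eq ?_ fun z hz => ?_).symm
  · rw [hV₁]
    exact ⟨⟨V.proj x w, _⟩, V.proj_mem x w, rfl⟩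
  · rw [hV₁] at hz
    obtain ⟨z, hz, rfl⟩ := hz
    rw [Q.pairing, Q.pairing]
    exact (V.pairing_proj hz _).symm

theorem Lifts.plusSec {u : Sec m F E} {v : Sec d F₁ E₁} (h : Q.Lifts u v) :
    Q.Lifts (V.plusSec u) (V₁.plusSec v) := by
  obtain ⟨hu, h⟩ := h
  refine ⟨hu.plusSec hV, fun x => ?_⟩
  rw [V₁.plusSec_apply, ← h]
  exact q_proj hV hV₁ ⟨u x, hu.1 x⟩

theorem Lifts.minusSec {u : Sec m F E} {v : Sec d F₁ E₁} (h : Q.Lifts u v) :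
    Q.Lifts (V.minusSec u) (V₁.minusSec v) := h.sub (h.plusSec hV hV₁)

theorem Lifts.ricOp {a b u : Sec m F E} {a₁ b₁ v : Sec d F₁ E₁} (ha : Q.Lifts a a₁)
    (hb : Q.Lifts b b₁) (h : Q.Lifts u v) : Q.Lifts (V.ricOp a b u) (V₁.ricOp a₁ b₁ v) :=
  (((h.bracket hb).minusSec hV hV₁).bracket ha).plusSec hV hV₁

theorem exists_lifts_plus {v : Sec d F₁ E₁} (hv : V₁.IsPlus v) :
    ∃ u, Q.Lifts u v ∧ V.IsPlus u := by
  obtain ⟨u, hu⟩ := Q.exists_lifts v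
  have := hu.plusSec hV hV₁
  rw [hv.plusSec_eq] at this
  exact ⟨_, this, V.isPlus_plusSec u⟩

theorem exists_lifts_minus {v : Sec d F₁ E₁} (hv : V₁.IsMinus v) :
    ∃ u, Q.Lifts u v ∧ V.IsMinus u := by
  obtain ⟨u, hu⟩ := Q.exists_lifts v
  have := hu.minusSec hV hV₁
  rw [hv.minusSec_eq] at this
  exact ⟨_, this, V.isMinus_minusSec u⟩

/-- Pairings of lifts agree with those below. A vector of `V₊` orthogonal to the lifts has zero
image in the reduced bundle, hence is zero by injectivity on `V₊`. -/
theorem isONFrame_lift (hpr : IsQuotientManifold m d S pr) {x : M} {k : ℕ} {e : Fin k → Sec m F E}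
    {ε : Fin k → Sec d F₁ E₁} {η : Fin k → ℝ} (h : IsONFrame C₁ V₁.plus (pr x) ε η)
    (he : ∀ i, Q.Lifts (e i) (ε i)) (he' : ∀ i, V.IsPlus (e i)) : IsONFrame C V.plus x e η := by
  have hc := hpr.submersion.contMDiff.continuous.continuousAt (x := x)
  refine isONFrame_of_complete h.sq ?_ (Eventually.of_forall fun y i => he' i y) ?_
  · filter_upwards [hc.eventually h.pairing] with y hy i j
    rw [(he i).pairing (he j), hy]
  · filter_upwards [hc.eventually h.expand] with y hy v hv h0
    refine eq_zero_of_mem_plus (Q := Q) hV (z := ⟨v, hV.2 y hv⟩) hv ?_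
    rw [hy (Q.q y ⟨v, hV.2 y hv⟩) (by rw [hV₁]; exact ⟨⟨v, hV.2 y hv⟩, hv, rfl⟩)]
    refine Finset.sum_eq_zero fun i _ => ?_
    obtain ⟨hi, hq⟩ := he i
    rw [← hq, Q.pairing]
    change (η i * C.pairing y (e i y) v) • _ = _
    rw [h0, mul_zero, zero_smul]

variable {D : Divergence C} {D₁ : Divergence C₁} (hD : Q.IsReducedDiv D D₁)
include hD

omit hV hV₁ in
theorem Lifts.div {u : Sec m F E} {v : Sec d F₁ E₁} (h : Q.Lifts u v)
    (hpr : IsQuotientManifold m d S pr) : D.toLin u = (D₁.toLin v).comp hpr.toMap := by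
  ext x
  exact (hD u h.1 v h.2 x).symm

omit hV hV₁ in
theorem scalarON_lift (hpr : IsQuotientManifold m d S pr) {x : M} {k : ℕ} {e : Fin k → Sec m F E}
    {ε : Fin k → Sec d F₁ E₁} (he : ∀ i, Q.Lifts (e i) (ε i)) (η : Fin k → ℝ) :
    scalarON D e η x = scalarON D₁ ε η (pr x) := by
  have h1 : ∀ i, D.toLin (e i) = (D₁.toLin (ε i)).comp hpr.toMap := fun i => (he i).div hD hpr
  have h2 : ∀ i, C.act (e i) (D.toLin (e i)) = (C₁.act (ε i) (D₁.toLin (ε i))).comp hpr.toMap :=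
    fun i => by rw [h1, (he i).act hpr]
  unfold scalarON
  simp only [h2, ((he _).bracket (he _)).pairing (he _), ((he _).bracket (he _)).pairing
    ((he _).bracket (he _))]
  simp only [h1]
  rfl

theorem GRic_lift (hpr : IsQuotientManifold m d S pr) {a b : Sec m F E} {a₁ b₁ : Sec d F₁ E₁}
    (ha : Q.Lifts a a₁) (hb : Q.Lifts b b₁) (hap : V.IsPlus a) (hbm : V.IsMinus b)
    (hap₁ : V₁.IsPlus a₁) (hbm₁ : V₁.IsMinus b₁) (x : M) :
    V.GRic D a b x = V₁.GRic D₁ a₁ b₁ (pr x) := by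
  obtain ⟨k, ε, η, hε, hε'⟩ := V₁.exists_ONFrame_plus (pr x)
  choose e he he' using fun i => exists_lifts_plus hV hV₁ (hε' i)
  rw [V.GRic_eq (isONFrame_lift hV hV₁ hpr hε he he') he' D hap hbm, V₁.GRic_eq hε hε' D₁ hap₁ hbm₁]
  have h1 : C.act b (D.toLin a) = (C₁.act b₁ (D₁.toLin a₁)).comp hpr.toMap := by
    rw [ha.div hD hpr, hb.act hpr]
  rw [((hb.bracket ha).plusSec hV hV₁).div hD hpr, h1]
  simp only [fun i => (he i).pairing (ha.ricOp hV hV₁ hb (he i)) x]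
  rfl

/-- Surjectivity of the projection places every point below some `x`, and lifting identifies both
reduced curvatures there with curvatures at `x` that vanish by hypothesis. -/
theorem stringBackground (hpr : IsQuotientManifold m d S pr)
    (hG : ∀ a b, V.IsPlus a → V.IsMinus b → ∀ x, V.GRic D a b x = 0)
    (hR : ∀ (x : M) (k : ℕ) (e : Fin k → Sec m F E) (η : Fin k → ℝ), IsONFrame C V.plus x e η →
      scalarON D e η x = 0) : StringBackground V₁ D₁ := by
  refine ⟨fun a₁ b₁ ha₁ hb₁ y => ?_, GenPseudometric.isScalarCurvature_zero fun y k ε η hε => ?_⟩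
  · obtain ⟨x, rfl⟩ := hpr.surjective y
    obtain ⟨a, ha, ha'⟩ := exists_lifts_plus hV hV₁ ha₁
    obtain ⟨b, hb, hb'⟩ := exists_lifts_minus hV hV₁ hb₁
    rw [← GRic_lift hV hV₁ hD hpr ha hb ha' hb' ha₁ hb₁]
    exact hG a b ha' hb' x
  · obtain ⟨x, rfl⟩ := hpr.surjective y
    -- The given frame lies in `V₊` only near the point, while lifts to `V₊` exist for global
    -- sections of it. Projection fixes this without changing the frame near the point.
    have h1 : ∀ᶠ z in 𝓝 (pr x), ∀ i, V₁.plusSec (ε i) z = ε i z := by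
      filter_upwards [hε.mem] with z hz i
      exact V₁.proj_of_mem (hz i)
    choose e he he' using fun i => exists_lifts_plus hV hV₁ (V₁.isPlus_plusSec (ε i))
    rw [← scalarON_congr D₁ η h1, ← scalarON_lift hD hpr he η]
    exact hR x k e η (isONFrame_lift hV hV₁ hpr (hε.congr h1) he he')

end CAReduction

end ReducedEquations

/-! ### Scalar curvature of the pullback in arbitrary orthonormal frames. -/

section PullbackScalar

variable {n m : ℕ} {M M' : Type*}
  [TopologicalSpace M] [ChartedSpace (EuclideanSpace ℝ (Fin n)) M] [IsManifold (𝓡 n) ∞ M]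
  [TopologicalSpace M'] [ChartedSpace (EuclideanSpace ℝ (Fin m)) M'] [IsManifold (𝓡 m) ∞ M']
  {F : Type*} [NormedAddCommGroup F] [NormedSpace ℝ F] [FiniteDimensional ℝ F]
  {E : M → Type*} [TopologicalSpace (TotalSpace F E)] [∀ x, TopologicalSpace (E x)]
  [∀ x, AddCommGroup (E x)] [∀ x, Module ℝ (E x)] [FiberBundle F E] [VectorBundle ℝ F E]
  {τ : ContMDiffMap (𝓡 m) (𝓡 n) M' M ∞}
  {C : CourantAlgebroid n F E} {C' : CourantAlgebroid m F ((τ : M' → M) *ᵖ E)}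
  [T2Space M] [T2Space M'] [ContMDiffVectorBundle ∞ F E (𝓡 n)]

/-- The fibre of `τ^* V₊` at `x` is that of `V₊` at `τ x`, so there is an orthonormal frame on `M`
whose pullback takes the given values at `x`. Frame independence then replaces the given frame by
the pulled back one. -/
theorem IsCAPullback.scalarON_eq_zero (H : IsCAPullback τ C C') {V : GenPseudometric C}
    {D : Divergence C} {D' : Divergence C'} (hD : IsPullbackDiv D D')
    (hR : IsScalarCurvature V D fun _ => 0) {x : M'} {k : ℕ}
    {e : Fin k → Sec m F ((τ : M' → M) *ᵖ E)} {η : Fin k → ℝ}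
    (he : IsONFrame C' (H.pullMetric V).plus x e η) : scalarON D' e η x = 0 := by
  have hk : k = finrank ℝ (V.plus (τ x)) := he.finrank_eq.symm
  obtain ⟨s, hsx, hs⟩ := exists_ONFrame C V.subbundle V.nondeg (τ x) hk (fun i => e i x) η
    he.mem.self_of_nhds he.sq fun i j =>
      (H.pairing x (e i x) (e j x)).symm.trans (he.pairing.self_of_nhds i j)
  rw [scalarON_eq D' (H.isONFrame_pull hs) he fun i => (hsx i).symm, H.scalarON_pull hD]
  exact GenPseudometric.scalarON_eq_zero hR hs

end PullbackScalar

end CourantT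

end

open CourantT in
theorem mainTheorem7
    {n m d r : ℕ}
    -- the manifolds `M`, `M'` and `M'_red`
    {M : Type*} [TopologicalSpace M] [ChartedSpace (EuclideanSpace ℝ (Fin n)) M]
    [IsManifold (𝓡 n) ∞ M] [T2Space M] [SecondCountableTopology M]
    {M' : Type*} [TopologicalSpace M'] [ChartedSpace (EuclideanSpace ℝ (Fin m)) M']
    [IsManifold (𝓡 m) ∞ M'] [T2Space M'] [SecondCountableTopology M']
    {N : Type*} [TopologicalSpace N] [ChartedSpace (EuclideanSpace ℝ (Fin d)) N]
    [IsManifold (𝓡 d) ∞ N] [T2Space N] [SecondCountableTopology N]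
    -- the vector bundles `E → M` and `E'_red → M'_red`
    {F : Type*} [NormedAddCommGroup F] [NormedSpace ℝ F] [FiniteDimensional ℝ F]
    {E : M → Type*} [TopologicalSpace (TotalSpace F E)] [∀ x, TopologicalSpace (E x)]
    [∀ x, AddCommGroup (E x)] [∀ x, Module ℝ (E x)] [FiberBundle F E] [VectorBundle ℝ F E]
    [ContMDiffVectorBundle ∞ F E (𝓡 n)]
    {F₁ : Type*} [NormedAddCommGroup F₁] [NormedSpace ℝ F₁] [FiniteDimensional ℝ F₁]
    {E₁ : N → Type*} [TopologicalSpace (TotalSpace F₁ E₁)] [∀ x, TopologicalSpace (E₁ x)]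
    [∀ x, AddCommGroup (E₁ x)] [∀ x, Module ℝ (E₁ x)] [FiberBundle F₁ E₁] [VectorBundle ℝ F₁ E₁]
    [ContMDiffVectorBundle ∞ F₁ E₁ (𝓡 d)]
    -- the Lie algebra `𝔰` and the connected Lie group `S` integrating it
    {𝔰 : Type*} [LieRing 𝔰] [LieAlgebra ℝ 𝔰]
    {S : Type*} [TopologicalSpace S] [ChartedSpace (EuclideanSpace ℝ (Fin r)) S] [Group S]
    [LieGroup (𝓡 r) ∞ S] [T2Space S] [ConnectedSpace S]
    (Φ : 𝔰 ≃ₗ[ℝ] GroupLieAlgebra (𝓡 r) S) (hΦ : ∀ s t, Φ ⁅s, t⁆ = ⁅Φ s, Φ t⁆)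
    -- an `𝔰`-equivariant Courant algebroid with a solution of the equations
    (C : CourantAlgebroid n F E) (X : EquivariantStructure 𝔰 C)
    (V : GenPseudometric C) (hV : X.Admissible V)
    (div : Divergence C) (hdiv : X.IsEquivariantDiv div)
    (hsol : StringBackground V div)
    -- a CA-pullback
    (τ : ContMDiffMap (𝓡 m) (𝓡 n) M' M ∞)
    (C' : CourantAlgebroid m F ((τ : M' → M) *ᵖ E)) (H : IsCAPullback τ C C')
    -- a free and proper action of `S` on `M'` integrating the action of `𝔰`
    [MulAction S M'] [ContMDiffSMul (𝓡 r) (𝓡 m) ∞ S M'] [ProperSMul S M'] [IsCancelSMul S M']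
    (hint : IntegratesTo (H.pullEquivariant X) Φ)
    -- the quotient manifold and the reduced Courant algebroid
    (pr : M' → N) (hpr : IsQuotientManifold m d S pr)
    (C₁ : CourantAlgebroid d F₁ E₁) (Q : CAReduction (H.pullEquivariant X) pr C₁) :
    (∃ (div' : Divergence C') (V₁ : GenPseudometric C₁) (div₁ : Divergence C₁),
      IsPullbackDiv div div' ∧ Q.IsReducedMetric (H.pullMetric V) V₁ ∧
        Q.IsReducedDiv div' div₁) ∧
    ∀ (div' : Divergence C') (V₁ : GenPseudometric C₁) (div₁ : Divergence C₁),
      IsPullbackDiv div div' → Q.IsReducedMetric (H.pullMetric V) V₁ →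
        Q.IsReducedDiv div' div₁ → StringBackground V₁ div₁ := by
  -- The Lie algebra of `S` is its tangent space at the identity, a copy of the model space; finite
  -- dimension is needed for the trace argument behind the reduced divergence.
  have hfin : FiniteDimensional ℝ 𝔰 :=
    (Φ.trans (LinearEquiv.refl ℝ (EuclideanSpace ℝ (Fin r)))).symm.finiteDimensional
  have hV' := H.admissible_pull hV
  refine ⟨?_, fun div' V₁ div₁ hdiv' hV₁ hdiv₁ => ?_⟩
  · obtain ⟨div', hdiv'⟩ := H.exists_pullbackDiv div
    obtain ⟨V₁, hV₁⟩ := CAReduction.exists_isReducedMetric (Q := Q) hV' hpr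
    obtain ⟨div₁, hdiv₁⟩ := CAReduction.exists_isReducedDiv (Q := Q)
      (H.isEquivariantDiv_pull hdiv' hdiv) hpr fun h hh => hint.eq_on_orbits hh
    exact ⟨div', V₁, div₁, hdiv', hV₁, hdiv₁⟩
  · exact CAReduction.stringBackground hV' hV₁ hdiv₁ hpr
      (fun a b ha hb => H.GRic_pull_eq_zero hdiv' hsol.1 ha hb)
      fun x k e η he => H.scalarON_eq_zero hdiv' hsol.2 he
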